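/- Let $k$ be a commutative ring and $\mathcal{A}=(A=\bigoplus_{i\in\mathbb{Z}}A^i,d)$ a differential graded (dg) $k$-algebra such that $A^i=0$ for $i<0$, the ring $A^0$ is semisimple, and $d(A^0)=0$. Let $\mathrm{dgMod}$ be the category of dg right $\mathcal{A}$-modules (morphisms: $A$-linear maps of degree $0$ commuting with the differentials) and $\mathrm{dgHot}$ its homotopy category. Write $(\{l\}M)^i=M^{i+l}$ with $d_{\{l\}M}=(-1)^l d_M$. For a simple right $A^0$-module $L$, placed in degree $0$ with zero differential, let $\hat L=L\otimes_{A^0}\mathcal{A}$. Consider the following two full subcategories of $\mathrm{dgHot}$: - $\mathrm{dgFilt}$, whose objects are the dg modules $M$ admitting a finite filtration $0=F_0\subset F_1\subset\dots\subset F_n=M$ by dg submodules such that $F_i/F_{i-1}\cong\{l_i\}\hat L_i$ in $\mathrm{dgMod}$ for suitable integers $l_1\ge l_2\ge\dots\ge l_n$ and simple right $A^0$-modules $L_1,\dots,L_n$; - $\mathrm{dgPer}$, the smallest strict full triangulated subcategory of $\mathrm{dgHot}$ that contains $\mathcal{A}$ and is closed under direct summands. An object is called indecomposable if it is nonzero and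 in each decomposition of it as a direct sum of two objects one of the two summands is zero. A Krull–Remak–Schmidt category is an additive category in which every object is isomorphic to a finite direct sum of objects with local endomorphism rings. Proposition 8.6. 1. Let $M$ be an object of $\mathrm{dgFilt}$ that is indecomposable in $\mathrm{dgMod}$ or in $\mathrm{dgFilt}$. Then every element of $\operatorname{End}_{\mathrm{dgMod}}(M)$ is either an isomorphism or nilpotent, the nilpotent endomorphisms form a two-sided ideal in $\operatorname{End}_{\mathrm{dgMod}}(M)$, and $\operatorname{End}_{\mathrm{dgMod}}(M)$ is a local ring. The same statements hold for $\operatorname{End}_{\mathrm{dgHot}}(N)$ if $N$ is an indecomposable object of $\mathrm{dgPer}$. 2. Every object of $\mathrm{dgFilt}$ is a finite direct sum, both in $\mathrm{dgMod}$ and in $\mathrm{dgFilt}$, of objects of $\mathrm{dgFilt}$ that are indecomposable both in $\mathrm{dgMod}$ and in $\mathrm{dgFilt}$. Every object of $\mathrm{dgPer}$ is a finite direct sum in $\mathrm{dgPer}$ of indecomposable objects of $\mathrm{dgPer}$. 3. $\mathrm{dgFilt}$ and $\mathrm{dgPer}$ are Krull–Remak–Schmidt categories. -/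

import Mathlib

open CategoryTheory CategoryTheory.Limits MulOpposite
open scoped TensorProduct RightActions DirectSum

universe u w

/-! ### Gradings by subgroups -/

/-- A family of subgroups is an (internal) direct sum decomposition as soon as it spans and there
are projections onto its members. -/
theorem isInternal_of_proj {M : Type*} [AddCommGroup M] (gr : ℤ → AddSubgroup M)
    (p : ℤ → M →+ M) (hp : ∀ i, ∀ m ∈ gr i, p i m = m)
    (hp' : ∀ i j, ∀ m ∈ gr j, i ≠ j → p i m = 0) (hs : ∀ m, m ∈ ⨆ i, gr i) :
    DirectSum.IsInternal gr := by
  have key : ∀ (x : ⨁ i, gr i) (i : ℤ), p i (DirectSum.coeAddMonoidHom gr x) = x i := by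
    intro x i
    induction x using DirectSum.induction_on with
    | zero => simp
    | of j y =>
      rw [DirectSum.coeAddMonoidHom_of]
      by_cases h : i = j
      · subst h
        rw [hp _ _ y.2, DirectSum.of_eq_same]
      · rw [hp' i j _ y.2 h, DirectSum.of_eq_of_ne _ _ _ h]
        rfl
    | add x y hx hy => rw [map_add, map_add, hx, hy, DirectSum.add_apply, AddSubgroup.coe_add]
  refine ⟨fun x y hxy => ?_, fun m => ?_⟩
  · ext i
    rw [← key, ← key, hxy]
  · have hm := hs m
    induction hm using AddSubgroup.iSup_induction' with
    | hp i x hx => exact ⟨DirectSum.of (fun i => gr i) i ⟨x, hx⟩, by simp⟩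
    | h1 => exact ⟨0, by simp⟩
    | hadd x y hx hy h1 h2 =>
      obtain ⟨a, rfl⟩ := h1
      obtain ⟨b, rfl⟩ := h2
      exact ⟨a + b, by simp⟩

theorem exists_proj_of_isInternal {M : Type*} [AddCommGroup M] {gr : ℤ → AddSubgroup M}
    (h : DirectSum.IsInternal gr) :
    ∃ p : ℤ → M →+ M, (∀ i m, p i m ∈ gr i) ∧ (∀ i, ∀ m ∈ gr i, p i m = m) ∧
      (∀ i j, ∀ m ∈ gr j, i ≠ j → p i m = 0) := by
  let _ := h.chooseDecomposition
  refine ⟨fun i => AddMonoidHom.mk' (fun m => (DirectSum.decompose gr m i : M)) ?_, ?_, ?_, ?_⟩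
  · intro a b
    simp
  · intro i m
    exact (DirectSum.decompose gr m i).2
  · intro i m hm
    exact DirectSum.decompose_of_mem_same gr hm
  · intro i j m hm hij
    exact DirectSum.decompose_of_mem_ne gr hm (Ne.symm hij)

theorem mem_iSup_of_isInternal {M : Type*} [AddCommGroup M] {gr : ℤ → AddSubgroup M}
    (h : DirectSum.IsInternal gr) (m : M) : m ∈ ⨆ i, gr i := by
  obtain ⟨x, rfl⟩ := h.2 m
  induction x using DirectSum.induction_on with
  | zero => simp
  | of j y =>
    rw [DirectSum.coeAddMonoidHom_of]
    exact AddSubgroup.mem_iSup_of_mem j y.2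
  | add x y hx hy => rw [map_add]; exact add_mem hx hy

/-! ### Differential graded algebras -/

/-- A structure of differential (`ℤ`-)graded `k`-algebra on the `k`-algebra `A`. -/
structure DGAlgebra (k : Type w) (A : Type u) [CommRing k] [Ring A] [Algebra k A] where
  /-- the homogeneous components `A^i` -/
  gr : ℤ → Submodule k A
  graded : GradedAlgebra gr
  /-- the differential -/
  d : A →ₗ[k] A
  d_mem : ∀ {i : ℤ} {a : A}, a ∈ gr i → d a ∈ gr (i + 1)
  d_d : ∀ a, d (d a) = 0
  leibniz : ∀ {i : ℤ} {a : A}, a ∈ gr i → ∀ b, d (a * b) = d a * b + i.negOnePow • (a * d b)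

section

variable {k : Type w} {A : Type u} [CommRing k] [Ring A] [Algebra k A]

instance (𝒜 : DGAlgebra k A) : GradedAlgebra 𝒜.gr := 𝒜.graded

namespace DGAlgebra

/-- The standing conditions: `A` is positively graded, the ring `A^0` is semisimple, and the
differential vanishes on `A^0`. -/
structure IsPosSemisimple (𝒜 : DGAlgebra k A) : Prop where
  pos : ∀ i : ℤ, i < 0 → 𝒜.gr i = ⊥
  semisimple : IsSemisimpleRing (𝒜.gr 0)
  d_zero : ∀ a ∈ 𝒜.gr 0, 𝒜.d a = 0

end DGAlgebra

/-! ### Differential graded modules -/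

/-- A differential graded right module over `𝒜`. (Its `k`-module structure is the one induced from
`k → A`; the Leibniz rule makes `d` automatically `k`-linear.) -/
structure DGMod (𝒜 : DGAlgebra k A) where
  carrier : Type u
  [addCommGroup : AddCommGroup carrier]
  [module : Module Aᵐᵒᵖ carrier]
  /-- the homogeneous components `M^i` -/
  gr : ℤ → AddSubgroup carrier
  internal : DirectSum.IsInternal gr
  smul_mem : ∀ {i j : ℤ} {m : carrier} {a : A}, m ∈ gr i → a ∈ 𝒜.gr j → m <• a ∈ gr (i + j)
  /-- the differential -/
  d : carrier →+ carrier
  d_mem : ∀ {i : ℤ} {m : carrier}, m ∈ gr i → d m ∈ gr (i + 1)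
  d_d : ∀ m, d (d m) = 0
  leibniz : ∀ {i : ℤ} {m : carrier}, m ∈ gr i → ∀ a : A,
    d (m <• a) = d m <• a + i.negOnePow • (m <• 𝒜.d a)

attribute [instance] DGMod.addCommGroup DGMod.module

namespace DGMod

variable {𝒜 : DGAlgebra k A}

/-- Morphisms of dg modules: `A`-linear maps of degree zero that commute with the differentials. -/
@[ext]
structure Hom (M N : DGMod 𝒜) where
  map : M.carrier →ₗ[Aᵐᵒᵖ] N.carrier
  map_mem : ∀ {i : ℤ} {m : M.carrier}, m ∈ M.gr i → map m ∈ N.gr i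
  comm : ∀ m, map (M.d m) = N.d (map m)

/-- The category `dgMod(𝒜)`. -/
instance : Category (DGMod 𝒜) where
  Hom := Hom
  id M := ⟨LinearMap.id, fun h => h, fun _ => rfl⟩
  comp f g := ⟨g.map ∘ₗ f.map, fun h => g.map_mem (f.map_mem h), fun m => by
    simp [f.comm, g.comm]⟩

/-- The underlying linear map of a morphism of dg modules. -/
def lin {M N : DGMod 𝒜} (f : M ⟶ N) : M.carrier →ₗ[Aᵐᵒᵖ] N.carrier := Hom.map f

theorem lin_mem {M N : DGMod 𝒜} (f : M ⟶ N) {i : ℤ} {m : M.carrier} (h : m ∈ M.gr i) :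
    lin f m ∈ N.gr i := Hom.map_mem f h

theorem lin_comm {M N : DGMod 𝒜} (f : M ⟶ N) (m : M.carrier) :
    lin f (M.d m) = N.d (lin f m) := Hom.comm f m

@[simp] theorem lin_id (M : DGMod 𝒜) : lin (𝟙 M) = LinearMap.id := rfl

@[simp] theorem lin_comp {M N P : DGMod 𝒜} (f : M ⟶ N) (g : N ⟶ P) :
    lin (f ≫ g) = lin g ∘ₗ lin f := rfl

theorem lin_injective {M N : DGMod 𝒜} :
    Function.Injective (lin : (M ⟶ N) → (M.carrier →ₗ[Aᵐᵒᵖ] N.carrier)) :=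
  fun _ _ h => Hom.ext h

/-- Build a morphism from its underlying linear map. -/
def ofLin {M N : DGMod 𝒜} (f : M.carrier →ₗ[Aᵐᵒᵖ] N.carrier)
    (h : ∀ {i : ℤ} {m : M.carrier}, m ∈ M.gr i → f m ∈ N.gr i)
    (hd : ∀ m, f (M.d m) = N.d (f m)) : M ⟶ N := Hom.mk f h hd

instance (M N : DGMod 𝒜) : Zero (M ⟶ N) :=
  ⟨ofLin 0 (fun _ => zero_mem _) (fun _ => by simp)⟩

instance (M N : DGMod 𝒜) : Add (M ⟶ N) :=
  ⟨fun f g => ofLin (lin f + lin g) (fun h => add_mem (lin_mem f h) (lin_mem g h))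
    (fun _ => by simp [lin_comm])⟩

instance (M N : DGMod 𝒜) : Neg (M ⟶ N) :=
  ⟨fun f => ofLin (-lin f) (fun h => neg_mem (lin_mem f h)) (fun _ => by simp [lin_comm])⟩

instance (M N : DGMod 𝒜) : Sub (M ⟶ N) :=
  ⟨fun f g => ofLin (lin f - lin g) (fun h => sub_mem (lin_mem f h) (lin_mem g h))
    (fun _ => by simp [lin_comm])⟩

instance (M N : DGMod 𝒜) : SMul ℕ (M ⟶ N) :=
  ⟨fun n f => ofLin (n • lin f) (fun h => nsmul_mem (lin_mem f h) n)
    (fun _ => by simp [lin_comm])⟩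

instance (M N : DGMod 𝒜) : SMul ℤ (M ⟶ N) :=
  ⟨fun n f => ofLin (n • lin f) (fun h => zsmul_mem (lin_mem f h) n)
    (fun _ => by simp [lin_comm])⟩

instance (M N : DGMod 𝒜) : AddCommGroup (M ⟶ N) :=
  lin_injective.addCommGroup lin rfl (fun _ _ => rfl) (fun _ => rfl) (fun _ _ => rfl)
    (fun _ _ => rfl) (fun _ _ => rfl)

@[simp] theorem lin_add {M N : DGMod 𝒜} (f g : M ⟶ N) : lin (f + g) = lin f + lin g := rfl

@[simp] theorem lin_zero {M N : DGMod 𝒜} : lin (0 : M ⟶ N) = 0 := rfl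

instance : Preadditive (DGMod 𝒜) where
  add_comp _ _ _ f f' g := lin_injective (by simp [LinearMap.comp_add])
  comp_add _ _ _ f g g' := lin_injective (by simp [LinearMap.add_comp])

/-! ### The homotopy category -/

/-- Two morphisms of dg modules are homotopic if their difference is `d h + h d` for some
`A`-linear map `h` of degree `-1`. -/
def Homotopic : HomRel (DGMod 𝒜) := fun M N f g =>
  ∃ h : M.carrier →ₗ[Aᵐᵒᵖ] N.carrier, (∀ (i : ℤ), ∀ m ∈ M.gr i, h m ∈ N.gr (i - 1)) ∧
    ∀ m, lin f m = lin g m + (N.d (h m) + h (M.d m))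

theorem Homotopic.add {M N : DGMod 𝒜} (f₁ f₂ g₁ g₂ : M ⟶ N) (hf : Homotopic f₁ f₂)
    (hg : Homotopic g₁ g₂) : Homotopic (f₁ + g₁) (f₂ + g₂) := by
  obtain ⟨s, hs, hs'⟩ := hf
  obtain ⟨t, ht, ht'⟩ := hg
  refine ⟨s + t, fun i m hm => add_mem (hs i m hm) (ht i m hm), fun m => ?_⟩
  simp only [lin_add, LinearMap.add_apply, hs', ht', map_add]
  abel

instance : Congruence (Homotopic (𝒜 := 𝒜)) where
  equivalence := by
    intro M N
    refine ⟨fun f => ⟨0, fun _ _ _ => zero_mem _, fun m => by simp⟩, ?_, ?_⟩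
    · rintro f g ⟨h, hd, hh⟩
      refine ⟨-h, fun i m hm => neg_mem (hd i m hm), fun m => ?_⟩
      simp only [hh, LinearMap.neg_apply, map_neg]
      abel
    · rintro f g e ⟨h, hd, hh⟩ ⟨h₂, hd₂, hh₂⟩
      refine ⟨h + h₂, fun i m hm => add_mem (hd i m hm) (hd₂ i m hm), fun m => ?_⟩
      simp only [hh, hh₂, LinearMap.add_apply, map_add]
      abel
  comp_left := by
    rintro M N P f g g' ⟨h, hd, hh⟩
    exact ⟨h ∘ₗ lin f, fun i m hm => hd i _ (lin_mem f hm), fun m => by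
      simp [hh, lin_comm]⟩
  comp_right := by
    rintro M N P f f' g ⟨h, hd, hh⟩
    exact ⟨lin g ∘ₗ h, fun i m hm => lin_mem g (hd i _ hm), fun m => by
      simp [hh, lin_comm]⟩

end DGMod

/-- The homotopy category `dgHot(𝒜)`: dg modules, and homotopy classes of morphisms. -/
abbrev DGHot (𝒜 : DGAlgebra k A) := CategoryTheory.Quotient (DGMod.Homotopic (𝒜 := 𝒜))

instance (𝒜 : DGAlgebra k A) : Preadditive (DGHot 𝒜) :=
  CategoryTheory.Quotient.preadditive _ (fun _ _ => DGMod.Homotopic.add)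

/-- The canonical functor `dgMod(𝒜) ⥤ dgHot(𝒜)`, the identity on objects. -/
abbrev DGHot.functor (𝒜 : DGAlgebra k A) : DGMod 𝒜 ⥤ DGHot 𝒜 :=
  CategoryTheory.Quotient.functor _

namespace DGMod

variable {𝒜 : DGAlgebra k A}

/-! ### Constructions with dg modules -/

/-- `𝒜` as a dg right module over itself. -/
def ofAlgebra (𝒜 : DGAlgebra k A) : DGMod 𝒜 where
  carrier := A
  gr i := (𝒜.gr i).toAddSubgroup
  internal := DirectSum.Decomposition.isInternal 𝒜.gr
  smul_mem hm ha := SetLike.mul_mem_graded (A := 𝒜.gr) hm ha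
  d := 𝒜.d.toAddMonoidHom
  d_mem := 𝒜.d_mem
  d_d := 𝒜.d_d
  leibniz := 𝒜.leibniz

/-- The shift `{n}M`: `({n}M)^i = M^(i+n)`, with differential `(-1)^n d`. -/
def shift (n : ℤ) (M : DGMod 𝒜) : DGMod 𝒜 where
  carrier := M.carrier
  gr i := M.gr (i + n)
  internal := by
    obtain ⟨p, hm, h1, h2⟩ := exists_proj_of_isInternal M.internal
    refine isInternal_of_proj _ (fun i => p (i + n)) (fun i => h1 (i + n))
      (fun i j m hm hij => h2 _ _ m hm (by omega)) (fun m => ?_)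
    have := mem_iSup_of_isInternal M.internal m
    rwa [← (Equiv.addRight n).iSup_comp (g := M.gr)] at this
  smul_mem {i j m a} hm ha := by
    have := M.smul_mem hm ha
    rwa [show i + n + j = i + j + n by ring] at this
  d := n.negOnePow • M.d
  d_mem {i m} hm := by
    have h := M.d_mem hm
    rw [show i + n + 1 = i + 1 + n by ring] at h
    rcases Int.even_or_odd n with hn | hn
    · simpa [Int.negOnePow_even n hn] using h
    · simpa [Int.negOnePow_odd n hn] using h
  d_d m := by
    rcases Int.even_or_odd n with hn | hn
    · simp [Int.negOnePow_even n hn, M.d_d]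
    · simp [Int.negOnePow_odd n hn, M.d_d]
  leibniz {i m} hm a := by
    have h := M.leibniz hm a
    rcases Int.even_or_odd n with hn | hn
    · simpa [Int.negOnePow_add, Int.negOnePow_even n hn] using h
    · simp only [Int.negOnePow_add, Int.negOnePow_odd n hn] at h ⊢
      simp [h]
      abel

/-- The mapping cone of `f : M ⟶ N`: `cone(f)^i = N^i ⊕ M^(i+1)`, with differential
`(n, m) ↦ (d n + f m, - d m)`. -/
def cone {M N : DGMod 𝒜} (f : M ⟶ N) : DGMod 𝒜 where
  carrier := N.carrier × M.carrier
  gr i := (N.gr i).prod (M.gr (i + 1))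
  internal := by
    obtain ⟨p, hp, h1, h2⟩ := exists_proj_of_isInternal N.internal
    obtain ⟨q, hq, h1', h2'⟩ := exists_proj_of_isInternal M.internal
    refine isInternal_of_proj _ (fun i => (p i).prodMap (q (i + 1))) ?_ ?_ ?_
    · rintro i ⟨x, y⟩ ⟨hx, hy⟩
      exact Prod.ext (h1 _ _ hx) (h1' _ _ hy)
    · rintro i j ⟨x, y⟩ ⟨hx, hy⟩ hij
      exact Prod.ext (h2 _ _ _ hx hij) (h2' _ _ _ hy (by omega))
    · rintro ⟨x, y⟩
      have hx : ((x, 0) : N.carrier × M.carrier) ∈ ⨆ i, (N.gr i).prod (M.gr (i + 1)) := by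
        have := mem_iSup_of_isInternal N.internal x
        have h : (⨆ i, N.gr i) ≤ (⨆ i, (N.gr i).prod (M.gr (i + 1))).comap
            (AddMonoidHom.inl N.carrier M.carrier) :=
          iSup_le fun i z hz => AddSubgroup.mem_iSup_of_mem i ⟨hz, zero_mem _⟩
        exact h this
      have hy : ((0, y) : N.carrier × M.carrier) ∈ ⨆ i, (N.gr i).prod (M.gr (i + 1)) := by
        have := mem_iSup_of_isInternal M.internal y
        have h : (⨆ i, M.gr i) ≤ (⨆ i, (N.gr i).prod (M.gr (i + 1))).comap
            (AddMonoidHom.inr N.carrier M.carrier) :=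
          iSup_le fun i z hz => AddSubgroup.mem_iSup_of_mem (i - 1)
            ⟨zero_mem _, by simpa using hz⟩
        exact h this
      simpa using add_mem hx hy
  smul_mem {i j m a} hm ha := by
    refine ⟨N.smul_mem hm.1 ha, ?_⟩
    have := M.smul_mem hm.2 ha
    rwa [show i + 1 + j = i + j + 1 by ring] at this
  d := AddMonoidHom.mk' (fun x => (N.d x.1 + lin f x.2, - M.d x.2)) (fun x y => by
    ext
    · simp only [Prod.fst_add, Prod.snd_add, map_add]; abel
    · simp only [Prod.snd_add, map_add]; abel)
  d_mem {i m} hm := 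
    ⟨add_mem (N.d_mem hm.1) (lin_mem f hm.2), (M.gr (i + 1 + 1)).neg_mem (M.d_mem hm.2)⟩
  d_d m := by
    ext
    · simp [N.d_d, lin_comm]
    · simp [M.d_d]
  leibniz {i m} hm a := by
    ext
    · have h := N.leibniz hm.1 a
      simp only [AddMonoidHom.mk'_apply, Prod.smul_fst, Prod.smul_snd, Prod.fst_add, h, map_smul,
        smul_add]
      abel
    · have h := M.leibniz hm.2 a
      simp only [AddMonoidHom.mk'_apply, Prod.smul_snd, Prod.snd_add, h, smul_neg,
        Int.negOnePow_succ, Units.neg_smul]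
      abel

/-- A dg submodule of `M`: a graded `A`-submodule stable under the differential. -/
structure DGSubmodule (M : DGMod 𝒜) extends Submodule Aᵐᵒᵖ M.carrier where
  homogeneous : ∀ m ∈ toSubmodule, m ∈ ⨆ i, M.gr i ⊓ toSubmodule.toAddSubgroup
  d_mem : ∀ m ∈ toSubmodule, M.d m ∈ toSubmodule

/-- A dg submodule, considered as a dg module. -/
def DGSubmodule.toDGMod {M : DGMod 𝒜} (F : DGSubmodule M) : DGMod 𝒜 where
  carrier := F.toSubmodule
  gr i := (M.gr i).comap F.toSubmodule.toAddSubgroup.subtype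
  internal := by
    obtain ⟨p, hp, h1, h2⟩ := exists_proj_of_isInternal M.internal
    have hF : ∀ i, ∀ m ∈ F.toSubmodule, p i m ∈ F.toSubmodule := by
      intro i m hm
      have h := F.homogeneous m hm
      have h' : (⨆ i, M.gr i ⊓ F.toSubmodule.toAddSubgroup) ≤
          F.toSubmodule.toAddSubgroup.comap (p i) := by
        refine iSup_le fun j z hz => ?_
        change p i z ∈ F.toSubmodule
        by_cases hij : i = j
        · subst hij
          rw [h1 _ _ hz.1]
          exact hz.2
        · rw [h2 _ _ _ hz.1 hij]
          exact zero_mem _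
      exact h' h
    refine isInternal_of_proj _ (fun i => AddMonoidHom.mk'
      (fun m => (⟨p i m, hF i m m.2⟩ : F.toSubmodule)) (fun a b => by ext; simp)) ?_ ?_ ?_
    · intro i m hm
      exact Subtype.ext (h1 _ _ hm)
    · intro i j m hm hij
      exact Subtype.ext (h2 _ _ _ hm hij)
    · rintro ⟨m, hm⟩
      have h := F.homogeneous m hm
      have h' : (⨆ i, M.gr i ⊓ F.toSubmodule.toAddSubgroup) ≤
          (⨆ i, (M.gr i).comap F.toSubmodule.toAddSubgroup.subtype).map
            F.toSubmodule.toAddSubgroup.subtype :=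
        iSup_le fun i z hz => ⟨⟨z, hz.2⟩, AddSubgroup.mem_iSup_of_mem i hz.1, rfl⟩
      obtain ⟨y, hy, hy'⟩ := h' h
      have : y = ⟨m, hm⟩ := Subtype.ext hy'
      exact this ▸ hy
  smul_mem hm ha := M.smul_mem hm ha
  d := AddMonoidHom.mk' (fun m => ⟨M.d m, F.d_mem m m.2⟩) (fun a b => by ext; simp)
  d_mem hm := M.d_mem hm
  d_d m := Subtype.ext (M.d_d m)
  leibniz {i m} hm a := Subtype.ext (by
    have h := M.leibniz (i := i) (m := (m : M.carrier)) hm a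
    rcases Int.even_or_odd i with hn | hn
    · simpa [Int.negOnePow_even i hn] using h
    · simpa [Int.negOnePow_odd i hn] using h)

/-! ### The dg modules `L ⊗_{A^0} A` -/

section Hat

variable (𝒜) (L : Type u) [AddCommGroup L] [Module (𝒜.gr 0)ᵐᵒᵖ L]

/-- The relations `l ⊗ a₀ a = l a₀ ⊗ a` (`a₀ ∈ A^0`). Here and below, `l ⊗ a` is written with
the two factors exchanged, as `a ⊗ₜ l`, so that the right action of `A` on `A` induces the
right action of `A` on the tensor product. -/
def hatRelSet : Set (A ⊗[ℤ] L) :=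
  {t | ∃ (a₀ : 𝒜.gr 0) (a : A) (l : L), t = ((a₀ : A) * a) ⊗ₜ[ℤ] l - a ⊗ₜ[ℤ] (l <• a₀)}

/-- The submodule generated by the relations defining `L ⊗_{A^0} A`. -/
def hatRel : Submodule Aᵐᵒᵖ (A ⊗[ℤ] L) where
  carrier := AddSubgroup.closure (hatRelSet 𝒜 L)
  zero_mem' := zero_mem _
  add_mem' := add_mem
  smul_mem' b t ht := by
    induction ht using AddSubgroup.closure_induction with
    | mem x hx =>
      obtain ⟨a₀, a, l, rfl⟩ := hx
      refine AddSubgroup.subset_closure ⟨a₀, a * b.unop, l, ?_⟩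
      rw [smul_sub, TensorProduct.smul_tmul', TensorProduct.smul_tmul', MulOpposite.smul_eq_mul_unop,
        MulOpposite.smul_eq_mul_unop, mul_assoc]
    | zero => simp
    | add x y _ _ hx hy => rw [smul_add]; exact add_mem hx hy
    | neg x _ hx => rw [smul_neg]; exact neg_mem hx

/-- The right `A`-module `L ⊗_{A^0} A`. -/
abbrev HatCarrier : Type u := (A ⊗[ℤ] L) ⧸ hatRel 𝒜 L

variable {L} in
/-- The pure tensor `l ⊗ a` in `L ⊗_{A^0} A`. -/
def hatMk (l : L) (a : A) : HatCarrier 𝒜 L := (hatRel 𝒜 L).mkQ (a ⊗ₜ[ℤ] l)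

/-- The map `l ⊗ a ↦ l ⊗ φ a` induced by an additive map `φ` that commutes with left
multiplication by elements of `A^0`. -/
def hatMap (φ : A →+ A) (hφ : ∀ a₀ ∈ 𝒜.gr 0, ∀ a, φ (a₀ * a) = a₀ * φ a) :
    HatCarrier 𝒜 L →+ HatCarrier 𝒜 L :=
  QuotientAddGroup.map (hatRel 𝒜 L).toAddSubgroup (hatRel 𝒜 L).toAddSubgroup
    (LinearMap.rTensor L φ.toIntLinearMap).toAddMonoidHom (by
      intro t ht
      change t ∈ AddSubgroup.closure (hatRelSet 𝒜 L) at ht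
      change LinearMap.rTensor L φ.toIntLinearMap t ∈ AddSubgroup.closure (hatRelSet 𝒜 L)
      induction ht using AddSubgroup.closure_induction with
      | mem x hx =>
        obtain ⟨a₀, a, l, rfl⟩ := hx
        refine AddSubgroup.subset_closure ⟨a₀, φ a, l, ?_⟩
        simp [hφ _ a₀.2]
      | zero => simp
      | add x y _ _ hx hy => rw [map_add]; exact add_mem hx hy
      | neg x _ hx => rw [map_neg]; exact neg_mem hx)

@[simp] theorem hatMap_mk (φ : A →+ A) (hφ : ∀ a₀ ∈ 𝒜.gr 0, ∀ a, φ (a₀ * a) = a₀ * φ a)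
    (l : L) (a : A) : hatMap 𝒜 L φ hφ (hatMk 𝒜 l a) = hatMk 𝒜 l (φ a) := rfl

variable {𝒜 L}

theorem hatMk_add (l : L) (a b : A) : hatMk 𝒜 l (a + b) = hatMk 𝒜 l a + hatMk 𝒜 l b := by
  simp [hatMk, TensorProduct.add_tmul]

theorem hatMk_smul (l : L) (a b : A) : hatMk 𝒜 l a <• b = hatMk 𝒜 l (a * b) := rfl

theorem hatMk_mul (l : L) (a₀ : 𝒜.gr 0) (a : A) :
    hatMk 𝒜 l ((a₀ : A) * a) = hatMk 𝒜 (l <• a₀) a := by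
  refine (Submodule.Quotient.eq _).2 ?_
  exact AddSubgroup.subset_closure ⟨a₀, a, l, rfl⟩

theorem hat_induction {P : HatCarrier 𝒜 L → Prop} (h0 : P 0)
    (hmk : ∀ l a, P (hatMk 𝒜 l a)) (hadd : ∀ x y, P x → P y → P (x + y)) (x : HatCarrier 𝒜 L) :
    P x := by
  obtain ⟨t, rfl⟩ := (hatRel 𝒜 L).mkQ_surjective x
  induction t using TensorProduct.induction_on with
  | zero => simpa using h0
  | tmul a l => exact hmk l a
  | add x y hx hy => rw [map_add]; exact hadd _ _ hx hy

variable (𝒜 L)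

/-- The degree `i` component of `L ⊗_{A^0} A`: it is spanned by the `l ⊗ a` with `a ∈ A^i`. -/
def hatGr (i : ℤ) : AddSubgroup (HatCarrier 𝒜 L) :=
  AddSubgroup.closure {t | ∃ (l : L) (a : A), a ∈ 𝒜.gr i ∧ t = hatMk 𝒜 l a}

/-- The dg module `L ⊗_{A^0} A`, for `L` a right `A^0`-module placed in degree zero; the
differential is `l ⊗ a ↦ l ⊗ d a`. -/
def hat (h : 𝒜.IsPosSemisimple) : DGMod 𝒜 where
  carrier := HatCarrier 𝒜 L
  gr := hatGr 𝒜 L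
  internal := by
    refine isInternal_of_proj _ (fun i => hatMap 𝒜 L (GradedRing.proj 𝒜.gr i) ?_) ?_ ?_ ?_
    · intro a₀ h₀ a
      simp only [GradedRing.proj_apply]
      exact DirectSum.coe_decompose_mul_of_left_mem_zero 𝒜.gr h₀
    · intro i m hm
      induction hm using AddSubgroup.closure_induction with
      | mem x hx =>
        obtain ⟨l, a, ha, rfl⟩ := hx
        rw [hatMap_mk, GradedRing.proj_apply, DirectSum.decompose_of_mem_same _ ha]
      | zero => simp
      | add x y _ _ hx hy => rw [map_add, hx, hy]
      | neg x _ hx => rw [map_neg, hx]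
    · intro i j m hm hij
      induction hm using AddSubgroup.closure_induction with
      | mem x hx =>
        obtain ⟨l, a, ha, rfl⟩ := hx
        rw [hatMap_mk, GradedRing.proj_apply, DirectSum.decompose_of_mem_ne _ ha (Ne.symm hij)]
        simp [hatMk]
      | zero => simp
      | add x y _ _ hx hy => rw [map_add, hx, hy, add_zero]
      | neg x _ hx => rw [map_neg, hx, neg_zero]
    · intro m
      induction m using hat_induction with
      | h0 => exact zero_mem _
      | hmk l a =>
        induction a using DirectSum.Decomposition.inductionOn 𝒜.gr with
        | zero => simp [hatMk]
        | homogeneous a =>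
          exact AddSubgroup.mem_iSup_of_mem _ (AddSubgroup.subset_closure ⟨l, _, a.2, rfl⟩)
        | add a b ha hb => rw [hatMk_add]; exact add_mem ha hb
      | hadd x y hx hy => exact add_mem hx hy
  smul_mem {i j m a} hm ha := by
    induction hm using AddSubgroup.closure_induction with
    | mem x hx =>
      obtain ⟨l, b, hb, rfl⟩ := hx
      exact AddSubgroup.subset_closure ⟨l, b * a, SetLike.mul_mem_graded hb ha, rfl⟩
    | zero => rw [smul_zero]; exact zero_mem _
    | add x y _ _ hx hy => rw [smul_add]; exact add_mem hx hy
    | neg x _ hx => rw [smul_neg]; exact neg_mem hx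
  d := hatMap 𝒜 L 𝒜.d.toAddMonoidHom (by
    intro a₀ h₀ a
    have := 𝒜.leibniz h₀ a
    simpa [h.d_zero _ h₀] using this)
  d_mem {i m} hm := by
    induction hm using AddSubgroup.closure_induction with
    | mem x hx =>
      obtain ⟨l, b, hb, rfl⟩ := hx
      exact AddSubgroup.subset_closure ⟨l, 𝒜.d b, 𝒜.d_mem hb, rfl⟩
    | zero => rw [map_zero]; exact zero_mem _
    | add x y _ _ hx hy => rw [map_add]; exact add_mem hx hy
    | neg x _ hx => rw [map_neg]; exact neg_mem hx
  d_d m := by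
    induction m using hat_induction with
    | h0 => simp
    | hmk l a =>
      simp only [hatMap_mk, LinearMap.toAddMonoidHom_coe, 𝒜.d_d]
      simp [hatMk]
    | hadd x y hx hy => rw [map_add, map_add, hx, hy, add_zero]
  leibniz {i m} hm a := by
    induction hm using AddSubgroup.closure_induction with
    | mem x hx =>
      obtain ⟨l, b, hb, rfl⟩ := hx
      have hl := 𝒜.leibniz hb a
      simp only [hatMk_smul, hatMap_mk, LinearMap.toAddMonoidHom_coe, hl, hatMk_add]
      rcases Int.even_or_odd i with hn | hn
      · simp [Int.negOnePow_even i hn]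
      · simp [Int.negOnePow_odd i hn, hatMk, TensorProduct.neg_tmul]
    | zero => simp
    | add x y _ _ hx hy =>
      simp only [smul_add, map_add, hx, hy]
      abel
    | neg x _ hx =>
      simp only [smul_neg, map_neg, hx]
      abel

end Hat

/-! ### The categories `dgFilt` and `dgPer` -/

/-- For dg submodules `F ⊆ G` of `M`: the subquotient `G/F` is isomorphic in `dgMod(𝒜)` to
`{l}(L ⊗_{A^0} A)` for some simple right `A^0`-module `L`, i.e. there is a surjective morphism
of dg modules `G ⟶ {l}(L ⊗_{A^0} A)` with kernel `F`. -/
def IsSimpleHatSubquotient (h : 𝒜.IsPosSemisimple) {M : DGMod 𝒜} (F G : DGSubmodule M) (l : ℤ) :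
    Prop :=
  F.toSubmodule ≤ G.toSubmodule ∧
    ∃ (L : Type u) (_ : AddCommGroup L) (_ : Module (𝒜.gr 0)ᵐᵒᵖ L),
      IsSimpleModule (𝒜.gr 0)ᵐᵒᵖ L ∧
      ∃ π : G.toDGMod ⟶ shift l (hat 𝒜 L h), Function.Surjective (lin π) ∧
        ∀ m : G.toSubmodule, lin π m = 0 ↔ (m : M.carrier) ∈ F.toSubmodule

/-- `M` admits a finite filtration `0 = F_0 ⊆ F_1 ⊆ ⋯ ⊆ F_n = M` by dg submodules with
`F_i / F_{i-1} ≅ {l_i}(L_i ⊗_{A^0} A)`, where the `L_i` are simple right `A^0`-modules and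
`l_1 ≥ l_2 ≥ ⋯ ≥ l_n`. -/
def HasHatFiltration (h : 𝒜.IsPosSemisimple) (M : DGMod 𝒜) : Prop :=
  ∃ (n : ℕ) (F : Fin (n + 1) → DGSubmodule M) (l : Fin n → ℤ),
    (F 0).toSubmodule = ⊥ ∧ (F (Fin.last n)).toSubmodule = ⊤ ∧ Antitone l ∧
      ∀ i : Fin n, IsSimpleHatSubquotient h (F i.castSucc) (F i.succ) (l i)

end DGMod

/-! ### Additive categories -/

section Additive

variable {C : Type*} [Category C] [Preadditive C]

/-- `X` is the direct sum of the finite family `Y`. -/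
def IsFiniteDirectSum {n : ℕ} (X : C) (Y : Fin n → C) : Prop :=
  ∃ b : Bicone Y, Nonempty b.IsBilimit ∧ Nonempty (X ≅ b.pt)

/-- `X` is the direct sum of `Y` and `Z`. -/
def IsBinaryDirectSum (X Y Z : C) : Prop :=
  ∃ b : BinaryBicone Y Z, Nonempty b.IsBilimit ∧ Nonempty (X ≅ b.pt)

/-- `X` is indecomposable: it is nonzero, and in every decomposition `X ≅ Y ⊕ Z` one of the
summands is zero. -/
def IsIndecomposable (X : C) : Prop :=
  ¬ IsZero X ∧ ∀ Y Z : C, IsBinaryDirectSum X Y Z → IsZero Y ∨ IsZero Z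

/-- Every endomorphism of `X` is an isomorphism or nilpotent, the nilpotent endomorphisms form a
two-sided ideal, and the endomorphism ring is local. -/
def HasFittingEnd (X : C) : Prop :=
  (∀ f : End X, IsIso (f : X ⟶ X) ∨ IsNilpotent f) ∧
    (∃ I : TwoSidedIdeal (End X), ∀ f : End X, f ∈ I ↔ IsNilpotent f) ∧
    IsLocalRing (End X)

variable (C) in
/-- A Krull-Remak-Schmidt category: an additive category in which every object is a finite direct
sum of objects with local endomorphism rings. -/
structure IsKrullRemakSchmidt : Prop where
  hasFiniteBiproducts : HasFiniteBiproducts C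
  exists_decomposition : ∀ X : C, ∃ (n : ℕ) (Y : Fin n → C),
    (∀ i, IsLocalRing (End (Y i))) ∧ IsFiniteDirectSum X Y

end Additive

/-- The full subcategory of `dgHot(𝒜)` on the objects satisfying `P` is a strict triangulated
subcategory: `P` is invariant under isomorphisms, nonempty, stable under all shifts, and contains
the cone of `f` (the third vertex of the standard distinguished triangle on `f`) whenever it
contains the source and the target of `f`. -/
structure IsTriangulatedSubcategory {𝒜 : DGAlgebra k A} (P : ObjectProperty (DGHot 𝒜)) :
    Prop where
  of_iso : ∀ X Y : DGHot 𝒜, (X ≅ Y) → P X → P Y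
  nonempty : ∃ X, P X
  shift : ∀ (n : ℤ) (M : DGMod 𝒜),
    P ((DGHot.functor 𝒜).obj M) → P ((DGHot.functor 𝒜).obj (M.shift n))
  cone : ∀ (M N : DGMod 𝒜) (f : M ⟶ N), P ((DGHot.functor 𝒜).obj M) →
    P ((DGHot.functor 𝒜).obj N) → P ((DGHot.functor 𝒜).obj (DGMod.cone f))

/-- The objects of `dgPer(𝒜)`: those of the smallest full triangulated subcategory of `dgHot(𝒜)`
that contains `𝒜` and is closed under taking direct summands. -/
def dgPer (𝒜 : DGAlgebra k A) : ObjectProperty (DGHot 𝒜) := fun X =>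
  ∀ P : ObjectProperty (DGHot 𝒜), IsTriangulatedSubcategory P →
    (∀ Y Z W : DGHot 𝒜, IsBinaryDirectSum Y Z W → P Y → P Z) →
    P ((DGHot.functor 𝒜).obj (DGMod.ofAlgebra 𝒜)) → P X

/-- The objects of `dgFilt(𝒜)`, as a full subcategory of `dgHot(𝒜)`. -/
def dgFilt {𝒜 : DGAlgebra k A} (h : 𝒜.IsPosSemisimple) : ObjectProperty (DGHot 𝒜) := fun X =>
  DGMod.HasHatFiltration h X.as

end

/-! Write `M.plus` for the submodule M A⁺. The proof replaces the existence of a filtration by the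
condition `IsHatFiltered`: M is finitely generated and projective over A, and a submodule that
contains every M^i with i < j, and every x in M^j whose differential it contains, contains all of
M^j. The two conditions are equivalent (`hasHatFiltration_iff`). Given a filtration, the generators
of the layers sit in increasing degrees -l_i and their differentials lie in earlier layers.
Conversely, the cycles of lowest degree contain a simple A⁰-module L, and L ⊗ A splits off as a
graded summand; the quotient is again of this kind and M / M A⁺ becomes shorter. Unlike a
filtration, the condition visibly passes to direct summands. It also forces d M ⊆ M A⁺, so by the
graded Nakayama lemma a contractible filtered module is zero; thus passing to the homotopy category
loses no summands.

The engine is a Fitting lemma (`exists_fitting`). For an endomorphism f of a filtered M, the module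
M / M A⁺ has finite length because A⁰ is semisimple, so some power of the induced map has a group
inverse there. Projectivity lifts this inverse to a degree-zero A-linear map on M. The resulting
errors land in M A⁺ and hence lower the degree of generation, which takes finitely many values; so
after finitely many steps the kernels and images of the powers of f stabilise. The group inverse of
that power commutes with d and with the grading, so End(M) in dgMod is strongly π-regular
(`IsHatFiltered.isStronglyPiRegular`). Three things follow: an endomorphism ring without nontrivial
idempotents consists of units and nilpotents, hence is local with the nilpotents as an ideal;
idempotents lift along the surjection from dgMod to dgHot; and, as idempotents in dgMod split
through their images, so do idempotents of filtered modules in dgHot. Decompositions terminate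
because the length of M / M A⁺ drops.

For dgPer, one shows that homotopy retracts of filtered modules contain A and are stable under
shifts, cones and summands. For cones, dévissage reduces to a map from a shifted L ⊗ A to a filtered
N. As L is simple, either its generators map into N A⁺ and the cone is filtered, or the map is a
graded-split monomorphism and the cone is a homotopy retract of the cokernel, which is filtered.
Since idempotents split, every object of dgPer is then isomorphic in dgHot to a filtered module
(`IsFilteredRetract.exists_iso`), and everything transfers. -/

namespace DGMod

variable {k : Type w} {A : Type u} [CommRing k] [Ring A] [Algebra k A] {𝒜 : DGAlgebra k A}

/-! ### Homogeneous components -/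

/-- The projection of a dg module onto its homogeneous component of degree `i`. -/
noncomputable def proj (M : DGMod 𝒜) : ℤ → M.carrier →+ M.carrier :=
  (exists_proj_of_isInternal M.internal).choose

theorem proj_mem (M : DGMod 𝒜) (i : ℤ) (m : M.carrier) : M.proj i m ∈ M.gr i :=
  (exists_proj_of_isInternal M.internal).choose_spec.1 i m

theorem proj_of_mem (M : DGMod 𝒜) {i : ℤ} {m : M.carrier} (hm : m ∈ M.gr i) : M.proj i m = m :=
  (exists_proj_of_isInternal M.internal).choose_spec.2.1 i m hm

theorem proj_of_mem_ne (M : DGMod 𝒜) {i j : ℤ} {m : M.carrier} (hm : m ∈ M.gr j) (h : i ≠ j) :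
    M.proj i m = 0 :=
  (exists_proj_of_isInternal M.internal).choose_spec.2.2 i j m hm h

theorem homogeneous_induction (M : DGMod 𝒜) {P : M.carrier → Prop}
    (hom : ∀ i, ∀ m ∈ M.gr i, P m) (add : ∀ x y, P x → P y → P (x + y)) (m : M.carrier) : P m := by
  induction mem_iSup_of_isInternal M.internal m using AddSubgroup.iSup_induction' with
  | hp i x hx => exact hom i x hx
  | h1 => exact hom 0 0 (zero_mem _)
  | hadd x y _ _ hx hy => exact add x y hx hy

theorem exists_sum_proj (M : DGMod 𝒜) (m : M.carrier) :
    ∃ s : Finset ℤ, (∀ i, i ∉ s → M.proj i m = 0) ∧ m = ∑ i ∈ s, M.proj i m := by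
  classical
  suffices ∃ s : Finset ℤ, (∀ i, i ∉ s → M.proj i m = 0) ∧
      ∀ t, s ⊆ t → m = ∑ i ∈ t, M.proj i m by
    obtain ⟨s, hs, h⟩ := this
    exact ⟨s, hs, h s subset_rfl⟩
  induction m using M.homogeneous_induction with
  | hom i m hm =>
    refine ⟨{i}, fun j hj => M.proj_of_mem_ne hm (by simpa using hj), fun t ht => ?_⟩
    rw [Finset.sum_eq_single i (fun j _ hj => M.proj_of_mem_ne hm hj), M.proj_of_mem hm]
    exact fun hi => (hi (ht (by simp))).elim
  | add x y hx hy =>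
    obtain ⟨s, hs, hs'⟩ := hx
    obtain ⟨t, ht, ht'⟩ := hy
    refine ⟨s ∪ t, fun i hi => ?_, fun r hr => ?_⟩
    · rw [Finset.notMem_union] at hi
      rw [map_add, hs i hi.1, ht i hi.2, add_zero]
    · simp only [map_add, Finset.sum_add_distrib]
      rw [← hs' r (Finset.union_subset_left hr), ← ht' r (Finset.union_subset_right hr)]

theorem eq_zero_of_proj (M : DGMod 𝒜) {m : M.carrier} (h : ∀ i, M.proj i m = 0) : m = 0 := by
  obtain ⟨s, -, hs⟩ := M.exists_sum_proj m
  rw [hs]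
  exact Finset.sum_eq_zero fun i _ => h i

theorem mem_of_proj (M : DGMod 𝒜) {S : Type*} [SetLike S M.carrier] [AddSubmonoidClass S M.carrier]
    (F : S) {m : M.carrier} (h : ∀ i, M.proj i m ∈ F) : m ∈ F := by
  obtain ⟨s, -, hs⟩ := M.exists_sum_proj m
  rw [hs]
  exact sum_mem fun i _ => h i

theorem lin_proj {M N : DGMod 𝒜} (f : M.carrier →+ N.carrier) (e : ℤ)
    (hf : ∀ i, ∀ m ∈ M.gr i, f m ∈ N.gr (i + e)) (i : ℤ) (m : M.carrier) :
    f (M.proj i m) = N.proj (i + e) (f m) := by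
  induction m using M.homogeneous_induction with
  | hom j m hm =>
    by_cases h : i = j
    · subst h
      rw [M.proj_of_mem hm, N.proj_of_mem (hf _ _ hm)]
    · rw [M.proj_of_mem_ne hm h, N.proj_of_mem_ne (hf _ _ hm) (by omega), map_zero]
  | add x y hx hy => simp only [map_add, hx, hy]

theorem proj_lin {M N : DGMod 𝒜} (f : M ⟶ N) (i : ℤ) (m : M.carrier) :
    N.proj i (lin f m) = lin f (M.proj i m) := by
  have := lin_proj (N := N) (lin f).toAddMonoidHom 0
    (fun j m hm => by simpa using lin_mem f hm) i m
  simpa using this.symm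

theorem proj_smul (M : DGMod 𝒜) (m : M.carrier) {s : ℤ} {a : A} (ha : a ∈ 𝒜.gr s) (j : ℤ) :
    M.proj j (m <• a) = M.proj (j - s) m <• a := by
  induction m using M.homogeneous_induction with
  | hom i m hm =>
    have hma := M.smul_mem hm ha
    by_cases h : j - s = i
    · subst h
      rw [sub_add_cancel] at hma
      rw [M.proj_of_mem hm, M.proj_of_mem hma]
    · rw [M.proj_of_mem_ne hm h, M.proj_of_mem_ne hma (by omega), smul_zero]
  | add x y hx hy => simp only [map_add, smul_add, hx, hy]

/-- An additive map that is linear for homogeneous scalars is linear. -/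
def linearOfHomogeneous {X Y : Type*} [AddCommGroup X] [AddCommGroup Y] [Module Aᵐᵒᵖ X]
    [Module Aᵐᵒᵖ Y] (𝒜 : DGAlgebra k A) (f : X →+ Y)
    (hf : ∀ s, ∀ a ∈ 𝒜.gr s, ∀ m, f (m <• a) = f m <• a) : X →ₗ[Aᵐᵒᵖ] Y where
  toFun := f
  map_add' := map_add f
  map_smul' b m := by
    change f (m <• b.unop) = f m <• b.unop
    induction b.unop using DirectSum.Decomposition.inductionOn 𝒜.gr with
    | zero => simp
    | homogeneous a => exact hf _ _ a.2 m
    | add a b ha hb => rw [MulOpposite.op_add, add_smul, add_smul, map_add, ha, hb]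

/-- The submodule of all elements whose homogeneous components lie in prescribed subgroups. -/
def ofComponents (M : DGMod 𝒜) (S : ℤ → AddSubgroup M.carrier)
    (hS : ∀ i j, ∀ m ∈ S i, ∀ a ∈ 𝒜.gr j, m <• a ∈ S (i + j)) : Submodule Aᵐᵒᵖ M.carrier where
  carrier := {m | ∀ i, M.proj i m ∈ S i}
  zero_mem' i := by simp
  add_mem' hx hy i := by
    rw [map_add]
    exact add_mem (hx i) (hy i)
  smul_mem' b m hm i := by
    change M.proj i (m <• b.unop) ∈ S i
    induction b.unop using DirectSum.Decomposition.inductionOn 𝒜.gr with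
    | zero => simp
    | @homogeneous s a =>
      rw [M.proj_smul m a.2]
      simpa using hS _ s _ (hm (i - s)) _ a.2
    | add a b ha hb =>
      rw [MulOpposite.op_add, add_smul, map_add]
      exact add_mem ha hb

/-- The part of degree `e` of an `A`-linear map between dg modules. -/
noncomputable def gradedPart {M N : DGMod 𝒜} (e : ℤ) (g : M.carrier →ₗ[Aᵐᵒᵖ] N.carrier) :
    M.carrier →+ N.carrier :=
  (DirectSum.toAddMonoid fun i =>
    (N.proj (i + e)).comp (g.toAddMonoidHom.comp (M.gr i).subtype)).comp
    (AddEquiv.ofBijective (DirectSum.coeAddMonoidHom M.gr) M.internal).symm.toAddMonoidHom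

theorem gradedPart_of_mem {M N : DGMod 𝒜} (e : ℤ) (g : M.carrier →ₗ[Aᵐᵒᵖ] N.carrier)
    {i : ℤ} {m : M.carrier} (hm : m ∈ M.gr i) : gradedPart e g m = N.proj (i + e) (g m) := by
  have : (AddEquiv.ofBijective (DirectSum.coeAddMonoidHom M.gr) M.internal).symm m =
      DirectSum.of (fun i => M.gr i) i ⟨m, hm⟩ := by
    rw [AddEquiv.symm_apply_eq]
    exact (DirectSum.coeAddMonoidHom_of M.gr i ⟨m, hm⟩).symm
  simp only [gradedPart, AddMonoidHom.comp_apply, AddEquiv.coe_toAddMonoidHom, this,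
    DirectSum.toAddMonoid_of]
  rfl

/-- Every `A`-linear map between dg modules has a homogeneous part of degree `e`, which is again
`A`-linear. -/
theorem exists_gradedPart {M N : DGMod 𝒜} (e : ℤ) (g : M.carrier →ₗ[Aᵐᵒᵖ] N.carrier) :
    ∃ f : M.carrier →ₗ[Aᵐᵒᵖ] N.carrier,
      ∀ i, ∀ m ∈ M.gr i, f m = N.proj (i + e) (g m) := by
  refine ⟨linearOfHomogeneous 𝒜 (gradedPart e g) ?_, fun i m hm => gradedPart_of_mem e g hm⟩
  intro s a ha m
  induction m using M.homogeneous_induction with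
  | hom i m hm =>
    rw [gradedPart_of_mem e g hm, gradedPart_of_mem e g (M.smul_mem hm ha), map_smul,
      N.proj_smul _ ha, show i + s + e - s = i + e by ring]
  | add x y hx hy => simp only [map_add, smul_add, hx, hy]

/-! ### Generation in bounded degrees, and the submodule `M A⁺` -/

/-- The submodule generated by the homogeneous elements of degree at most `i`. -/
def genLE (M : DGMod 𝒜) (i : ℤ) : Submodule Aᵐᵒᵖ M.carrier :=
  Submodule.span Aᵐᵒᵖ {x | ∃ j ≤ i, x ∈ M.gr j}

theorem mem_genLE (M : DGMod 𝒜) {i j : ℤ} (h : j ≤ i) {m : M.carrier} (hm : m ∈ M.gr j) :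
    m ∈ M.genLE i :=
  Submodule.subset_span ⟨j, h, hm⟩

theorem genLE_mono (M : DGMod 𝒜) {i j : ℤ} (h : i ≤ j) : M.genLE i ≤ M.genLE j :=
  Submodule.span_mono fun _ ⟨r, hr, hx⟩ => ⟨r, hr.trans h, hx⟩

theorem genLE_le_comap {M N : DGMod 𝒜} (f : M.carrier →ₗ[Aᵐᵒᵖ] N.carrier)
    (hf : ∀ i, ∀ m ∈ M.gr i, f m ∈ N.gr i) (i : ℤ) : M.genLE i ≤ (N.genLE i).comap f :=
  Submodule.span_le.2 fun _ ⟨_, hr, hx⟩ => N.mem_genLE hr (hf _ _ hx)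

/-- The submodule `M A⁺`. -/
def plus (M : DGMod 𝒜) : Submodule Aᵐᵒᵖ M.carrier :=
  Submodule.span Aᵐᵒᵖ {x | ∃ (m : M.carrier) (i : ℤ) (a : A), 0 < i ∧ a ∈ 𝒜.gr i ∧ x = m <• a}

theorem smul_mem_plus (M : DGMod 𝒜) (m : M.carrier) {i : ℤ} (hi : 0 < i) {a : A}
    (ha : a ∈ 𝒜.gr i) : m <• a ∈ M.plus :=
  Submodule.subset_span ⟨m, i, a, hi, ha, rfl⟩

theorem plus_le_comap {M N : DGMod 𝒜} (f : M.carrier →ₗ[Aᵐᵒᵖ] N.carrier) :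
    M.plus ≤ N.plus.comap f := by
  refine Submodule.span_le.2 ?_
  rintro x ⟨m, i, a, hi, ha, rfl⟩
  change f (m <• a) ∈ N.plus
  rw [map_smul]
  exact N.smul_mem_plus _ hi ha

theorem proj_mem_plus (M : DGMod 𝒜) (j : ℤ) {m : M.carrier} (hm : m ∈ M.plus) :
    M.proj j m ∈ M.plus := by
  suffices M.plus ≤ M.ofComponents (fun _ => M.plus.toAddSubgroup)
      (fun _ _ m hm a _ => M.plus.smul_mem _ hm) from this hm j
  refine Submodule.span_le.2 ?_
  rintro x ⟨m, i, a, hi, ha, rfl⟩ j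
  rw [M.proj_smul m ha]
  exact M.smul_mem_plus _ hi ha

/-- Scalars of negative degree vanish, so that a property of scalars need only be checked in
degree zero and in positive degrees. -/
theorem _root_.DGAlgebra.IsPosSemisimple.induction (h : 𝒜.IsPosSemisimple) {P : A → Prop}
    (zero : ∀ a ∈ 𝒜.gr 0, P a) (pos : ∀ i, 0 < i → ∀ a ∈ 𝒜.gr i, P a)
    (add : ∀ a b, P a → P b → P (a + b)) (a : A) : P a := by
  induction a using DirectSum.Decomposition.inductionOn 𝒜.gr with
  | zero => exact zero 0 (zero_mem _)
  | @homogeneous i a =>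
    rcases lt_trichotomy i 0 with hi | hi | hi
    · obtain ⟨a, ha⟩ := a
      rw [h.pos i hi, Submodule.mem_bot] at ha
      subst ha
      exact zero 0 (zero_mem _)
    · subst hi
      exact zero _ a.2
    · exact pos i hi _ a.2
  | add a b ha hb => exact add a b ha hb

/-- If m a has degree j and a has positive degree, then m has degree at most j - 1. This drives both
the graded Nakayama lemma and the Fitting lemma: landing in M A⁺ lowers the degree of generation. -/
theorem proj_mem_genLE_of_mem_plus (h : 𝒜.IsPosSemisimple) (M : DGMod 𝒜) (j : ℤ) {m : M.carrier}
    (hm : m ∈ M.plus) : M.proj j m ∈ M.genLE (j - 1) := by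
  have hS : ∀ i j, ∀ m ∈ M.genLE (i - 1), ∀ a ∈ 𝒜.gr j, m <• a ∈ M.genLE (i + j - 1) := by
    intro i j m hm a ha
    rcases lt_or_ge j 0 with hj | hj
    · rw [h.pos j hj, Submodule.mem_bot] at ha
      simp [ha]
    · exact M.genLE_mono (by omega) ((M.genLE _).smul_mem _ hm)
  suffices M.plus ≤ M.ofComponents (fun i => (M.genLE (i - 1)).toAddSubgroup) hS from this hm j
  refine Submodule.span_le.2 ?_
  rintro x ⟨m, i, a, hi, ha, rfl⟩ j
  rw [M.proj_smul m ha]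
  exact (M.genLE _).smul_mem _ (M.mem_genLE (by omega) (M.proj_mem _ _))

theorem mem_genLE_of_mem_plus (h : 𝒜.IsPosSemisimple) (M : DGMod 𝒜) {j : ℤ} {m : M.carrier}
    (hm : m ∈ M.plus) (hj : m ∈ M.gr j) : m ∈ M.genLE (j - 1) :=
  M.proj_of_mem hj ▸ M.proj_mem_genLE_of_mem_plus h j hm

theorem d_smul_of_mem_zero (h : 𝒜.IsPosSemisimple) (M : DGMod 𝒜) (m : M.carrier) {a : A}
    (ha : a ∈ 𝒜.gr 0) : M.d (m <• a) = M.d m <• a := by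
  induction m using M.homogeneous_induction with
  | hom j m hm => rw [M.leibniz hm, h.d_zero a ha, MulOpposite.op_zero, zero_smul, smul_zero,
      add_zero]
  | add x y hx hy => simp only [smul_add, map_add, hx, hy]

/-- By the Leibniz rule d(x a) is a combination of (d x) a and x (d a), and d a again has positive
degree. -/
theorem d_mem_plus (h : 𝒜.IsPosSemisimple) (M : DGMod 𝒜) {m : M.carrier} (hm : m ∈ M.plus) :
    M.d m ∈ M.plus := by
  have key : ∀ (x : M.carrier) {i : ℤ} {a : A}, 0 < i → a ∈ 𝒜.gr i → M.d (x <• a) ∈ M.plus := by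
    intro x i a hi ha
    induction x using M.homogeneous_induction with
    | hom j x hx =>
      rw [M.leibniz hx]
      refine add_mem (M.smul_mem_plus _ hi ha) ?_
      have := M.smul_mem_plus x (by omega : 0 < i + 1) (𝒜.d_mem ha)
      rcases Int.even_or_odd j with hj | hj
      · simpa [Int.negOnePow_even j hj] using this
      · simpa [Int.negOnePow_odd j hj] using this
    | add x y hx hy =>
      rw [smul_add, map_add]
      exact add_mem hx hy
  induction hm using Submodule.span_induction with
  | mem x hx =>
    obtain ⟨m, i, a, hi, ha, rfl⟩ := hx
    exact key m hi ha
  | zero => simp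
  | add x y _ _ hx hy =>
    rw [map_add]
    exact add_mem hx hy
  -- The differential is not A-linear, so the scalar is split: it commutes with the action of A⁰
  -- because d(A⁰) = 0, and scalars of positive degree fall under `key`.
  | smul b x hxp hx =>
    change M.d (x <• b.unop) ∈ M.plus
    induction b.unop using h.induction with
    | zero a ha =>
      rw [M.d_smul_of_mem_zero h x ha]
      exact M.plus.smul_mem _ hx
    | pos i hi a ha => exact key x hi ha
    | add a b ha hb =>
      rw [MulOpposite.op_add, add_smul, map_add]
      exact add_mem ha hb

end DGMod

/-! ### A Fitting lemma for filtered modules -/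

section Fitting

variable {R X : Type*} [Ring R] [AddCommGroup X] [Module R X]

/-- When kernel and range are complementary, g is bijective on its range; s sends x to the element
of the range whose image under g² is g x. Linearity of s follows from this uniqueness, not from the
choice of t. -/
theorem exists_fitting_inverse (g : Module.End R X) (hg : IsCompl g.ker g.range) :
    ∃ s : Module.End R X, (∀ x, g (g (s x)) = g x) ∧ ∀ x, s (g (g x)) = g x := by
  have hdis : ∀ x, g (g x) = 0 → g x = 0 := fun x hx =>
    Submodule.disjoint_def.1 hg.disjoint (g x) hx ⟨x, rfl⟩
  have hdec : ∀ x, ∃ y, g x = g (g y) := by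
    intro x
    have hx : x ∈ g.ker ⊔ g.range := hg.sup_eq_top ▸ trivial
    obtain ⟨z, hz, _, ⟨y, rfl⟩, rfl⟩ := Submodule.mem_sup.1 hx
    exact ⟨y, by rw [map_add, LinearMap.mem_ker.1 hz, zero_add]⟩
  choose t ht using hdec
  have hu : ∀ x z, g (g z) = g x → g z = g (t x) := fun x z hz => by
    rw [← sub_eq_zero, ← map_sub]
    apply hdis
    rw [map_sub, map_sub, hz, ← ht, sub_self]
  have hv : ∀ x z, g (g (g z)) = g x → g z = g (t (t x)) := fun x z hz => hu _ _ (hu _ _ hz)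
  have ht' : ∀ x, g (g (g (t (t x)))) = g x := fun x => by rw [← ht, ← ht]
  let s : Module.End R X :=
    { toFun := fun x => g (t (t x))
      map_add' := fun x y => by
        rw [← map_add]
        exact (hv _ _ (by simp only [map_add, ht'])).symm
      map_smul' := fun r x => by
        rw [RingHom.id_apply, ← map_smul]
        exact (hv _ _ (by simp only [map_smul, ht'])).symm }
  exact ⟨s, ht', fun x => (hv (g (g x)) x rfl).symm⟩

/-- On each layer D (k+1) / D k the maps satisfy g² s = g = s g², so there the kernels and images of
the powers of g are stable from the first power on. Iterating, s^m g^(m+1) and g^(m+1) s^m agree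
with g modulo D k, so each layer costs one further power of g and k powers suffice on D k. -/
theorem fitting_of_filtration (g s : Module.End R X) (D : ℕ → Submodule R X) (hD : D 0 = ⊥)
    (hg : ∀ k, ∀ x ∈ D k, g x ∈ D k) (hs : ∀ k, ∀ x ∈ D k, s x ∈ D k)
    (h₁ : ∀ k, ∀ x ∈ D (k + 1), g (g (s x)) - g x ∈ D k)
    (h₂ : ∀ k, ∀ x ∈ D (k + 1), s (g (g x)) - g x ∈ D k) (k : ℕ) :
    ∀ x ∈ D k, ∀ m, ((g ^ m) x = 0 → (g ^ k) x = 0) ∧ ∃ y, (g ^ k) x = (g ^ m) y := by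
  have hgm : ∀ m k, ∀ x ∈ D k, (g ^ m) x ∈ D k := by
    intro m k x hx
    induction m with
    | zero => simpa using hx
    | succ m ih => rw [pow_succ', Module.End.mul_apply]; exact hg _ _ ih
  have hsm : ∀ m k, ∀ x ∈ D k, (s ^ m) x ∈ D k := by
    intro m k x hx
    induction m with
    | zero => simpa using hx
    | succ m ih => rw [pow_succ', Module.End.mul_apply]; exact hs _ _ ih
  have k₁ : ∀ k, ∀ x ∈ D (k + 1), ∀ m, (g ^ (m + 1)) ((s ^ m) x) - g x ∈ D k := by
    intro k x hx m
    induction m with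
    | zero => simp
    | succ m ih =>
      have := hgm m k _ (h₁ k _ (hsm m _ x hx))
      rw [map_sub] at this
      convert add_mem this ih using 1
      have e : (s ^ (m + 1)) x = s ((s ^ m) x) := by rw [pow_succ', Module.End.mul_apply]
      have e' : (g ^ m) (g ((s ^ m) x)) = (g ^ (m + 1)) ((s ^ m) x) := rfl
      rw [e, e', sub_add_sub_cancel]
      rfl
  have k₂ : ∀ k, ∀ x ∈ D (k + 1), ∀ m, (s ^ m) ((g ^ (m + 1)) x) - g x ∈ D k := by
    intro k x hx m
    induction m with
    | zero => simp
    | succ m ih =>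
      have := hsm m k _ (h₂ k _ (hgm m _ x hx))
      rw [map_sub] at this
      convert add_mem this ih using 1
      have e : (g ^ (m + 1)) x = g ((g ^ m) x) := by rw [pow_succ', Module.End.mul_apply]
      rw [e, sub_add_sub_cancel, pow_succ s, pow_succ' g, pow_succ' g]
      rfl
  induction k with
  | zero =>
    intro x hx m
    rw [hD, Submodule.mem_bot] at hx
    subst hx
    exact ⟨fun _ => map_zero _, 0, by simp⟩
  | succ k ih =>
    intro x hx m
    constructor
    · intro hm
      have hx' : g x ∈ D k := by
        have := k₂ k x hx m
        rw [pow_succ', Module.End.mul_apply, hm, map_zero, map_zero, zero_sub] at this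
        simpa using this
      have := (ih _ hx' m).1 (by
        rw [← Module.End.mul_apply, ← pow_succ, pow_succ', Module.End.mul_apply, hm, map_zero])
      rwa [pow_succ, Module.End.mul_apply]
    · obtain ⟨y, hy⟩ := (ih _ (k₁ k x hx m) m).2
      refine ⟨(g ^ (k + 1)) ((s ^ m) x) - y, ?_⟩
      have e₁ : (g ^ k) ((g ^ (m + 1)) ((s ^ m) x)) = (g ^ m) ((g ^ (k + 1)) ((s ^ m) x)) := by
        rw [← Module.End.mul_apply, ← pow_add, show k + (m + 1) = m + (k + 1) by omega, pow_add,
          Module.End.mul_apply]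
      rw [map_sub, ← hy, map_sub, e₁, sub_sub_cancel, pow_succ, Module.End.mul_apply]

end Fitting

namespace DGMod

variable {k : Type w} {A : Type u} [CommRing k] [Ring A] [Algebra k A] {𝒜 : DGAlgebra k A}

/-! ### Restriction of scalars to `A⁰` -/

/-- The inclusion of `A⁰` into `A`. -/
def zeroHom (𝒜 : DGAlgebra k A) : 𝒜.gr 0 →+* A where
  toFun := Subtype.val
  map_one' := rfl
  map_mul' _ _ := rfl
  map_zero' := rfl
  map_add' _ _ := rfl

/-- A right `A`-module, considered as a right `A⁰`-module. -/
abbrev zeroModule (𝒜 : DGAlgebra k A) (X : Type*) [AddCommGroup X] [Module Aᵐᵒᵖ X] :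
    Module (𝒜.gr 0)ᵐᵒᵖ X :=
  Module.compHom X (zeroHom 𝒜).op

/-- An `A⁰`-linear map between modules that are annihilated by `A⁺` is `A`-linear. -/
def linearOfZero (h : 𝒜.IsPosSemisimple) {X Y : Type*} [AddCommGroup X] [AddCommGroup Y]
    [Module Aᵐᵒᵖ X] [Module Aᵐᵒᵖ Y] (f : X →+ Y)
    (hf : ∀ a ∈ 𝒜.gr 0, ∀ m, f (m <• a) = f m <• a)
    (hX : ∀ i, 0 < i → ∀ a ∈ 𝒜.gr i, ∀ m : X, m <• a = 0)
    (hY : ∀ i, 0 < i → ∀ a ∈ 𝒜.gr i, ∀ m : Y, m <• a = 0) : X →ₗ[Aᵐᵒᵖ] Y where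
  toFun := f
  map_add' := map_add f
  map_smul' b m := by
    change f (m <• b.unop) = f m <• b.unop
    induction b.unop using h.induction with
    | zero a ha => exact hf a ha m
    | pos i hi a ha => rw [hX i hi a ha, hY i hi a ha, map_zero]
    | add a b ha hb => rw [MulOpposite.op_add, add_smul, add_smul, map_add, ha, hb]

theorem quotient_plus_smul (M : DGMod 𝒜) {i : ℤ} (hi : 0 < i) {a : A} (ha : a ∈ 𝒜.gr i)
    (m : M.carrier ⧸ M.plus) : m <• a = 0 := by
  obtain ⟨m, rfl⟩ := M.plus.mkQ_surjective m
  rw [← map_smul]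
  exact (Submodule.Quotient.mk_eq_zero _).2 (M.smul_mem_plus m hi ha)

theorem _root_.DGAlgebra.IsPosSemisimple.semisimple_op (h : 𝒜.IsPosSemisimple) :
    IsSemisimpleRing (𝒜.gr 0)ᵐᵒᵖ :=
  have := h.semisimple
  inferInstance

/-- Positive degrees act by zero on M / M A⁺, so generators over A already generate over A⁰. -/
theorem finite_zero_quotient_plus (h : 𝒜.IsPosSemisimple) (M : DGMod 𝒜)
    [hM : Module.Finite Aᵐᵒᵖ M.carrier] :
    letI := zeroModule 𝒜 (M.carrier ⧸ M.plus)
    Module.Finite (𝒜.gr 0)ᵐᵒᵖ (M.carrier ⧸ M.plus) := by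
  let _ := zeroModule 𝒜 (M.carrier ⧸ M.plus)
  obtain ⟨S, hS⟩ := (Module.Finite.fg_top : (⊤ : Submodule Aᵐᵒᵖ (M.carrier ⧸ M.plus)).FG)
  refine ⟨⟨S, ?_⟩⟩
  rw [eq_top_iff]
  rintro x -
  have hx : x ∈ Submodule.span Aᵐᵒᵖ (S : Set (M.carrier ⧸ M.plus)) := hS ▸ trivial
  induction hx using Submodule.span_induction with
  | mem x hx => exact Submodule.subset_span hx
  | zero => exact zero_mem _
  | add x y _ _ hx hy => exact add_mem hx hy
  | smul b x _ hx =>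
    change x <• b.unop ∈ _
    induction b.unop using h.induction with
    | zero a ha => exact Submodule.smul_mem _ (op (⟨a, ha⟩ : 𝒜.gr 0)) hx
    | pos i hi a ha =>
      rw [M.quotient_plus_smul hi ha]
      exact zero_mem _
    | add a b ha hb =>
      rw [MulOpposite.op_add, add_smul]
      exact add_mem ha hb

/-- Finitely generated modules over the semisimple ring A⁰ have finite length, and A-submodules are
in particular A⁰-submodules. -/
theorem isArtinian_isNoetherian_quotient_plus (h : 𝒜.IsPosSemisimple) (M : DGMod 𝒜)
    [Module.Finite Aᵐᵒᵖ M.carrier] :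
    IsArtinian Aᵐᵒᵖ (M.carrier ⧸ M.plus) ∧ IsNoetherian Aᵐᵒᵖ (M.carrier ⧸ M.plus) := by
  let _ := zeroModule 𝒜 (M.carrier ⧸ M.plus)
  let _ := zeroModule 𝒜 Aᵐᵒᵖ
  have := finite_zero_quotient_plus h M
  have := h.semisimple_op
  have : IsScalarTower (𝒜.gr 0)ᵐᵒᵖ Aᵐᵒᵖ (M.carrier ⧸ M.plus) :=
    ⟨fun a b x => mul_smul ((zeroHom 𝒜).op a) b x⟩
  exact ⟨isArtinian_of_tower (𝒜.gr 0)ᵐᵒᵖ inferInstance,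
    isNoetherian_of_tower (𝒜.gr 0)ᵐᵒᵖ inferInstance⟩

/-! ### Finitely generated dg modules are bounded below -/

/-- Finitely many generators have finitely many homogeneous components, and scalars never lower the
degree. -/
theorem exists_bounds (h : 𝒜.IsPosSemisimple) (M : DGMod 𝒜) [Module.Finite Aᵐᵒᵖ M.carrier] :
    ∃ c b : ℤ, (∀ i < c, M.gr i = ⊥) ∧ M.genLE b = ⊤ := by
  classical
  obtain ⟨S, hS⟩ := (Module.Finite.fg_top : (⊤ : Submodule Aᵐᵒᵖ M.carrier).FG)
  have hb : ∀ T : Finset M.carrier, ∃ c b : ℤ, ∀ x ∈ T, ∀ i, i < c ∨ b < i → M.proj i x = 0 := by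
    intro T
    induction T using Finset.induction_on with
    | empty => exact ⟨0, 0, by simp⟩
    | insert x T _ ih =>
      obtain ⟨c, b, hcb⟩ := ih
      obtain ⟨s, hs, -⟩ := M.exists_sum_proj x
      obtain ⟨c', hc'⟩ := s.finite_toSet.bddBelow
      obtain ⟨b', hb'⟩ := s.finite_toSet.bddAbove
      refine ⟨min c c', max b b', fun y hy i hi => ?_⟩
      rcases Finset.mem_insert.1 hy with rfl | hy
      · refine hs i fun hi' => ?_
        have h1 := hc' hi'
        have h2 := hb' hi'
        omega
      · exact hcb y hy i (by omega)
  obtain ⟨c, b, hcb⟩ := hb S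
  refine ⟨c, b, fun i hi => ?_, ?_⟩
  -- The elements without components below c form a submodule, because A has no negative degrees; it
  -- contains the generators.
  · have hT : ∀ r s, ∀ m ∈ (if r < c then (⊥ : AddSubgroup M.carrier) else ⊤), ∀ a ∈ 𝒜.gr s,
        m <• a ∈ (if r + s < c then (⊥ : AddSubgroup M.carrier) else ⊤) := by
      intro r s m hm a ha
      rcases lt_or_ge s 0 with hs | hs
      · rw [h.pos s hs, Submodule.mem_bot] at ha
        simp [ha]
      · by_cases hrs : r + s < c
        · rw [if_pos (by omega), AddSubgroup.mem_bot] at hm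
          simp [hm]
        · rw [if_neg hrs]
          trivial
    have hle : Submodule.span Aᵐᵒᵖ (S : Set M.carrier) ≤ M.ofComponents _ hT :=
      Submodule.span_le.2 fun x hx j => by
        by_cases hj : j < c
        · simp [hcb x hx j (Or.inl hj)]
        · simp only [if_neg hj]
          trivial
    rw [hS] at hle
    rw [eq_bot_iff]
    intro x hx
    have := hle (show x ∈ ⊤ from trivial) i
    simpa only [if_pos hi, M.proj_of_mem hx] using this
  · rw [eq_top_iff, ← hS]
    refine Submodule.span_le.2 fun x hx => M.mem_of_proj (M.genLE b) fun i => ?_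
    by_cases hi : b < i
    · rw [hcb x hx i (Or.inr hi)]
      exact zero_mem _
    · exact M.mem_genLE (by omega) (M.proj_mem i x)

theorem genLE_eq_bot (M : DGMod 𝒜) {c i : ℤ} (hc : ∀ i < c, M.gr i = ⊥) (hi : i < c) :
    M.genLE i = ⊥ := by
  rw [eq_bot_iff]
  refine Submodule.span_le.2 ?_
  rintro x ⟨j, hj, hx⟩
  rwa [hc j (by omega)] at hx

/-- The graded Nakayama lemma: in the lowest degree of a nonzero module, no nonzero element lies
in `M A⁺`. -/
theorem exists_lowest (h : 𝒜.IsPosSemisimple) (M : DGMod 𝒜) [Module.Finite Aᵐᵒᵖ M.carrier]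
    [Nontrivial M.carrier] :
    ∃ a : ℤ, (∀ i < a, M.gr i = ⊥) ∧ (∃ x ∈ M.gr a, x ≠ 0) ∧ ∀ x ∈ M.gr a, x ∈ M.plus → x = 0 := by
  obtain ⟨c, -, hc, -⟩ := exists_bounds h M
  have hne : ∃ i, M.gr i ≠ ⊥ := by
    by_contra! hall
    obtain ⟨x, hx⟩ := exists_ne (0 : M.carrier)
    exact hx (M.eq_zero_of_proj fun i => by simpa [hall i] using M.proj_mem i x)
  obtain ⟨a, ha, hmin⟩ := Int.exists_least_of_bdd (P := fun i => M.gr i ≠ ⊥)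
    ⟨c, fun i hi => by by_contra hlt; exact hi (hc i (by omega))⟩ hne
  have hlow : ∀ i < a, M.gr i = ⊥ := fun i hi => by
    by_contra hi'
    exact absurd (hmin i hi') (by omega)
  obtain ⟨x, hx⟩ := AddSubgroup.ne_bot_iff_exists_ne_zero.1 ha
  refine ⟨a, hlow, ⟨x, x.2, by simpa using hx⟩, fun x hx hx' => ?_⟩
  have := M.mem_genLE_of_mem_plus h hx' hx
  rwa [M.genLE_eq_bot hlow (by omega), Submodule.mem_bot] at this

/-! ### Fitting decompositions -/

/-- M itself need not have finite length. Fitting's lemma is applied on M / M A⁺, and the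
approximate inverse obtained by lifting is corrected along the filtration of M by degree of
generation. -/
theorem exists_fitting (h : 𝒜.IsPosSemisimple) (M : DGMod 𝒜) [Module.Finite Aᵐᵒᵖ M.carrier]
    [Module.Projective Aᵐᵒᵖ M.carrier] (f : M ⟶ M) :
    ∃ n : ℕ, 0 < n ∧ ∀ x m, ((lin f ^ m) x = 0 → (lin f ^ n) x = 0) ∧
      ∃ y, (lin f ^ n) x = (lin f ^ m) y := by
  obtain ⟨_, _⟩ := isArtinian_isNoetherian_quotient_plus h M
  let F : Module.End Aᵐᵒᵖ (M.carrier ⧸ M.plus) := M.plus.mapQ M.plus (lin f) (plus_le_comap _)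
  obtain ⟨r, hr⟩ := Filter.eventually_atTop.1 F.eventually_isCompl_ker_pow_range_pow
  -- The exponent r + 1 instead of r keeps the final exponent positive.
  obtain ⟨t, ht₁, ht₂⟩ := exists_fitting_inverse _ (hr (r + 1) (by omega))
  obtain ⟨s', hs'⟩ := Module.projective_lifting_property M.plus.mkQ (t ∘ₗ M.plus.mkQ)
    M.plus.mkQ_surjective
  obtain ⟨s, hs⟩ := exists_gradedPart 0 s'
  set g : Module.End Aᵐᵒᵖ M.carrier := lin f ^ (r + 1) with hgdef
  have hg_mem : ∀ i, ∀ m ∈ M.gr i, g m ∈ M.gr i := by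
    intro i m hm
    have : ∀ n, ((lin f ^ n) m) ∈ M.gr i := by
      intro n
      induction n with
      | zero => simpa using hm
      | succ n ih => rw [pow_succ', Module.End.mul_apply]; exact lin_mem f ih
    exact this _
  have hs_mem : ∀ i, ∀ m ∈ M.gr i, s m ∈ M.gr i := fun i m hm => by
    rw [hs i m hm, add_zero]
    exact M.proj_mem _ _
  have hg_proj : ∀ i m, M.proj i (g m) = g (M.proj i m) := fun i m => by
    simpa using (lin_proj (N := M) g.toAddMonoidHom 0 (fun j m hm => by simpa using hg_mem j m hm)
      i m).symm
  have hFg : ∀ m, (F ^ (r + 1)) (M.plus.mkQ m) = M.plus.mkQ (g m) := by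
    intro m
    rw [← Submodule.mapQ_pow]
    rfl
  have hs'm : ∀ m, M.plus.mkQ (s' m) = t (M.plus.mkQ m) := fun m => LinearMap.congr_fun hs' m
  have e₁ : ∀ m, g (g (s' m)) - g m ∈ M.plus := fun m => by
    rw [← Submodule.Quotient.eq]
    change M.plus.mkQ _ = M.plus.mkQ _
    rw [← hFg, ← hFg, hs'm, ht₁, hFg]
  have e₂ : ∀ m, s' (g (g m)) - g m ∈ M.plus := fun m => by
    rw [← Submodule.Quotient.eq]
    change M.plus.mkQ _ = M.plus.mkQ _
    rw [hs'm, ← hFg, ← hFg, ht₂, hFg]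
  obtain ⟨c, b, hc, hb⟩ := exists_bounds h M
  -- A degree-zero map into M A⁺ sends generators of degree i + 1 to elements generated in degrees
  -- at most i.
  have drop : ∀ (u : M.carrier →ₗ[Aᵐᵒᵖ] M.carrier),
      (∀ i, ∀ m ∈ M.gr i, u m ∈ M.gr i ∧ u m ∈ M.plus) →
      ∀ i, M.genLE (i + 1) ≤ (M.genLE i).comap u := by
    intro u hu i
    refine Submodule.span_le.2 ?_
    rintro x ⟨j, hj, hx⟩
    exact M.genLE_mono (by omega) (M.mem_genLE_of_mem_plus h (hu j x hx).2 (hu j x hx).1)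
  have d₁ := drop (g * g * s - g) (fun i m hm => by
    refine ⟨sub_mem (hg_mem _ _ (hg_mem _ _ (hs_mem _ _ hm))) (hg_mem _ _ hm), ?_⟩
    have := M.proj_mem_plus i (e₁ m)
    rw [map_sub, hg_proj, hg_proj, hg_proj, M.proj_of_mem hm] at this
    simpa [hs i m hm] using this)
  have d₂ := drop (s * g * g - g) (fun i m hm => by
    refine ⟨sub_mem (hs_mem _ _ (hg_mem _ _ (hg_mem _ _ hm))) (hg_mem _ _ hm), ?_⟩
    have := M.proj_mem_plus i (e₂ m)
    rw [map_sub, hg_proj, M.proj_of_mem hm] at this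
    simpa [hs i _ (hg_mem _ _ (hg_mem _ _ hm))] using this)
  -- The filtration starts at c - 1, where it is zero, and reaches all of M after `(b - (c -
  -- 1)).toNat` steps; the extra successor makes the exponent positive.
  have key := fitting_of_filtration g s (fun n => M.genLE (c - 1 + n))
    (M.genLE_eq_bot hc (by simp)) (fun n => genLE_le_comap g hg_mem _)
    (fun n => genLE_le_comap s hs_mem _)
    (fun n x hx => d₁ (c - 1 + n) (by simpa [add_assoc] using hx))
    (fun n x hx => d₂ (c - 1 + n) (by simpa [add_assoc] using hx)) (b - (c - 1)).toNat.succ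
  have htop : ∀ x : M.carrier, x ∈ M.genLE (c - 1 + ((b - (c - 1)).toNat.succ : ℤ)) := fun x =>
    M.genLE_mono (i := b) (by push_cast; omega) (hb ▸ trivial)
  refine ⟨(r + 1) * (b - (c - 1)).toNat.succ, by positivity, fun x m => ?_⟩
  obtain ⟨k₁, y, k₂⟩ := key x (htop x) m
  rw [hgdef, ← pow_mul, ← pow_mul] at k₁ k₂
  refine ⟨fun hm => k₁ ?_, (lin f ^ (r * m)) y, ?_⟩
  · rw [show (r + 1) * m = r * m + m by ring, pow_add, Module.End.mul_apply, hm,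
      map_zero]
  · rw [k₂, show (r + 1) * m = m + r * m by ring, pow_add, Module.End.mul_apply]

end DGMod

namespace DGMod

variable {k : Type w} {A : Type u} [CommRing k] [Ring A] [Algebra k A] {𝒜 : DGAlgebra k A}

/-! ### The modules `L ⊗_{A⁰} A` -/

section Hat

variable (L : Type u) [AddCommGroup L] [Module (𝒜.gr 0)ᵐᵒᵖ L]

/-- The universal property of `L ⊗_{A⁰} A`. -/
theorem exists_hatLift {Y : Type*} [AddCommGroup Y] [Module Aᵐᵒᵖ Y] (φ : L →+ Y)
    (hφ : ∀ (a : 𝒜.gr 0) (l : L), φ (l <• a) = φ l <• (a : A)) :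
    ∃ Φ : HatCarrier 𝒜 L →ₗ[Aᵐᵒᵖ] Y, ∀ l a, Φ (hatMk 𝒜 l a) = φ l <• a := by
  let T : A ⊗[ℤ] L →+ Y := TensorProduct.liftAddHom
    (AddMonoidHom.mk' (fun a => AddMonoidHom.mk' (fun l => φ l <• a) fun x y => by
      rw [map_add, smul_add]) fun a b => by
        ext l
        simp [add_smul]) fun r a l => by
          simp only [AddMonoidHom.mk'_apply, map_zsmul, AddMonoidHom.smul_apply]
  let T' : A ⊗[ℤ] L →ₗ[Aᵐᵒᵖ] Y :=
    { T with
      map_smul' := fun b t => by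
        change T (b • t) = b • T t
        induction t using TensorProduct.induction_on with
        | zero => simp
        | tmul a l =>
          rw [TensorProduct.smul_tmul']
          change φ l <• (a * b.unop) = (φ l <• a) <• b.unop
          rw [op_mul, mul_smul]
        | add x y hx hy => rw [smul_add, map_add, map_add, hx, hy, smul_add] }
  refine ⟨(hatRel 𝒜 L).liftQ T' fun t ht => ?_, fun l a => rfl⟩
  change t ∈ AddSubgroup.closure (hatRelSet 𝒜 L) at ht
  rw [LinearMap.mem_ker]
  induction ht using AddSubgroup.closure_induction with
  | mem x hx =>
    obtain ⟨a₀, a, l, rfl⟩ := hx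
    rw [map_sub]
    change φ l <• ((a₀ : A) * a) - φ (l <• a₀) <• a = 0
    rw [hφ, op_mul, mul_smul, sub_self]
  | zero => simp
  | add x y _ _ hx hy => rw [map_add, hx, hy, add_zero]
  | neg x _ hx => rw [map_neg, hx, neg_zero]

theorem hatMk_eq_smul (l : L) (a : A) : hatMk 𝒜 l a = hatMk 𝒜 l 1 <• a := by
  rw [hatMk_smul, one_mul]

theorem hatMk_add_left (l l' : L) (a : A) :
    hatMk 𝒜 (l + l') a = hatMk 𝒜 l a + hatMk 𝒜 l' a := by
  simp [hatMk, TensorProduct.tmul_add]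

/-- The map `l ↦ l ⊗ 1`. -/
def hatUnit : L →+ HatCarrier 𝒜 L :=
  AddMonoidHom.mk' (fun l => hatMk 𝒜 l 1) fun l l' => hatMk_add_left L l l' 1

theorem hatUnit_smul (a : 𝒜.gr 0) (l : L) :
    hatUnit (𝒜 := 𝒜) L (l <• a) = hatUnit L l <• (a : A) := by
  change hatMk 𝒜 (l <• a) 1 = hatMk 𝒜 l 1 <• (a : A)
  rw [← hatMk_mul, hatMk_smul, one_mul, mul_one]

variable {L} in
theorem hat_hom_ext {Y : Type*} [AddCommGroup Y] [Module Aᵐᵒᵖ Y]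
    {f g : HatCarrier 𝒜 L →ₗ[Aᵐᵒᵖ] Y} (hfg : ∀ l, f (hatMk 𝒜 l 1) = g (hatMk 𝒜 l 1)) :
    f = g := by
  refine LinearMap.ext fun x => ?_
  induction x using hat_induction with
  | h0 => simp
  | hmk l a => rw [hatMk_eq_smul, map_smul, map_smul, hfg]
  | hadd x y hx hy => rw [map_add, map_add, hx, hy]

/-- Induction of scalars is left adjoint to restriction, and every module over the semisimple ring
A⁰ is projective. -/
theorem projective_hat (h : 𝒜.IsPosSemisimple) : Module.Projective Aᵐᵒᵖ (HatCarrier 𝒜 L) := by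
  have := h.semisimple_op
  have := Module.projective_of_isSemisimpleRing (𝒜.gr 0)ᵐᵒᵖ L
  refine Module.Projective.of_lifting_property fun {X Y} _ _ _ _ f g hf => ?_
  let _ := zeroModule 𝒜 X
  let _ := zeroModule 𝒜 Y
  let f₀ : X →ₗ[(𝒜.gr 0)ᵐᵒᵖ] Y :=
    { toFun := f
      map_add' := map_add f
      map_smul' := fun a x => map_smul f ((zeroHom 𝒜).op a) x }
  let g₀ : L →ₗ[(𝒜.gr 0)ᵐᵒᵖ] Y :=
    { toFun := fun l => g (hatUnit L l)
      map_add' := fun x y => by rw [map_add, map_add]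
      map_smul' := fun a l => by
        change g (hatUnit L (l <• a.unop)) = _
        rw [hatUnit_smul, map_smul]
        rfl }
  obtain ⟨u, hu⟩ := Module.projective_lifting_property f₀ g₀ hf
  obtain ⟨U, hU⟩ := exists_hatLift L u.toAddMonoidHom fun a l => map_smul u (op a) l
  refine ⟨U, hat_hom_ext fun l => ?_⟩
  rw [LinearMap.comp_apply, hU, MulOpposite.op_one, one_smul]
  exact LinearMap.congr_fun hu l

variable (h : 𝒜.IsPosSemisimple)

theorem hatMk_mem (l : L) {i : ℤ} {a : A} (ha : a ∈ 𝒜.gr i) : hatMk 𝒜 l a ∈ (hat 𝒜 L h).gr i :=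
  AddSubgroup.subset_closure ⟨l, a, ha, rfl⟩

theorem hatMk_one_mem (l : L) : hatMk 𝒜 l 1 ∈ (hat 𝒜 L h).gr 0 :=
  hatMk_mem L h l SetLike.GradedOne.one_mem

theorem hat_gr_eq_bot {i : ℤ} (hi : i < 0) : (hat 𝒜 L h).gr i = ⊥ := by
  refine AddSubgroup.closure_eq_bot_iff.2 ?_
  rintro _ ⟨l, a, ha, rfl⟩
  rw [h.pos i hi, Submodule.mem_bot] at ha
  simp [ha, hatMk]

theorem exists_hatMk_of_mem_zero {x : HatCarrier 𝒜 L} (hx : x ∈ (hat 𝒜 L h).gr 0) :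
    ∃ l, x = hatMk 𝒜 l 1 := by
  change x ∈ hatGr 𝒜 L 0 at hx
  induction hx using AddSubgroup.closure_induction with
  | mem x hx =>
    obtain ⟨l, a, ha, rfl⟩ := hx
    exact ⟨l <• (⟨a, ha⟩ : 𝒜.gr 0), by rw [← hatMk_mul, mul_one]⟩
  | zero => exact ⟨0, ((hatUnit L).map_zero).symm⟩
  | add x y _ _ hx hy =>
    obtain ⟨l, rfl⟩ := hx
    obtain ⟨l', rfl⟩ := hy
    exact ⟨l + l', (hatMk_add_left L _ _ _).symm⟩
  | neg x _ hx =>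
    obtain ⟨l, rfl⟩ := hx
    exact ⟨-l, ((hatUnit L).map_neg l).symm⟩

theorem hat_d_hatMk_one (l : L) : (hat 𝒜 L h).d (hatMk 𝒜 l 1) = 0 := by
  change hatMk 𝒜 l (𝒜.d 1) = 0
  rw [h.d_zero 1 SetLike.GradedOne.one_mem]
  simp [hatMk]

/-- A degree-zero component of an element of H A⁺, with H = L ⊗ A, would be generated in negative
degrees, where H vanishes. -/
theorem hat_proj_zero_of_mem_plus {x : HatCarrier 𝒜 L} (hx : x ∈ (hat 𝒜 L h).plus) :
    (hat 𝒜 L h).proj 0 x = 0 := by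
  have := (hat 𝒜 L h).proj_mem_genLE_of_mem_plus h 0 hx
  rwa [(hat 𝒜 L h).genLE_eq_bot (c := 0) (fun i hi => hat_gr_eq_bot L h hi) (by omega),
    Submodule.mem_bot] at this

/-- A simple module is cyclic, so a single l₀ ⊗ 1 generates. -/
theorem finite_hat [IsSimpleModule (𝒜.gr 0)ᵐᵒᵖ L] : Module.Finite Aᵐᵒᵖ (HatCarrier 𝒜 L) := by
  have := IsSimpleModule.nontrivial (𝒜.gr 0)ᵐᵒᵖ L
  obtain ⟨l₀, hl₀⟩ := exists_ne (0 : L)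
  refine ⟨⟨{hatMk 𝒜 l₀ 1}, eq_top_iff.2 fun x hx => ?_⟩⟩
  clear hx
  induction x using hat_induction with
  | h0 => exact zero_mem _
  | hmk l a =>
    have hl : l ∈ Submodule.span (𝒜.gr 0)ᵐᵒᵖ {l₀} := by
      rw [IsSimpleModule.span_singleton_eq_top _ hl₀]
      trivial
    obtain ⟨b, rfl⟩ := Submodule.mem_span_singleton.1 hl
    have e : hatMk 𝒜 (l₀ <• b.unop) a = hatMk 𝒜 l₀ 1 <• ((b.unop : A) * a) := by
      rw [← hatMk_mul, hatMk_eq_smul]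
    have h₁ : hatMk 𝒜 l₀ 1 ∈
        Submodule.span Aᵐᵒᵖ (({hatMk 𝒜 l₀ 1} : Finset (HatCarrier 𝒜 L)) : Set _) :=
      Submodule.subset_span (Finset.mem_singleton_self _)
    exact e ▸ Submodule.smul_mem _ _ h₁
  | hadd x y hx hy => exact add_mem hx hy

variable {L} in
/-- If `φ : L → M^b` is injective modulo `M A⁺` and `M` is projective, then the induced map
`L ⊗_{A⁰} A → M` has a homogeneous retraction. -/
theorem exists_retraction (M : DGMod 𝒜) [Module.Projective Aᵐᵒᵖ M.carrier] {b : ℤ}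
    (φ : L →+ M.carrier) (hφ : ∀ (a : 𝒜.gr 0) (l : L), φ (l <• a) = φ l <• (a : A))
    (hmem : ∀ l, φ l ∈ M.gr b) (hinj : ∀ l, φ l ∈ M.plus → l = 0) :
    ∃ ρ : M.carrier →ₗ[Aᵐᵒᵖ] HatCarrier 𝒜 L,
      (∀ i, ∀ m ∈ M.gr i, ρ m ∈ (hat 𝒜 L h).gr (i + -b)) ∧ ∀ l, ρ (φ l) = hatMk 𝒜 l 1 := by
  have := h.semisimple_op
  let H := hat 𝒜 L h
  let _ := zeroModule 𝒜 (M.carrier ⧸ M.plus)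
  let _ := zeroModule 𝒜 (H.carrier ⧸ H.plus)
  let φ₀ : L →ₗ[(𝒜.gr 0)ᵐᵒᵖ] (M.carrier ⧸ M.plus) :=
    { toFun := fun l => M.plus.mkQ (φ l)
      map_add' := fun x y => by rw [map_add, map_add]
      map_smul' := fun a l => by
        change M.plus.mkQ (φ (l <• a.unop)) = _
        rw [hφ, map_smul]
        rfl }
  have hφ₀ : Function.Injective φ₀ := (injective_iff_map_eq_zero φ₀).2 fun l hl =>
    hinj l ((Submodule.Quotient.mk_eq_zero _).1 hl)
  let ψ₀ : L →ₗ[(𝒜.gr 0)ᵐᵒᵖ] (H.carrier ⧸ H.plus) :=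
    { toFun := fun l => H.plus.mkQ (hatUnit L l)
      map_add' := fun x y =>
        (congrArg H.plus.mkQ ((hatUnit L).map_add x y)).trans (H.plus.mkQ.map_add _ _)
      map_smul' := fun a l => congrArg H.plus.mkQ (hatUnit_smul L a.unop l) }
  -- Semisimplicity of A⁰ gives a retraction modulo A⁺. It is A-linear because A⁺ kills both
  -- quotients, and projectivity of M then lifts it.
  obtain ⟨r, hr⟩ := IsSemisimpleModule.extension_property φ₀ hφ₀ ψ₀
  let r' : (M.carrier ⧸ M.plus) →ₗ[Aᵐᵒᵖ] (H.carrier ⧸ H.plus) :=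
    linearOfZero h r.toAddMonoidHom (fun a ha m => map_smul r (op (⟨a, ha⟩ : 𝒜.gr 0)) m)
      (fun i hi a ha m => M.quotient_plus_smul hi ha m)
      (fun i hi a ha m => H.quotient_plus_smul hi ha m)
  obtain ⟨ρ', hρ'⟩ := Module.projective_lifting_property H.plus.mkQ (r' ∘ₗ M.plus.mkQ)
    H.plus.mkQ_surjective
  obtain ⟨ρ, hρ⟩ := exists_gradedPart (N := H) (-b) ρ'
  refine ⟨ρ, fun i m hm => hρ i m hm ▸ H.proj_mem _ _, fun l => ?_⟩
  obtain ⟨y, hy⟩ : ∃ y : H.carrier, y = hatMk 𝒜 l 1 := ⟨_, rfl⟩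
  have hl : ρ' (φ l) - y ∈ H.plus := by
    rw [← Submodule.Quotient.eq, hy]
    exact (LinearMap.congr_fun hρ' (φ l)).trans (LinearMap.congr_fun hr l)
  -- The lift and l ⊗ 1 agree only modulo H A⁺, but H A⁺ has no component in degree zero; the part
  -- of degree -b of the lift therefore hits l ⊗ 1 exactly.
  have := hat_proj_zero_of_mem_plus L h hl
  rw [map_sub, sub_eq_zero] at this
  have e := hρ b _ (hmem l)
  rw [add_neg_cancel] at e
  have hy0 : y ∈ H.gr 0 := hy ▸ hatMk_one_mem L h l
  exact (e.trans this).trans ((H.proj_of_mem hy0).trans hy)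

end Hat

/-! ### The internal characterization of filtered dg modules -/

/-- A condition on dg modules that is equivalent to the existence of a filtration as in the
definition of `dgFilt`, but which is visibly stable under direct summands. -/
structure IsHatFiltered (M : DGMod 𝒜) : Prop where
  finite : Module.Finite Aᵐᵒᵖ M.carrier
  projective : Module.Projective Aᵐᵒᵖ M.carrier
  induction : ∀ (j : ℤ) (F : Submodule Aᵐᵒᵖ M.carrier), (∀ i < j, ∀ x ∈ M.gr i, x ∈ F) →
    (∀ x ∈ M.gr j, M.d x ∈ F → x ∈ F) → ∀ x ∈ M.gr j, x ∈ F

theorem IsHatFiltered.of_surjective {M N : DGMod 𝒜} (hM : M.IsHatFiltered) (q : M ⟶ N)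
    (hq : Function.Surjective (lin q)) [hN : Module.Projective Aᵐᵒᵖ N.carrier] :
    N.IsHatFiltered where
  finite :=
    have := hM.finite
    Module.Finite.of_surjective (lin q) hq
  projective := hN
  induction j F h₁ h₂ y hy := by
    obtain ⟨x, rfl⟩ := hq y
    rw [← N.proj_of_mem hy, proj_lin]
    refine hM.induction j (F.comap (lin q)) (fun i hi x hx => h₁ i hi _ (lin_mem q hx))
      (fun x hx hdx => h₂ _ (lin_mem q hx) ?_) _ (M.proj_mem _ _)
    rw [← lin_comm]
    exact hdx

theorem IsHatFiltered.of_retract {M N : DGMod 𝒜} (hM : M.IsHatFiltered) (i : N ⟶ M) (q : M ⟶ N)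
    (hiq : i ≫ q = 𝟙 N) : N.IsHatFiltered := by
  have hl : lin q ∘ₗ lin i = LinearMap.id := congrArg lin hiq
  have := hM.projective
  have : Module.Projective Aᵐᵒᵖ N.carrier := Module.Projective.of_split (lin i) (lin q) hl
  exact hM.of_surjective q fun x => ⟨lin i x, LinearMap.congr_fun hl x⟩

/-- Minimality: the induced differential on M / M A⁺ is zero. This is what makes contractible
filtered modules vanish. -/
theorem IsHatFiltered.d_mem_plus (h : 𝒜.IsPosSemisimple) {M : DGMod 𝒜} (hM : M.IsHatFiltered)
    (m : M.carrier) : M.d m ∈ M.plus := by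
  induction m using M.homogeneous_induction with
  | hom j m hm =>
    -- The test submodule imposes no condition below degree j, asks for d x in M A⁺ in degree j, and
    -- for x in M A⁺ above j. If x has degree j and d x lies in it, the condition in degree j + 1
    -- says that d x is in M A⁺, which is the condition on x.
    let S : ℤ → AddSubgroup M.carrier := fun r =>
      { carrier := {x | (r = j → M.d x ∈ M.plus) ∧ (j < r → x ∈ M.plus)}
        zero_mem' := ⟨fun _ => by simp, fun _ => zero_mem _⟩
        add_mem' := fun hx hy => ⟨fun hr => by
          rw [map_add]
          exact add_mem (hx.1 hr) (hy.1 hr), fun hr => add_mem (hx.2 hr) (hy.2 hr)⟩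
        neg_mem' := fun hx => ⟨fun hr => by
          rw [map_neg]
          exact neg_mem (hx.1 hr), fun hr => neg_mem (hx.2 hr)⟩ }
    have hS : ∀ r s, ∀ x ∈ S r, ∀ a ∈ 𝒜.gr s, x <• a ∈ S (r + s) := by
      intro r s x hx a ha
      rcases lt_trichotomy s 0 with hs | rfl | hs
      · rw [h.pos s hs, Submodule.mem_bot] at ha
        simp [ha]
      · rw [add_zero]
        refine ⟨fun hr => ?_, fun hr => M.plus.smul_mem _ (hx.2 hr)⟩
        rw [M.d_smul_of_mem_zero h x ha]
        exact M.plus.smul_mem _ (hx.1 hr)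
      · have := M.smul_mem_plus x hs ha
        exact ⟨fun _ => M.d_mem_plus h this, fun _ => this⟩
    have key := hM.induction j (M.ofComponents S hS)
      (fun i hi x hx r => by
        by_cases hr : r = i
        · exact ⟨fun _ => by omega, fun _ => by omega⟩
        · rw [M.proj_of_mem_ne hx hr]
          exact zero_mem _)
      (fun x hx hdx r => by
        by_cases hr : r = j
        · subst hr
          rw [M.proj_of_mem hx]
          have := (hdx (r + 1)).2 (lt_add_one r)
          rw [M.proj_of_mem (M.d_mem hx)] at this
          exact ⟨fun _ => this, fun _ => by omega⟩
        · rw [M.proj_of_mem_ne hx hr]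
          exact zero_mem _) m hm j
    rw [M.proj_of_mem hm] at key
    exact key.1 rfl
  | add x y hx hy =>
    rw [map_add]
    exact add_mem hx hy

/-- Only degree zero matters: there d = 0, so the hypothesis on differentials is automatic; above it
everything is generated by 1, and below it there is nothing. -/
theorem isHatFiltered_ofAlgebra (h : 𝒜.IsPosSemisimple) : (ofAlgebra 𝒜).IsHatFiltered where
  finite := Module.Finite.equiv (opLinearEquiv Aᵐᵒᵖ (M := A)).symm
  projective := Module.Projective.of_equiv (opLinearEquiv Aᵐᵒᵖ (M := A)).symm
  induction j F h₁ h₂ x hx := by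
    have one : ∀ y : A, (∀ z ∈ 𝒜.gr 0, z ∈ F) → y ∈ F := fun y h0 => by
      have := F.smul_mem (op y) (h0 (1 : A) SetLike.GradedOne.one_mem)
      have e : (op y • (1 : A) : A) = y := one_mul y
      exact e ▸ this
    have hx' : (x : A) ∈ 𝒜.gr j := hx
    rcases lt_trichotomy j 0 with hj | hj | hj
    · rw [h.pos j hj] at hx'
      have e : ∀ y : A, y ∈ (⊥ : Submodule k A) → y = 0 := fun y => (Submodule.mem_bot k).1
      exact e x hx' ▸ zero_mem F
    · subst hj
      refine h₂ x hx ?_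
      rw [show (ofAlgebra 𝒜).d x = 0 from h.d_zero x hx']
      exact zero_mem F
    · exact one x (h₁ 0 hj)

/-! ### The length of `M / M A⁺` -/

/-- The length of `M / M A⁺`. -/
noncomputable def topLength (M : DGMod 𝒜) : ℕ∞ := Module.length Aᵐᵒᵖ (M.carrier ⧸ M.plus)

/-- The induced surjection M / M A⁺ → N / N A⁺ kills the nonzero class of x, and the source has
finite length. All inductions below run on this length. -/
theorem topLength_lt (h : 𝒜.IsPosSemisimple) {M N : DGMod 𝒜} [Module.Finite Aᵐᵒᵖ M.carrier]
    (q : M.carrier →ₗ[Aᵐᵒᵖ] N.carrier) (hq : Function.Surjective q) {x : M.carrier}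
    (hx : x ∉ M.plus) (hqx : q x ∈ N.plus) : N.topLength < M.topLength := by
  obtain ⟨_, _⟩ := isArtinian_isNoetherian_quotient_plus h M
  let Q := M.plus.mapQ N.plus q (plus_le_comap q)
  have hQ : Function.Surjective Q := by
    intro y
    obtain ⟨y, rfl⟩ := N.plus.mkQ_surjective y
    obtain ⟨x, rfl⟩ := hq y
    exact ⟨M.plus.mkQ x, rfl⟩
  have hker : Q.ker ≠ ⊥ := by
    intro hbot
    have : M.plus.mkQ x ∈ Q.ker := (Submodule.Quotient.mk_eq_zero _).2 hqx
    rw [hbot, Submodule.mem_bot] at this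
    exact hx ((Submodule.Quotient.mk_eq_zero _).1 this)
  have := Submodule.length_quotient_lt Q.ker hker
  rwa [(Q.quotKerEquivOfSurjective hQ).length_eq] at this

end DGMod

namespace DGMod

variable {k : Type w} {A : Type u} [CommRing k] [Ring A] [Algebra k A] {𝒜 : DGAlgebra k A}

/-! ### Submodules and quotients -/

theorem DGSubmodule.proj_mem {M : DGMod 𝒜} (F : DGSubmodule M) (i : ℤ) {m : M.carrier}
    (hm : m ∈ F.toSubmodule) : M.proj i m ∈ F.toSubmodule := by
  have hle : (⨆ i, M.gr i ⊓ F.toSubmodule.toAddSubgroup) ≤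
      F.toSubmodule.toAddSubgroup.comap (M.proj i) := by
    refine iSup_le fun j z hz => ?_
    change M.proj i z ∈ F.toSubmodule
    by_cases hij : i = j
    · subst hij
      rw [M.proj_of_mem hz.1]
      exact hz.2
    · rw [M.proj_of_mem_ne hz.1 hij]
      exact zero_mem _
  exact hle (F.homogeneous m hm)

/-- A submodule that is stable under the projections and the differential is a dg submodule. -/
def DGSubmodule.ofStable {M : DGMod 𝒜} (F : Submodule Aᵐᵒᵖ M.carrier)
    (hp : ∀ i, ∀ m ∈ F, M.proj i m ∈ F) (hd : ∀ m ∈ F, M.d m ∈ F) : DGSubmodule M where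
  toSubmodule := F
  homogeneous m hm := M.mem_of_proj _ fun i =>
    AddSubgroup.mem_iSup_of_mem i ⟨M.proj_mem i m, hp i m hm⟩
  d_mem := hd

/-- The image of a morphism of dg modules. -/
def range {M N : DGMod 𝒜} (f : M ⟶ N) : DGSubmodule N :=
  DGSubmodule.ofStable (lin f).range
    (by
      rintro i _ ⟨m, rfl⟩
      exact ⟨M.proj i m, (proj_lin f i m).symm⟩)
    (by
      rintro _ ⟨m, rfl⟩
      exact ⟨M.d m, lin_comm f m⟩)

/-- The inverse image of a dg submodule. -/
def DGSubmodule.preimage {M N : DGMod 𝒜} (f : M ⟶ N) (F : DGSubmodule N) : DGSubmodule M :=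
  DGSubmodule.ofStable (F.toSubmodule.comap (lin f))
    (fun i m hm => by
      rw [Submodule.mem_comap, ← proj_lin]
      exact F.proj_mem i hm)
    (fun m hm => by
      rw [Submodule.mem_comap, lin_comm]
      exact F.d_mem _ hm)

/-- The zero submodule. -/
def DGSubmodule.zero (M : DGMod 𝒜) : DGSubmodule M :=
  DGSubmodule.ofStable ⊥ (fun i m hm => by simp_all) (fun m hm => by simp_all)

/-- The inclusion of a dg submodule. -/
def DGSubmodule.incl {M : DGMod 𝒜} (F : DGSubmodule M) : F.toDGMod ⟶ M :=
  ofLin (M := F.toDGMod) F.toSubmodule.subtype (fun hm => hm) (fun _ => rfl)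

/-- The quotient of a dg module by a dg submodule. -/
def quotient {M : DGMod 𝒜} (F : DGSubmodule M) : DGMod 𝒜 where
  carrier := M.carrier ⧸ F.toSubmodule
  gr i := (M.gr i).map F.toSubmodule.mkQ.toAddMonoidHom
  internal := by
    refine isInternal_of_proj _ (fun i => QuotientAddGroup.map F.toSubmodule.toAddSubgroup
      F.toSubmodule.toAddSubgroup (M.proj i) fun m hm => F.proj_mem i hm) ?_ ?_ ?_
    · rintro i _ ⟨m, hm, rfl⟩
      exact congrArg F.toSubmodule.mkQ (M.proj_of_mem hm)
    · rintro i j _ ⟨m, hm, rfl⟩ hij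
      exact congrArg F.toSubmodule.mkQ (M.proj_of_mem_ne hm hij)
    · intro m
      obtain ⟨m, rfl⟩ := F.toSubmodule.mkQ_surjective m
      induction m using M.homogeneous_induction with
      | hom i m hm => exact AddSubgroup.mem_iSup_of_mem i ⟨m, hm, rfl⟩
      | add x y hx hy =>
        rw [map_add]
        exact add_mem hx hy
  smul_mem := by
    rintro i j _ a ⟨m, hm, rfl⟩ ha
    exact ⟨m <• a, M.smul_mem hm ha, rfl⟩
  d := QuotientAddGroup.map F.toSubmodule.toAddSubgroup F.toSubmodule.toAddSubgroup M.d
    fun m hm => F.d_mem m hm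
  d_mem := by
    rintro i _ ⟨m, hm, rfl⟩
    exact ⟨M.d m, M.d_mem hm, rfl⟩
  d_d m := by
    obtain ⟨m, rfl⟩ := F.toSubmodule.mkQ_surjective m
    exact congrArg F.toSubmodule.mkQ (M.d_d m)
  leibniz := by
    rintro i _ ⟨m, hm, rfl⟩ a
    have := congrArg F.toSubmodule.mkQ (M.leibniz hm a)
    rw [map_add] at this
    refine this.trans ?_
    rcases Int.even_or_odd i with hi | hi
    · simp only [Int.negOnePow_even i hi, one_smul]
      rfl
    · simp only [Int.negOnePow_odd i hi, Units.neg_smul, one_smul, map_neg]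
      rfl

/-- The projection onto a quotient. -/
def toQuotient {M : DGMod 𝒜} (F : DGSubmodule M) : M ⟶ quotient F :=
  ofLin (N := quotient F) F.toSubmodule.mkQ (fun hm => ⟨_, hm, rfl⟩) (fun _ => rfl)

/-- A graded-split submodule has a graded-split quotient. -/
theorem exists_split_quotient {X M : DGMod 𝒜} (ι : X ⟶ M)
    (ρ : M.carrier →ₗ[Aᵐᵒᵖ] X.carrier) (hρ : ∀ i, ∀ m ∈ M.gr i, ρ m ∈ X.gr i)
    (hρι : ∀ x, ρ (lin ι x) = x) :
    ∃ (Q : DGMod 𝒜) (q : M ⟶ Q) (σ : Q.carrier →ₗ[Aᵐᵒᵖ] M.carrier),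
      (∀ i, ∀ y ∈ Q.gr i, σ y ∈ M.gr i) ∧ (∀ y, lin q (σ y) = y) ∧
      (∀ m, σ (lin q m) = m - lin ι (ρ m)) ∧ (∀ x, lin q (lin ι x) = 0) := by
  have hker : ∀ x, lin (toQuotient (range ι)) (lin ι x) = 0 := fun x =>
    (Submodule.Quotient.mk_eq_zero _).2 ⟨x, rfl⟩
  let σ : (quotient (range ι)).carrier →ₗ[Aᵐᵒᵖ] M.carrier :=
    (range ι).toSubmodule.liftQ (LinearMap.id - lin ι ∘ₗ ρ) (by
      rintro _ ⟨x, rfl⟩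
      simp [hρι])
  have hσ : ∀ m, σ (lin (toQuotient (range ι)) m) = m - lin ι (ρ m) := fun m => rfl
  refine ⟨quotient (range ι), toQuotient _, σ, ?_, ?_, hσ, hker⟩
  · rintro i _ ⟨m, hm, rfl⟩
    exact sub_mem hm (lin_mem ι (hρ i m hm))
  · intro y
    obtain ⟨m, rfl⟩ := (range ι).toSubmodule.mkQ_surjective y
    change lin (toQuotient (range ι)) (σ (lin (toQuotient (range ι)) m)) = _
    rw [hσ, map_sub, hker, sub_zero]
    rfl

/-! ### Splitting off `L ⊗_{A⁰} A` from the bottom -/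

/-- Cycles of degree b that form an A⁰-module extend to a dg map; the sign (-1)^b in the shifted
differential is the Leibniz sign of d(φ(l) a) = (-1)^b φ(l) d a. -/
theorem exists_hatHom (h : 𝒜.IsPosSemisimple) {L : Type u} [AddCommGroup L]
    [Module (𝒜.gr 0)ᵐᵒᵖ L] (M : DGMod 𝒜) {b : ℤ} (φ : L →+ M.carrier)
    (hφ : ∀ (a : 𝒜.gr 0) (l : L), φ (l <• a) = φ l <• (a : A))
    (hmem : ∀ l, φ l ∈ M.gr b) (hd : ∀ l, M.d (φ l) = 0) :
    ∃ ι : shift (-b) (hat 𝒜 L h) ⟶ M, ∀ l, lin ι (hatMk 𝒜 l 1) = φ l := by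
  obtain ⟨Φ, hΦ⟩ := exists_hatLift L φ hφ
  refine ⟨ofLin (M := shift (-b) (hat 𝒜 L h)) Φ ?_ ?_, fun l => ?_⟩
  · intro i m hm
    have hle : hatGr 𝒜 L (i + -b) ≤ (M.gr i).comap Φ.toAddMonoidHom := by
      refine (AddSubgroup.closure_le _).2 ?_
      rintro _ ⟨l, a, ha, rfl⟩
      have := M.smul_mem (hmem l) ha
      rw [show b + (i + -b) = i by ring] at this
      exact (congrArg (· ∈ M.gr i) (hΦ l a)).mpr this
    exact hle hm
  · have key : ∀ x : HatCarrier 𝒜 L,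
        Φ (show HatCarrier 𝒜 L from (hat 𝒜 L h).d x) = b.negOnePow • M.d (Φ x) := by
      intro x
      induction x using hat_induction with
      | h0 =>
        rw [map_zero, map_zero, smul_zero]
        exact (congrArg Φ ((hat 𝒜 L h).d.map_zero)).trans (map_zero Φ)
      | hmk l a =>
        rw [hΦ, M.leibniz (hmem l), hd, smul_zero, zero_add, smul_smul, ← Int.negOnePow_add,
          Int.negOnePow_even _ (Even.add_self b), one_smul]
        exact hΦ l (𝒜.d a)
      | hadd x y hx hy =>
        rw [map_add, map_add, smul_add, ← hx, ← hy, ← map_add]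
        exact congrArg Φ ((hat 𝒜 L h).d.map_add x y)
    intro m
    rcases Int.even_or_odd b with hb | hb
    · have hm := key m
      rw [Int.negOnePow_even b hb, one_smul] at hm
      have e : (shift (-b) (hat 𝒜 L h)).d m = (hat 𝒜 L h).d m := by
        change (-b).negOnePow • (hat 𝒜 L h).d m = _
        rw [Int.negOnePow_neg, Int.negOnePow_even b hb, one_smul]
      exact (congrArg Φ e).trans hm
    · have hm := key m
      rw [Int.negOnePow_odd b hb, Units.neg_smul, one_smul] at hm
      have e : (shift (-b) (hat 𝒜 L h)).d m = -(hat 𝒜 L h).d m := by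
        change (-b).negOnePow • (hat 𝒜 L h).d m = _
        rw [Int.negOnePow_neg, Int.negOnePow_odd b hb, Units.neg_smul, one_smul]
      refine (congrArg Φ e).trans ((map_neg Φ _).trans ?_)
      exact neg_eq_iff_eq_neg.2 hm
  · exact (hΦ l 1).trans (by rw [MulOpposite.op_one, one_smul])

/-- The situation in which the dg module `X` is a shift of `L ⊗_{A⁰} A` for a simple `L`, embedded
in `M` as a graded direct summand and not contained in `M A⁺`. -/
theorem exists_split_hat (h : 𝒜.IsPosSemisimple) {L : Type u} [AddCommGroup L]
    [Module (𝒜.gr 0)ᵐᵒᵖ L] (M : DGMod 𝒜) [Module.Projective Aᵐᵒᵖ M.carrier] {b : ℤ}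
    (ι : shift (-b) (hat 𝒜 L h) ⟶ M) (hι : ∀ l : L, lin ι (hatMk 𝒜 l 1) ∈ M.plus → l = 0) :
    ∃ ρ : M.carrier →ₗ[Aᵐᵒᵖ] (shift (-b) (hat 𝒜 L h)).carrier,
      (∀ i, ∀ m ∈ M.gr i, ρ m ∈ (shift (-b) (hat 𝒜 L h)).gr i) ∧ ∀ x, ρ (lin ι x) = x := by
  obtain ⟨ρ, hρ, hρ'⟩ := exists_retraction h M ((lin ι).toAddMonoidHom.comp (hatUnit L))
    (b := b) (fun a l => (congrArg (lin ι) (hatUnit_smul L a l)).trans ((lin ι).map_smul _ _))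
    (fun l => lin_mem ι (by
      change hatMk 𝒜 l 1 ∈ (hat 𝒜 L h).gr (b + -b)
      rw [add_neg_cancel]
      exact hatMk_one_mem L h l)) hι
  refine ⟨ρ, hρ, fun x => ?_⟩
  let ι' : HatCarrier 𝒜 L →ₗ[Aᵐᵒᵖ] M.carrier := lin ι
  have : ρ ∘ₗ ι' = LinearMap.id := hat_hom_ext fun l => hρ' l
  exact LinearMap.congr_fun this x

theorem exists_simple_of_nontrivial (R : Type*) (V : Type u) [Ring R] [IsSemisimpleRing R]
    [AddCommGroup V] [Module R V] [Nontrivial V] :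
    ∃ (L : Type u) (_ : AddCommGroup L) (_ : Module R L) (j : L →ₗ[R] V),
      IsSimpleModule R L ∧ Function.Injective j := by
  obtain ⟨L, hL⟩ := IsSemisimpleModule.exists_simple_submodule R V
  exact ⟨L, inferInstance, inferInstance, L.subtype, hL, L.subtype_injective⟩

/-- A simple L is taken among the cycles of lowest degree. That degree meets M A⁺ trivially, so the
induced map from the shifted L ⊗ A to M has a graded retraction. -/
theorem IsHatFiltered.exists_bottom (h : 𝒜.IsPosSemisimple) {M : DGMod 𝒜} (hM : M.IsHatFiltered)
    [Nontrivial M.carrier] :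
    ∃ a : ℤ, (∀ i < a, M.gr i = ⊥) ∧ M.gr a ≠ ⊥ ∧ ∃ (L : Type u) (_ : AddCommGroup L)
      (_ : Module (𝒜.gr 0)ᵐᵒᵖ L), IsSimpleModule (𝒜.gr 0)ᵐᵒᵖ L ∧
      ∃ (ι : shift (-a) (hat 𝒜 L h) ⟶ M)
        (ρ : M.carrier →ₗ[Aᵐᵒᵖ] (shift (-a) (hat 𝒜 L h)).carrier),
        (∀ i, ∀ m ∈ M.gr i, ρ m ∈ (shift (-a) (hat 𝒜 L h)).gr i) ∧ (∀ x, ρ (lin ι x) = x) ∧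
        ∃ x, lin ι x ∉ M.plus := by
  have := hM.finite
  have := hM.projective
  obtain ⟨a, ha, ⟨x, hx, hx0⟩, hplus⟩ := exists_lowest h M
  let _ := zeroModule 𝒜 M.carrier
  have := h.semisimple_op
  let V : Submodule (𝒜.gr 0)ᵐᵒᵖ M.carrier :=
    { carrier := {x | x ∈ M.gr a ∧ M.d x = 0}
      zero_mem' := ⟨zero_mem _, map_zero _⟩
      add_mem' := fun hx hy => ⟨add_mem hx.1 hy.1, by rw [map_add, hx.2, hy.2, add_zero]⟩
      smul_mem' := fun b x hx => by
        change x <• (b.unop : A) ∈ M.gr a ∧ M.d (x <• (b.unop : A)) = 0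
        refine ⟨by simpa using M.smul_mem hx.1 b.unop.2, ?_⟩
        rw [M.d_smul_of_mem_zero h x b.unop.2, hx.2, smul_zero] }
  have hV : Nontrivial V := by
    rw [Submodule.nontrivial_iff_ne_bot]
    intro hbot
    -- Without nonzero cycles in degree a the induction principle would apply to the zero submodule
    -- and kill the lowest degree.
    refine hx0 (hM.induction a ⊥ (fun i hi y hy => ?_) (fun y hy hdy => ?_) x hx)
    · rwa [ha i hi] at hy
    · have : y ∈ V := ⟨hy, hdy⟩
      rwa [hbot] at this
  obtain ⟨L, _, _, j, hL, hj⟩ := exists_simple_of_nontrivial (𝒜.gr 0)ᵐᵒᵖ V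
  have := IsSimpleModule.nontrivial (𝒜.gr 0)ᵐᵒᵖ L
  obtain ⟨ι, hι⟩ := exists_hatHom h M (L := L) (b := a) (V.subtype ∘ₗ j).toAddMonoidHom
    (fun a l => (V.subtype ∘ₗ j).map_smul (op a) l) (fun l => (j l).2.1) (fun l => (j l).2.2)
  have hι' : ∀ l : L, lin ι (hatMk 𝒜 l 1) ∈ M.plus → l = 0 := fun l hl => by
    rw [hι] at hl
    exact hj ((Subtype.ext (hplus _ (j l).2.1 hl)).trans (map_zero j).symm)
  obtain ⟨ρ, hρ, hρι⟩ := exists_split_hat h M ι hι'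
  obtain ⟨l, hl⟩ := exists_ne (0 : L)
  exact ⟨a, ha, fun hbot => hx0 (by rwa [hbot] at hx), L, inferInstance, inferInstance, hL, ι, ρ,
    hρ, hρι, hatMk 𝒜 l 1, fun hl' => hl (hι' l hl')⟩

theorem IsHatFiltered.of_split {M Q : DGMod 𝒜} (hM : M.IsHatFiltered) (q : M ⟶ Q)
    (σ : Q.carrier →ₗ[Aᵐᵒᵖ] M.carrier) (hσ : ∀ y, lin q (σ y) = y) : Q.IsHatFiltered := by
  have := hM.projective
  have : Module.Projective Aᵐᵒᵖ Q.carrier :=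
    Module.Projective.of_split σ (lin q) (LinearMap.ext hσ)
  exact hM.of_surjective q fun y => ⟨σ y, hσ y⟩

end DGMod

namespace DGMod

variable {k : Type w} {A : Type u} [CommRing k] [Ring A] [Algebra k A] {𝒜 : DGAlgebra k A}

/-! ### From the internal characterization to filtrations -/

theorem isSimpleHatSubquotient_preimage (h : 𝒜.IsPosSemisimple) {M Q : DGMod 𝒜} (q : M ⟶ Q)
    (hq : Function.Surjective (lin q)) {F G : DGSubmodule Q} {l : ℤ}
    (hFG : IsSimpleHatSubquotient h F G l) :
    IsSimpleHatSubquotient h (F.preimage q) (G.preimage q) l := by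
  obtain ⟨hle, L, _, _, hL, π, hπ, hker⟩ := hFG
  let q' : (G.preimage q).toDGMod ⟶ G.toDGMod :=
    ofLin (M := (G.preimage q).toDGMod) (N := G.toDGMod)
      ((lin q).restrict (p := (G.preimage q).toSubmodule) (q := G.toSubmodule) fun m hm => hm)
      (fun hm => lin_mem q hm) (fun m => Subtype.ext (lin_comm q m.1))
  refine ⟨fun m hm => hle hm, L, _, _, hL, q' ≫ π, fun y => ?_, fun m => hker _⟩
  obtain ⟨⟨x, hx⟩, rfl⟩ := hπ y
  obtain ⟨m, rfl⟩ := hq x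
  exact ⟨⟨m, hx⟩, rfl⟩

/-- Split off the bottom L ⊗ A, filter the quotient, and pull back. The bound by c is carried along
so that the weights stay decreasing: the quotient has no degrees below a, so its weights are at most
-a. -/
theorem IsHatFiltered.exists_filtration (h : 𝒜.IsPosSemisimple) {M : DGMod 𝒜}
    (hM : M.IsHatFiltered) (c : ℤ) (hc : ∀ i < -c, M.gr i = ⊥) :
    ∃ (n : ℕ) (F : Fin (n + 1) → DGSubmodule M) (l : Fin n → ℤ),
      (F 0).toSubmodule = ⊥ ∧ (F (Fin.last n)).toSubmodule = ⊤ ∧ Antitone l ∧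
      (∀ i : Fin n, IsSimpleHatSubquotient h (F i.castSucc) (F i.succ) (l i)) ∧
      ∀ i, l i ≤ c := by
  induction hn : M.topLength using WellFoundedLT.induction generalizing M c with
  | ind n ih =>
  subst hn
  have := hM.finite
  cases subsingleton_or_nontrivial M.carrier with
  | inl hs =>
    exact ⟨0, fun _ => DGSubmodule.zero M, Fin.elim0, rfl, Subsingleton.elim _ _,
      fun i => i.elim0, fun i => i.elim0, fun i => i.elim0⟩
  | inr hs =>
    obtain ⟨a, ha, ha', L, _, _, hL, ι, ρ, hρ, hρι, x, hx⟩ := hM.exists_bottom h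
    obtain ⟨Q, q, σ, hσ, hqσ, hσq, hqι⟩ := exists_split_quotient ι ρ hρ hρι
    have hq : Function.Surjective (lin q) := fun y => ⟨σ y, hqσ y⟩
    have hac : -a ≤ c := by
      by_contra hlt
      exact ha' (hc a (by omega))
    obtain ⟨n, F, l, hF0, hFn, hl, hF, hlc⟩ := ih Q.topLength
      (topLength_lt h (lin q) hq hx (by rw [hqι]; exact zero_mem _))
      (hM.of_split q σ hqσ) (-a) (fun i hi => by
        rw [eq_bot_iff]
        intro y hy
        have := hσ i y hy
        rw [ha i (by omega), AddSubgroup.mem_bot] at this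
        rw [← hqσ y, this, map_zero]
        exact zero_mem _) rfl
    refine ⟨n + 1, Fin.cons (DGSubmodule.zero M) fun i => (F i).preimage q, Fin.cons (-a) l,
      rfl, ?_, ?_, ?_, ?_⟩
    · rw [← Fin.succ_last, Fin.cons_succ]
      exact eq_top_iff.2 fun m _ => by
        change lin q m ∈ (F (Fin.last n)).toSubmodule
        rw [hFn]
        trivial
    · intro i j hij
      induction j using Fin.cases with
      | zero => rw [Fin.le_zero_iff.1 hij]
      | succ j =>
        induction i using Fin.cases with
        | zero => simpa using hlc j
        | succ i => simpa using hl (Fin.succ_le_succ_iff.1 hij)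
    · intro i
      induction i using Fin.cases with
      | zero =>
        refine ⟨bot_le, L, _, _, hL, ?_⟩
        -- The first nonzero step is the image of ι; only there does ρ commute with the
        -- differentials.
        have hmem : ∀ m : M.carrier, m ∈ ((F 0).preimage q).toSubmodule →
            m = lin ι (ρ m) := fun m hm => by
          change lin q m ∈ (F 0).toSubmodule at hm
          rw [hF0, Submodule.mem_bot] at hm
          have := hσq m
          rw [hm, map_zero] at this
          exact (sub_eq_zero.1 this.symm)
        refine ⟨ofLin (M := ((F 0).preimage q).toDGMod)
          (ρ ∘ₗ ((F 0).preimage q).toSubmodule.subtype) (fun hm => hρ _ _ hm) (fun m => ?_),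
          fun y => ⟨⟨lin ι y, ?_⟩, hρι y⟩, fun m => ⟨fun hm => ?_, fun hm => ?_⟩⟩
        · change ρ (M.d m.1) = (shift (-a) (hat 𝒜 L h)).d (ρ m.1)
          conv_lhs => rw [hmem m.1 m.2, ← lin_comm, hρι]
        · change lin q (lin ι y) ∈ (F 0).toSubmodule
          exact (congrArg (· ∈ (F 0).toSubmodule) (hqι y)).mpr (zero_mem _)
        · change ρ m.1 = 0 at hm
          have := hmem m.1 m.2
          rw [hm, map_zero] at this
          rw [this]
          exact zero_mem _
        · have hm0 : m.1 = 0 := hm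
          change ρ m.1 = 0
          rw [hm0, map_zero]
      | succ i => simpa using isSimpleHatSubquotient_preimage h q hq (hF i)
    · intro i
      induction i using Fin.cases with
      | zero => simpa using hac
      | succ i =>
        rw [Fin.cons_succ]
        exact (hlc i).trans hac

theorem IsHatFiltered.hasHatFiltration (h : 𝒜.IsPosSemisimple) {M : DGMod 𝒜}
    (hM : M.IsHatFiltered) : HasHatFiltration h M := by
  have := hM.finite
  obtain ⟨c, -, hc, -⟩ := exists_bounds h M
  obtain ⟨n, F, l, h₁, h₂, h₃, h₄, -⟩ := hM.exists_filtration h (-c) (by simpa using hc)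
  exact ⟨n, F, l, h₁, h₂, h₃, h₄⟩

/-! ### From filtrations to the internal characterization -/

section Subquotient

variable {h : 𝒜.IsPosSemisimple} {M : DGMod 𝒜} {F G : DGSubmodule M} {l : ℤ}

theorem IsSimpleHatSubquotient.mem_of_lt (hFG : IsSimpleHatSubquotient h F G l) {j : ℤ}
    (hj : j < -l) {x : M.carrier} (hx : x ∈ G.toSubmodule) (hxj : x ∈ M.gr j) :
    x ∈ F.toSubmodule := by
  obtain ⟨-, L, _, _, -, π, -, hker⟩ := hFG
  refine (hker ⟨x, hx⟩).1 ?_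
  have : lin π ⟨x, hx⟩ ∈ (hat 𝒜 L h).gr (j + l) := lin_mem π (m := (⟨x, hx⟩ : G.toSubmodule)) hxj
  rwa [hat_gr_eq_bot L h (by omega)] at this

/-- The layer is generated over A by the cycles b ⊗ 1 of degree -l; lifted to G in that degree, they
have differentials in F. -/
theorem IsSimpleHatSubquotient.le_of_generators (hFG : IsSimpleHatSubquotient h F G l)
    (S : Submodule Aᵐᵒᵖ M.carrier) (hFS : F.toSubmodule ≤ S)
    (hS : ∀ x ∈ G.toSubmodule, x ∈ M.gr (-l) → M.d x ∈ F.toSubmodule → x ∈ S) :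
    G.toSubmodule ≤ S := by
  obtain ⟨hle, L, _, _, -, π, hπ, hker⟩ := hFG
  have gen : ∀ b : L, ∃ y : G.toSubmodule, y.1 ∈ S ∧ lin π y = hatMk 𝒜 b 1 := by
    intro b
    obtain ⟨y, hy⟩ := hπ (hatMk 𝒜 b 1)
    have hmem : (hatMk 𝒜 b 1 : (shift l (hat 𝒜 L h)).carrier) ∈
        (shift l (hat 𝒜 L h)).gr (-l) := by
      change hatMk 𝒜 b 1 ∈ (hat 𝒜 L h).gr (-l + l)
      rw [neg_add_cancel]
      exact hatMk_one_mem L h b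
    obtain ⟨z, hz, hzy⟩ : ∃ z ∈ G.toDGMod.gr (-l), lin π z = hatMk 𝒜 b 1 := by
      refine ⟨G.toDGMod.proj (-l) y, G.toDGMod.proj_mem _ _, ?_⟩
      rw [← proj_lin, hy, proj_of_mem _ hmem]
    refine ⟨z, hS z.1 z.2 hz ((hker (G.toDGMod.d z)).1 ?_), hzy⟩
    rw [lin_comm, hzy]
    change l.negOnePow • (hat 𝒜 L h).d (hatMk 𝒜 b 1) = 0
    rw [hat_d_hatMk_one]
    exact smul_zero _
  have all : ∀ z : HatCarrier 𝒜 L, ∃ y : G.toSubmodule, y.1 ∈ S ∧ lin π y = z := by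
    intro z
    induction z using hat_induction with
    | h0 => exact ⟨0, zero_mem _, map_zero (lin π)⟩
    | hmk b a =>
      obtain ⟨y, hyS, hy⟩ := gen b
      refine ⟨y <• a, S.smul_mem _ hyS, ?_⟩
      rw [hatMk_eq_smul]
      exact ((lin π).map_smul (op a) y).trans (congrArg (· <• a) hy)
    | hadd z z' hz hz' =>
      obtain ⟨y, hyS, rfl⟩ := hz
      obtain ⟨y', hyS', rfl⟩ := hz'
      exact ⟨y + y', add_mem hyS hyS', (lin π).map_add y y'⟩
  intro x hx
  obtain ⟨y, hyS, hy⟩ := all (lin π ⟨x, hx⟩)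
  have hxy : (⟨x, hx⟩ - y : G.toSubmodule).1 ∈ F.toSubmodule :=
    (hker _).1 (((lin π).map_sub _ _).trans (sub_eq_zero.2 hy.symm))
  have := add_mem (hFS hxy) hyS
  simpa using this

/-- The layer is projective, so over A the submodule G is the direct sum of F and L ⊗ A. -/
theorem IsSimpleHatSubquotient.finite_projective (hFG : IsSimpleHatSubquotient h F G l)
    (hF : Module.Finite Aᵐᵒᵖ F.toSubmodule ∧ Module.Projective Aᵐᵒᵖ F.toSubmodule) :
    Module.Finite Aᵐᵒᵖ G.toSubmodule ∧ Module.Projective Aᵐᵒᵖ G.toSubmodule := by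
  obtain ⟨_, _⟩ := hF
  obtain ⟨hle, L, _, _, hL, π, hπ, hker⟩ := hFG
  have := projective_hat L h
  have := finite_hat L (𝒜 := 𝒜)
  let π' : G.toSubmodule →ₗ[Aᵐᵒᵖ] HatCarrier 𝒜 L := lin π
  obtain ⟨s, hs⟩ := Module.projective_lifting_property π' LinearMap.id hπ
  have hs' : ∀ z, π' (s z) = z := LinearMap.congr_fun hs
  let e : (F.toSubmodule × HatCarrier 𝒜 L) →ₗ[Aᵐᵒᵖ] G.toSubmodule :=
    (Submodule.inclusion hle).coprod s
  have hπF : ∀ x : F.toSubmodule, π' (Submodule.inclusion hle x) = 0 := fun x => (hker _).2 x.2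
  have he : Function.Bijective e := by
    constructor
    · refine (injective_iff_map_eq_zero e).2 ?_
      rintro ⟨x, z⟩ hxz
      rw [LinearMap.coprod_apply] at hxz
      have hz : z = 0 := by
        have := congrArg π' hxz
        rwa [map_add, hπF, hs', zero_add, map_zero] at this
      subst hz
      rw [map_zero, add_zero] at hxz
      exact Prod.ext (Submodule.inclusion_injective hle (hxz.trans (map_zero _).symm)) rfl
    · intro y
      have hy : (y - s (π' y)).1 ∈ F.toSubmodule := (hker _).1 (by
        change π' (y - s (π' y)) = 0
        rw [map_sub, hs', sub_self])
      refine ⟨(⟨_, hy⟩, π' y), ?_⟩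
      rw [LinearMap.coprod_apply]
      exact sub_add_cancel y (s (π' y))
  let E := LinearEquiv.ofBijective e he
  exact ⟨Module.Finite.equiv E, Module.Projective.of_equiv E⟩

end Subquotient

/-- Since the l_i decrease, the layers are generated in increasing degrees -l_i. Layers generated in
degrees at most j are absorbed into S one after another; the remaining ones have nothing in degree
j. -/
theorem HasHatFiltration.isHatFiltered {h : 𝒜.IsPosSemisimple} {M : DGMod 𝒜}
    (hM : HasHatFiltration h M) : M.IsHatFiltered := by
  obtain ⟨n, F, l, hF0, hFn, hl, hF⟩ := hM
  have fp : ∀ i, Module.Finite Aᵐᵒᵖ (F i).toSubmodule ∧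
      Module.Projective Aᵐᵒᵖ (F i).toSubmodule := by
    intro i
    induction i using Fin.induction with
    | zero =>
      rw [hF0]
      exact ⟨inferInstance, inferInstance⟩
    | succ i ih => exact (hF i).finite_projective ih
  have fpn := fp (Fin.last n)
  rw [hFn] at fpn
  obtain ⟨_, _⟩ := fpn
  have eT : (⊤ : Submodule Aᵐᵒᵖ M.carrier) ≃ₗ[Aᵐᵒᵖ] M.carrier := Submodule.topEquiv
  refine ⟨Module.Finite.equiv eT, Module.Projective.of_equiv eT, fun j S h₁ h₂ x hx => ?_⟩
  -- The first half says that F i lies in S as soon as some later layer is generated in degree at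
  -- most j. It is needed when -l i = j: the differentials of the new generators lie in the previous
  -- step, which must already be inside S.
  have key : ∀ i : Fin (n + 1), (∀ i' : Fin n, i ≤ i'.castSucc → -l i' ≤ j →
      (F i).toSubmodule ≤ S) ∧ ∀ y ∈ (F i).toSubmodule, y ∈ M.gr j → y ∈ S := by
    intro i
    induction i using Fin.induction with
    | zero =>
      rw [hF0]
      refine ⟨fun _ _ _ => bot_le, fun y hy _ => ?_⟩
      rw [(Submodule.mem_bot _).1 hy]
      exact zero_mem _
    | succ i ih =>
      have big : -l i ≤ j → (F i.succ).toSubmodule ≤ S := by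
        intro hij
        have hle := ih.1 i le_rfl hij
        refine (hF i).le_of_generators S hle fun y hy hyl hdy => ?_
        rcases lt_or_eq_of_le hij with hlt | heq
        · exact h₁ _ hlt y hyl
        · exact h₂ y (heq ▸ hyl) (hle hdy)
      refine ⟨fun i' hi' hij => big ?_, fun y hy hyj => ?_⟩
      · have := hl (Fin.castSucc_lt_castSucc_iff.1 (Fin.castSucc_lt_succ.trans_le hi')).le
        omega
      · by_cases hij : -l i ≤ j
        · exact big hij hy
        · exact ih.2 y ((hF i).mem_of_lt (by omega) hy hyj) hyj
  exact (key (Fin.last n)).2 x (hFn ▸ trivial) hx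

theorem hasHatFiltration_iff (h : 𝒜.IsPosSemisimple) (M : DGMod 𝒜) :
    HasHatFiltration h M ↔ M.IsHatFiltered :=
  ⟨fun hM => hM.isHatFiltered, fun hM => hM.hasHatFiltration h⟩

end DGMod

namespace DGMod

variable {k : Type w} {A : Type u} [CommRing k] [Ring A] [Algebra k A] {𝒜 : DGAlgebra k A}

/-! ### Homotopy retracts -/

theorem Homotopic.refl {M N : DGMod 𝒜} (f : M ⟶ N) : Homotopic f f :=
  (inferInstance : Congruence (Homotopic (𝒜 := 𝒜))).equivalence.refl f

theorem Homotopic.of_eq {M N : DGMod 𝒜} {f g : M ⟶ N} (hfg : f = g) : Homotopic f g :=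
  hfg ▸ Homotopic.refl f

theorem Homotopic.trans {M N : DGMod 𝒜} {f g e : M ⟶ N} (h₁ : Homotopic f g)
    (h₂ : Homotopic g e) : Homotopic f e :=
  (inferInstance : Congruence (Homotopic (𝒜 := 𝒜))).equivalence.trans h₁ h₂

/-- `N` is a retract of `M` in the homotopy category. -/
def HomotopyRetract (N M : DGMod 𝒜) : Prop :=
  ∃ (i : N ⟶ M) (r : M ⟶ N), Homotopic (i ≫ r) (𝟙 N)

theorem HomotopyRetract.refl (M : DGMod 𝒜) : HomotopyRetract M M :=
  ⟨𝟙 M, 𝟙 M, Homotopic.of_eq (Category.comp_id _)⟩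

theorem HomotopyRetract.trans {M N P : DGMod 𝒜} (h₁ : HomotopyRetract M N)
    (h₂ : HomotopyRetract N P) : HomotopyRetract M P := by
  obtain ⟨i, r, h⟩ := h₁
  obtain ⟨i', r', h'⟩ := h₂
  refine ⟨i ≫ i', r' ≫ r, Homotopic.trans ?_ h⟩
  have e : (i ≫ i') ≫ r' ≫ r = i ≫ (i' ≫ r') ≫ r := by simp only [Category.assoc]
  rw [e]
  have : Homotopic (i ≫ (i' ≫ r') ≫ r) (i ≫ 𝟙 N ≫ r) :=
    HomRel.comp_left (r := Homotopic) i (HomRel.comp_right (r := Homotopic) r h')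
  rwa [Category.id_comp] at this

/-- The shift of a morphism. -/
def shiftMap (l : ℤ) {M N : DGMod 𝒜} (f : M ⟶ N) : shift l M ⟶ shift l N :=
  ofLin (M := shift l M) (N := shift l N) (show M.carrier →ₗ[Aᵐᵒᵖ] N.carrier from lin f)
    (fun hm => lin_mem f hm) (by
      intro (m : M.carrier)
      change lin f (l.negOnePow • M.d m) = l.negOnePow • N.d (lin f m)
      rcases Int.even_or_odd l with hl | hl
      · rw [Int.negOnePow_even l hl, one_smul, one_smul, lin_comm]
      · rw [Int.negOnePow_odd l hl, Units.neg_smul, Units.neg_smul, one_smul, one_smul, map_neg,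
          lin_comm])

theorem HomotopyRetract.shiftObj {M N : DGMod 𝒜} (h : HomotopyRetract M N) (l : ℤ) :
    HomotopyRetract (shift l M) (shift l N) := by
  obtain ⟨i, r, s, hs, hs'⟩ := h
  refine ⟨shiftMap l i, shiftMap l r, ?_⟩
  rcases Int.even_or_odd l with hl | hl
  · refine ⟨s, fun j m hm => ?_, fun (m : M.carrier) => ?_⟩
    · have := hs _ m hm
      rwa [show j + l - 1 = j - 1 + l by ring] at this
    · change lin r (lin i m) = m + (l.negOnePow • M.d (s m) + s (l.negOnePow • M.d m))
      rw [Int.negOnePow_even l hl, one_smul, one_smul]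
      exact hs' m
  · refine ⟨-s, fun j m hm => ?_, fun (m : M.carrier) => ?_⟩
    · have := (M.gr _).neg_mem (hs _ m hm)
      rwa [show j + l - 1 = j - 1 + l by ring] at this
    · change lin r (lin i m) = m + (l.negOnePow • M.d (-s m) + -s (l.negOnePow • M.d m))
      rw [Int.negOnePow_odd l hl, Units.neg_smul, Units.neg_smul, one_smul, one_smul, map_neg,
        map_neg, neg_neg, neg_neg]
      exact hs' m

/-! ### Cones and retracts -/

/-- The maps are (n, m) ↦ (β n, m) and (n, m) ↦ (β' n + s f m, m); the term s f m compensates for β'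
β f being only homotopic to f. The homotopy is s on the first factor. -/
theorem cone_retract_target {M N N₀ : DGMod 𝒜} (f : M ⟶ N) (β : N ⟶ N₀) (β' : N₀ ⟶ N)
    (hβ : Homotopic (β ≫ β') (𝟙 N)) : HomotopyRetract (cone f) (cone (f ≫ β)) := by
  obtain ⟨s, hs, hs'⟩ := hβ
  replace hs' : ∀ n, lin β' (lin β n) = n + (N.d (s n) + s (N.d n)) := hs'
  refine ⟨ofLin (M := cone f) (N := cone (f ≫ β)) ((lin β).prodMap LinearMap.id)
      (fun hm => ⟨lin_mem β hm.1, hm.2⟩) ?_,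
    ofLin (M := cone (f ≫ β)) (N := cone f)
      (LinearMap.prod (lin β' ∘ₗ LinearMap.fst _ _ _ + (s ∘ₗ lin f) ∘ₗ LinearMap.snd _ _ _)
        (LinearMap.snd Aᵐᵒᵖ N₀.carrier M.carrier))
      (fun {i m} hm => ⟨add_mem (lin_mem β' hm.1) ?_, hm.2⟩) ?_,
    LinearMap.prod (s ∘ₗ LinearMap.fst _ _ _) (0 : N.carrier × M.carrier →ₗ[Aᵐᵒᵖ] M.carrier),
    fun i m hm => ⟨hs _ _ hm.1, zero_mem _⟩, ?_⟩
  · rintro ⟨n, m⟩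
    refine Prod.ext ?_ rfl
    change lin β (N.d n + lin f m) = N₀.d (lin β n) + lin β (lin f m)
    rw [map_add, lin_comm]
  · have := hs _ _ (lin_mem f hm.2)
    rwa [add_sub_cancel_right] at this
  · rintro ⟨n, m⟩
    refine Prod.ext ?_ rfl
    change lin β' (N₀.d n + lin β (lin f m)) + s (lin f (-M.d m)) =
      N.d (lin β' n + s (lin f m)) + lin f m
    simp only [map_add, map_neg, hs', lin_comm]
    abel
  · rintro ⟨n, m⟩
    refine Prod.ext ?_ ?_
    · change lin β' (lin β n) + s (lin f m) =
        n + (N.d (s n) + lin f (0 : M.carrier) + s (N.d n + lin f m))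
      simp only [map_add, map_zero, hs']
      abel
    · change m = m + (-M.d 0 + 0)
      simp

/-- Here (n, m) ↦ (n - f s m, α m) and (n, m) ↦ (n, α' m), with homotopy -s on the second factor. -/
theorem cone_retract_source {M M₀ N : DGMod 𝒜} (f : M ⟶ N) (α : M ⟶ M₀) (α' : M₀ ⟶ M)
    (hα : Homotopic (α ≫ α') (𝟙 M)) : HomotopyRetract (cone f) (cone (α' ≫ f)) := by
  obtain ⟨s, hs, hs'⟩ := hα
  replace hs' : ∀ m, lin α' (lin α m) = m + (M.d (s m) + s (M.d m)) := hs'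
  refine ⟨ofLin (M := cone f) (N := cone (α' ≫ f))
      (LinearMap.prod (LinearMap.fst _ _ _ - (lin f ∘ₗ s) ∘ₗ LinearMap.snd _ _ _)
        (lin α ∘ₗ LinearMap.snd Aᵐᵒᵖ N.carrier M.carrier))
      (fun {i m} hm => ⟨(N.gr i).sub_mem hm.1 (lin_mem f ?_), lin_mem α hm.2⟩) ?_,
    ofLin (M := cone (α' ≫ f)) (N := cone f) (LinearMap.id.prodMap (lin α'))
      (fun hm => ⟨hm.1, lin_mem α' hm.2⟩) ?_,
    LinearMap.prod (0 : N.carrier × M.carrier →ₗ[Aᵐᵒᵖ] N.carrier) (-s ∘ₗ LinearMap.snd _ _ _),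
    fun i m hm => ⟨zero_mem _, (M.gr _).neg_mem ?_⟩, ?_⟩
  · have := hs _ _ hm.2
    rwa [add_sub_cancel_right] at this
  · rintro ⟨n, m⟩
    refine Prod.ext ?_ ?_
    · change N.d n + lin f m - lin f (s (-M.d m)) =
        N.d (n - lin f (s m)) + lin f (lin α' (lin α m))
      simp only [map_add, map_sub, map_neg, hs', lin_comm]
      abel
    · change lin α (-M.d m) = -M₀.d (lin α m)
      rw [map_neg, lin_comm]
  · rintro ⟨n, m⟩
    refine Prod.ext rfl ?_
    change lin α' (-M₀.d m) = -M.d (lin α' m)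
    rw [map_neg, lin_comm]
  · have := hs _ _ hm.2
    rwa [show i + 1 - 1 = i - 1 + 1 by ring] at this
  · rintro ⟨n, m⟩
    refine Prod.ext ?_ ?_
    · change n - lin f (s m) = n + (N.d 0 + lin f (-s m) + 0)
      simp only [map_neg, map_zero]
      abel
    · change lin α' (lin α m) = m + (-M.d (-s m) + -s (-M.d m))
      simp only [map_neg, hs']
      abel

/-- A morphism `ι : X ⟶ M` with cokernel `q : M ⟶ Q`, together with a splitting that respects the
gradings and the `A`-module structures (but not necessarily the differentials). -/
structure GradedSplit (X M Q : DGMod 𝒜) where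
  ι : X ⟶ M
  q : M ⟶ Q
  ρ : M.carrier →ₗ[Aᵐᵒᵖ] X.carrier
  σ : Q.carrier →ₗ[Aᵐᵒᵖ] M.carrier
  ρ_mem : ∀ i, ∀ m ∈ M.gr i, ρ m ∈ X.gr i
  σ_mem : ∀ i, ∀ y ∈ Q.gr i, σ y ∈ M.gr i
  ρ_ι : ∀ x, ρ (lin ι x) = x
  q_σ : ∀ y, lin q (σ y) = y
  σ_q : ∀ m, σ (lin q m) = m - lin ι (ρ m)
  q_ι : ∀ x, lin q (lin ι x) = 0

namespace GradedSplit

variable {X M Q : DGMod 𝒜} (S : GradedSplit X M Q)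

theorem ρ_σ (y : Q.carrier) : S.ρ (S.σ y) = 0 := by
  rw [← S.q_σ y, S.σ_q, map_sub, S.ρ_ι, sub_self]

/-- The map `ρ d σ`, which measures the failure of the splitting to respect the differentials. -/
def twist : Q.carrier →ₗ[Aᵐᵒᵖ] X.carrier :=
  linearOfHomogeneous 𝒜 (S.ρ.toAddMonoidHom.comp (M.d.comp S.σ.toAddMonoidHom)) fun s a ha y => by
    change S.ρ (M.d (S.σ (y <• a))) = S.ρ (M.d (S.σ y)) <• a
    induction y using Q.homogeneous_induction with
    | hom i y hy =>
      rw [map_smul, M.leibniz (S.σ_mem i y hy), map_add, map_smul]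
      have : S.ρ (S.σ y <• 𝒜.d a) = 0 := by rw [map_smul, ρ_σ, smul_zero]
      rcases Int.even_or_odd i with hi | hi
      · rw [Int.negOnePow_even i hi, one_smul, this, add_zero]
      · rw [Int.negOnePow_odd i hi, Units.neg_smul, one_smul, map_neg, this, neg_zero, add_zero]
    | add x y hx hy => simp only [smul_add, map_add, hx, hy]

theorem twist_apply (y : Q.carrier) : S.twist y = S.ρ (M.d (S.σ y)) := rfl

theorem twist_mem (i : ℤ) (y : Q.carrier) (hy : y ∈ Q.gr i) : S.twist y ∈ X.gr (i + 1) :=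
  S.ρ_mem _ _ (M.d_mem (S.σ_mem i y hy))

/-- The difference on the right is killed by q, hence comes from X; `twist` is its preimage. -/
theorem ι_twist (y : Q.carrier) : lin S.ι (S.twist y) = M.d (S.σ y) - S.σ (Q.d y) := by
  have := S.σ_q (M.d (S.σ y))
  rw [lin_comm, S.q_σ] at this
  rw [this, sub_sub_cancel, twist_apply]

theorem σ_d (y : Q.carrier) : S.σ (Q.d y) = M.d (S.σ y) - lin S.ι (S.twist y) := by
  rw [ι_twist, sub_sub_cancel]

theorem twist_d (y : Q.carrier) : S.twist (Q.d y) = -X.d (S.twist y) := by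
  rw [twist_apply, σ_d, map_sub, M.d_d, zero_sub, map_neg, ← lin_comm, S.ρ_ι]

theorem twist_q (m : M.carrier) : S.twist (lin S.q m) = S.ρ (M.d m) - X.d (S.ρ m) := by
  rw [twist_apply, S.σ_q, map_sub, map_sub, ← lin_comm, S.ρ_ι]

/-- The cone of a graded-split monomorphism is a homotopy retract of the cokernel. -/
theorem cone_retract : HomotopyRetract (cone S.ι) Q := by
  -- Project (m, x) to q m; return by y ↦ (σ y, -twist y), where the second entry restores
  -- compatibility with d. The homotopy is (m, x) ↦ (0, -ρ m).
  refine ⟨ofLin (M := cone S.ι) (lin S.q ∘ₗ LinearMap.fst Aᵐᵒᵖ M.carrier X.carrier)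
      (fun hm => lin_mem S.q hm.1) ?_,
    ofLin (N := cone S.ι) (LinearMap.prod S.σ (-S.twist))
      (fun {i y} hy => ⟨S.σ_mem i y hy, (X.gr _).neg_mem (S.twist_mem i y hy)⟩) ?_,
    LinearMap.prod (0 : M.carrier × X.carrier →ₗ[Aᵐᵒᵖ] M.carrier) (-S.ρ ∘ₗ LinearMap.fst _ _ _),
    fun i m hm => ⟨zero_mem _, (X.gr _).neg_mem ?_⟩, ?_⟩
  · rintro ⟨m, x⟩
    change lin S.q (M.d m + lin S.ι x) = Q.d (lin S.q m)
    rw [map_add, S.q_ι, add_zero, lin_comm]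
  · intro y
    refine Prod.ext ?_ ?_
    · change S.σ (Q.d y) = M.d (S.σ y) + lin S.ι (-S.twist y)
      rw [σ_d, map_neg, sub_eq_add_neg]
    · change -S.twist (Q.d y) = -X.d (-S.twist y)
      rw [twist_d, map_neg]
  · rw [sub_add_cancel]
    exact S.ρ_mem _ _ hm.1
  · rintro ⟨m, x⟩
    refine Prod.ext ?_ ?_
    · change S.σ (lin S.q m) = m + (M.d 0 + lin S.ι (-S.ρ m) + 0)
      rw [S.σ_q, map_zero, map_neg]
      abel
    · change -S.twist (lin S.q m) = x + (-X.d (-S.ρ m) + -S.ρ (M.d m + lin S.ι x))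
      rw [twist_q, map_neg, map_add, S.ρ_ι]
      abel

/-- An octahedron: if `X ⟶ M ⟶ Q` is graded-split, then the cone of `f : M ⟶ N` is a retract of
the cone of a morphism from `Q` to the cone of the restriction of `f` to `X`. -/
theorem exists_cone_retract {N : DGMod 𝒜} (f : M ⟶ N) :
    ∃ g : Q ⟶ cone (S.ι ≫ f), HomotopyRetract (cone f) (cone g) := by
  -- The connecting map y ↦ (f σ y, -twist y). With it the retraction holds strictly, without a
  -- homotopy, because ι ρ + σ q is the identity of M.
  let g : Q ⟶ cone (S.ι ≫ f) := ofLin (N := cone (S.ι ≫ f))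
    (LinearMap.prod (lin f ∘ₗ S.σ) (-S.twist))
    (fun {i y} hy => ⟨lin_mem f (S.σ_mem i y hy), (X.gr _).neg_mem (S.twist_mem i y hy)⟩) (by
      intro y
      refine Prod.ext ?_ ?_
      · change lin f (S.σ (Q.d y)) = N.d (lin f (S.σ y)) + lin f (lin S.ι (-S.twist y))
        rw [σ_d, map_neg, map_sub, map_neg, lin_comm, sub_eq_add_neg]
      · change -S.twist (Q.d y) = -X.d (-S.twist y)
        rw [twist_d, map_neg])
  refine ⟨g, ofLin (M := cone f) (N := cone g)
      (LinearMap.prod ((LinearMap.id : N.carrier →ₗ[Aᵐᵒᵖ] N.carrier).prodMap S.ρ)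
        (lin S.q ∘ₗ LinearMap.snd Aᵐᵒᵖ N.carrier M.carrier))
      (fun hm => ⟨⟨hm.1, S.ρ_mem _ _ hm.2⟩, lin_mem S.q hm.2⟩) ?_,
    ofLin (M := cone g) (N := cone f)
      (LinearMap.prod
        (LinearMap.fst _ _ _ ∘ₗ LinearMap.fst Aᵐᵒᵖ (N.carrier × X.carrier) Q.carrier)
        (lin S.ι ∘ₗ LinearMap.snd _ _ _ ∘ₗ LinearMap.fst Aᵐᵒᵖ (N.carrier × X.carrier) Q.carrier +
          S.σ ∘ₗ LinearMap.snd Aᵐᵒᵖ (N.carrier × X.carrier) Q.carrier))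
      (fun hm => ⟨hm.1.1, (M.gr _).add_mem (lin_mem S.ι hm.1.2) (S.σ_mem _ _ hm.2)⟩) ?_,
    Homotopic.of_eq (lin_injective (LinearMap.ext ?_))⟩
  · rintro ⟨n, m⟩
    refine Prod.ext (Prod.ext ?_ ?_) ?_
    · change N.d n + lin f m = N.d n + lin f (lin S.ι (S.ρ m)) + lin f (S.σ (lin S.q m))
      rw [S.σ_q, map_sub]
      abel
    · change S.ρ (-M.d m) = -X.d (S.ρ m) + -S.twist (lin S.q m)
      rw [twist_q, map_neg]
      abel
    · change lin S.q (-M.d m) = -Q.d (lin S.q m)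
      rw [map_neg, lin_comm]
  · rintro ⟨⟨n, x⟩, y⟩
    refine Prod.ext ?_ ?_
    · change N.d n + lin f (lin S.ι x) + lin f (S.σ y) = N.d n + lin f (lin S.ι x + S.σ y)
      rw [map_add, add_assoc]
    · change lin S.ι (-X.d x + -S.twist y) + S.σ (-Q.d y) = -M.d (lin S.ι x + S.σ y)
      rw [map_add, map_neg, map_neg, map_neg, ι_twist, lin_comm, map_add]
      abel
  · rintro ⟨n, m⟩
    refine Prod.ext rfl ?_
    change lin S.ι (S.ρ m) + S.σ (lin S.q m) = m
    rw [S.σ_q]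
    abel

end GradedSplit

theorem exists_gradedSplit {X M : DGMod 𝒜} (ι : X ⟶ M)
    (ρ : M.carrier →ₗ[Aᵐᵒᵖ] X.carrier) (hρ : ∀ i, ∀ m ∈ M.gr i, ρ m ∈ X.gr i)
    (hρι : ∀ x, ρ (lin ι x) = x) : ∃ (Q : DGMod 𝒜) (S : GradedSplit X M Q), S.ι = ι := by
  obtain ⟨Q, q, σ, h₁, h₂, h₃, h₄⟩ := exists_split_quotient ι ρ hρ hρι
  exact ⟨Q, ⟨ι, q, ρ, σ, hρ, h₁, hρι, h₂, h₃, h₄⟩, rfl⟩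

/-! ### Homotopy retracts of filtered dg modules -/

/-- `M` is a retract, up to homotopy, of a filtered dg module. -/
def IsFilteredRetract (M : DGMod 𝒜) : Prop :=
  ∃ M₀ : DGMod 𝒜, M₀.IsHatFiltered ∧ HomotopyRetract M M₀

theorem IsHatFiltered.isFilteredRetract {M : DGMod 𝒜} (hM : M.IsHatFiltered) :
    M.IsFilteredRetract :=
  ⟨M, hM, HomotopyRetract.refl M⟩

theorem IsFilteredRetract.of_retract {M N : DGMod 𝒜} (hM : M.IsFilteredRetract)
    (h : HomotopyRetract N M) : N.IsFilteredRetract := by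
  obtain ⟨M₀, hM₀, h₀⟩ := hM
  exact ⟨M₀, hM₀, h.trans h₀⟩

theorem IsHatFiltered.shiftObj {M : DGMod 𝒜} (hM : M.IsHatFiltered) (l : ℤ) :
    (shift l M).IsHatFiltered where
  finite := hM.finite
  projective := hM.projective
  induction j F h₁ h₂ x hx := by
    refine hM.induction (j + l) F (fun i hi y hy => h₁ (i - l) (by omega) y ?_)
      (fun y hy hdy => h₂ y hy ?_) x hx
    · change y ∈ M.gr (i - l + l)
      rwa [sub_add_cancel]
    · change l.negOnePow • M.d y ∈ F
      rcases Int.even_or_odd l with hl | hl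
      · rwa [Int.negOnePow_even l hl, one_smul]
      · rw [Int.negOnePow_odd l hl, Units.neg_smul, one_smul]
        exact neg_mem hdy

theorem IsFilteredRetract.shiftObj {M : DGMod 𝒜} (hM : M.IsFilteredRetract) (l : ℤ) :
    (shift l M).IsFilteredRetract := by
  obtain ⟨M₀, hM₀, h₀⟩ := hM
  exact ⟨shift l M₀, hM₀.shiftObj l, h₀.shiftObj l⟩

/-- The cone of a morphism from a shift of `L ⊗_{A⁰} A` to `N` is filtered if the morphism maps to
`N A⁺`. -/
theorem isHatFiltered_cone (h : 𝒜.IsPosSemisimple) {L : Type u} [AddCommGroup L]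
    [Module (𝒜.gr 0)ᵐᵒᵖ L] [IsSimpleModule (𝒜.gr 0)ᵐᵒᵖ L] {N : DGMod 𝒜} (hN : N.IsHatFiltered)
    {b : ℤ} (g : shift (-b) (hat 𝒜 L h) ⟶ N) (hg : ∀ l : L, lin g (hatMk 𝒜 l 1) ∈ N.plus) :
    (cone g).IsHatFiltered := by
  have := hN.finite
  have := hN.projective
  have := finite_hat (𝒜 := 𝒜) L
  have := projective_hat L h
  refine ⟨inferInstanceAs (Module.Finite Aᵐᵒᵖ (N.carrier × HatCarrier 𝒜 L)),
    inferInstanceAs (Module.Projective Aᵐᵒᵖ (N.carrier × HatCarrier 𝒜 L)), ?_⟩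
  intro j F h₁ h₂
  let inN : N.carrier →ₗ[Aᵐᵒᵖ] (cone g).carrier := LinearMap.inl Aᵐᵒᵖ N.carrier (HatCarrier 𝒜 L)
  let inX : HatCarrier 𝒜 L →ₗ[Aᵐᵒᵖ] (cone g).carrier :=
    LinearMap.inr Aᵐᵒᵖ N.carrier (HatCarrier 𝒜 L)
  have dN : ∀ n, (cone g).d (inN n) = inN (N.d n) := fun n => by
    refine Prod.ext ?_ ?_
    · change N.d n + lin g 0 = N.d n
      rw [map_zero, add_zero]
    · change -(shift (-b) (hat 𝒜 L h)).d 0 = 0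
      rw [map_zero, neg_zero]
  have hNlt : ∀ i < j, ∀ n ∈ N.gr i, inN n ∈ F := fun i hi n hn => h₁ i hi _ ⟨hn, zero_mem _⟩
  have hNF : ∀ n ∈ N.gr j, inN n ∈ F := by
    refine hN.induction j (F.comap inN) hNlt fun n hn hdn => ?_
    refine h₂ (inN n) ⟨hn, zero_mem _⟩ ?_
    rw [dN]
    exact hdn
  -- The generators l ⊗ 1 sit in degree b - 1 of the cone. The three cases are j < b - 1, where
  -- nothing is there; j = b - 1, the essential one; and j > b - 1, where the generators already lie
  -- in F.
  have hX : ∀ x ∈ (hat 𝒜 L h).gr (j + 1 + -b), inX x ∈ F := by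
    rcases lt_trichotomy (j + 1 + -b) 0 with hj | hj | hj
    · intro x hx
      rw [hat_gr_eq_bot L h hj, AddSubgroup.mem_bot] at hx
      rw [hx]
      exact (congrArg (· ∈ F) (map_zero inX)).mpr (zero_mem F)
    · rw [hj]
      intro x hx
      obtain ⟨l, rfl⟩ := exists_hatMk_of_mem_zero L h hx
      have hlb : lin g (hatMk 𝒜 l 1) ∈ N.gr b := lin_mem g (by
        change hatMk 𝒜 l 1 ∈ (hat 𝒜 L h).gr (b + -b)
        rw [add_neg_cancel]
        exact hx)
      refine h₂ _ ⟨zero_mem _, ?_⟩ ?_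
      · change hatMk 𝒜 l 1 ∈ (hat 𝒜 L h).gr (j + 1 + -b)
        rwa [hj]
      · have hd : (cone g).d (inX (hatMk 𝒜 l 1)) = inN (lin g (hatMk 𝒜 l 1)) := by
          refine Prod.ext ?_ ?_
          · change N.d 0 + lin g (hatMk 𝒜 l 1) = lin g (hatMk 𝒜 l 1)
            rw [map_zero, zero_add]
          · change -((-b).negOnePow • (hat 𝒜 L h).d (hatMk 𝒜 l 1)) = 0
            rw [hat_d_hatMk_one, smul_zero, neg_zero]
        rw [hd]
        -- Here b - 1 = j: the differential of l ⊗ 1 is g(l ⊗ 1), which lies in N A⁺ and has degree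
        -- b, so it is generated by elements of N of degree at most j, all of which are in F.
        have hle : N.genLE (b - 1) ≤ F.comap inN := by
          refine Submodule.span_le.2 ?_
          rintro n ⟨i, hi, hn⟩
          rcases lt_or_eq_of_le (show i ≤ j by omega) with hij | rfl
          · exact hNlt i hij n hn
          · exact hNF n hn
        exact hle (N.mem_genLE_of_mem_plus h (hg l) hlb)
    · intro x hx
      clear hx
      have hgen : ∀ l : L, inX (hatMk 𝒜 l 1) ∈ F := fun l => h₁ (b - 1) (by omega) _
        ⟨zero_mem _, by
          change hatMk 𝒜 l 1 ∈ (hat 𝒜 L h).gr (b - 1 + 1 + -b)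
          rw [show b - 1 + 1 + -b = 0 by ring]
          exact hatMk_one_mem L h l⟩
      induction x using hat_induction with
      | h0 => exact (congrArg (· ∈ F) (map_zero inX)).mpr (zero_mem F)
      | hmk l a =>
        rw [hatMk_eq_smul, map_smul]
        exact F.smul_mem _ (hgen l)
      | hadd x y hx hy =>
        rw [map_add]
        exact add_mem hx hy
  rintro ⟨n, x⟩ ⟨hn, hx⟩
  have := add_mem (hNF n hn) (hX x hx)
  have e : inN n + inX x = ((n, x) : N.carrier × HatCarrier 𝒜 L) :=
    Prod.ext (add_zero n) (zero_add x)
  exact e ▸ this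

/-- The l whose image lies in N A⁺ form an A⁰-submodule K of the simple module L. If K = 0 the map
is a graded-split monomorphism and the cone is a retract of its cokernel; if K = L the cone itself
is filtered. -/
theorem isFilteredRetract_cone_hat (h : 𝒜.IsPosSemisimple) {L : Type u} [AddCommGroup L]
    [Module (𝒜.gr 0)ᵐᵒᵖ L] [hL : IsSimpleModule (𝒜.gr 0)ᵐᵒᵖ L] {N : DGMod 𝒜}
    (hN : N.IsHatFiltered) {b : ℤ} (g : shift (-b) (hat 𝒜 L h) ⟶ N) :
    (cone g).IsFilteredRetract := by
  let K : Submodule (𝒜.gr 0)ᵐᵒᵖ L :=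
    { carrier := {l | lin g (hatMk 𝒜 l 1) ∈ N.plus}
      zero_mem' := (congrArg (· ∈ N.plus) ((congrArg (lin g) (map_zero (hatUnit L))).trans
        (map_zero (lin g)))).mpr (zero_mem _)
      add_mem' := fun {x y} hx hy => (congrArg (· ∈ N.plus) ((congrArg (lin g)
        (map_add (hatUnit L) x y)).trans (map_add (lin g) _ _))).mpr (add_mem hx hy)
      smul_mem' := fun a x hx => (congrArg (· ∈ N.plus) ((congrArg (lin g)
        (hatUnit_smul L a.unop x)).trans (map_smul (lin g) _ _))).mpr (N.plus.smul_mem _ hx) }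
  rcases eq_bot_or_eq_top K with hK | hK
  · have := hN.projective
    obtain ⟨ρ, hρ, hρι⟩ := exists_split_hat h N g fun l hl => by
      have : l ∈ K := hl
      rwa [hK, Submodule.mem_bot] at this
    obtain ⟨Q, S, hS⟩ := exists_gradedSplit g ρ hρ hρι
    refine ⟨Q, hN.of_split S.q S.σ S.q_σ, ?_⟩
    rw [← hS]
    exact S.cone_retract
  · exact (isHatFiltered_cone h hN g fun l => by
      have : l ∈ K := hK ▸ trivial
      exact this).isFilteredRetract

theorem cone_retract_of_subsingleton {M N : DGMod 𝒜} [Subsingleton M.carrier] (f : M ⟶ N) :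
    HomotopyRetract (cone f) N := by
  refine ⟨ofLin (M := cone f) (LinearMap.fst Aᵐᵒᵖ N.carrier M.carrier) (fun hm => hm.1) ?_,
    ofLin (N := cone f) (LinearMap.inl Aᵐᵒᵖ N.carrier M.carrier)
      (fun hm => ⟨hm, zero_mem _⟩) ?_,
    Homotopic.of_eq (lin_injective (LinearMap.ext ?_))⟩
  · rintro ⟨n, m⟩
    change N.d n + lin f m = N.d n
    rw [Subsingleton.elim m 0, map_zero, add_zero]
  · intro n
    refine Prod.ext ?_ (Subsingleton.elim (α := M.carrier) _ _)
    change N.d n = N.d n + lin f 0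
    rw [map_zero, add_zero]
  · rintro ⟨n, m⟩
    exact Prod.ext rfl (Subsingleton.elim (α := M.carrier) _ _)

/-- Dévissage on the source: cone off the bottom piece first, then the quotient Q by the octahedron.
The target varies in the induction and must be allowed to be a mere homotopy retract, since the
first cone is only known to be one. -/
theorem IsHatFiltered.isFilteredRetract_cone (h : 𝒜.IsPosSemisimple) {M N : DGMod 𝒜}
    (hM : M.IsHatFiltered) (hN : N.IsFilteredRetract) (f : M ⟶ N) :
    (cone f).IsFilteredRetract := by
  induction hn : M.topLength using WellFoundedLT.induction generalizing M N with
  | ind n ih =>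
  subst hn
  have := hM.finite
  cases subsingleton_or_nontrivial M.carrier with
  | inl hs => exact hN.of_retract (cone_retract_of_subsingleton f)
  | inr hs =>
    obtain ⟨a, -, -, L, _, _, hL, ι, ρ, hρ, hρι, x, hx⟩ := hM.exists_bottom h
    obtain ⟨Q, S, rfl⟩ := exists_gradedSplit ι ρ hρ hρι
    obtain ⟨g, hg⟩ := S.exists_cone_retract f
    refine (ih Q.topLength (topLength_lt h (lin S.q) (fun y => ⟨S.σ y, S.q_σ y⟩) hx
      (by rw [S.q_ι]; exact zero_mem _)) (hM.of_split S.q S.σ S.q_σ) ?_ g rfl).of_retract hg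
    obtain ⟨N₀, hN₀, β, β', hβ⟩ := hN
    exact (isFilteredRetract_cone_hat h hN₀ ((S.ι ≫ f) ≫ β)).of_retract
      (cone_retract_target _ β β' hβ)

theorem IsFilteredRetract.cone (h : 𝒜.IsPosSemisimple) {M N : DGMod 𝒜}
    (hM : M.IsFilteredRetract) (hN : N.IsFilteredRetract) (f : M ⟶ N) :
    (cone f).IsFilteredRetract := by
  obtain ⟨M₀, hM₀, α, α', hα⟩ := hM
  exact (hM₀.isFilteredRetract_cone h hN (α' ≫ f)).of_retract (cone_retract_source f α α' hα)

end DGMod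

/-! ### Strongly π-regular rings -/

/-- A monoid is strongly π-regular if a positive power of each element has a group inverse. -/
def IsStronglyPiRegular (R : Type*) [Monoid R] : Prop :=
  ∀ f : R, ∃ n : ℕ, 0 < n ∧ ∃ g : R, f ^ n * g = g * f ^ n ∧ f ^ n * g * f ^ n = f ^ n

theorem IsStronglyPiRegular.of_surjective {R S : Type*} [Monoid R] [Monoid S]
    (hR : IsStronglyPiRegular R) (φ : R →* S) (hφ : Function.Surjective φ) :
    IsStronglyPiRegular S := by
  intro f
  obtain ⟨f, rfl⟩ := hφ f
  obtain ⟨n, hn, g, h₁, h₂⟩ := hR f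
  refine ⟨n, hn, φ g, ?_, ?_⟩
  · rw [← map_pow, ← map_mul, h₁, map_mul]
  · rw [← map_pow, ← map_mul, ← map_mul, h₂]

/-- Idempotents lift along surjections from strongly π-regular monoids. -/
theorem IsStronglyPiRegular.exists_lift_idempotent {R S : Type*} [Monoid R] [Monoid S]
    (hR : IsStronglyPiRegular R) (φ : R →* S) (hφ : Function.Surjective φ) {e : S}
    (he : IsIdempotentElem e) : ∃ p : R, IsIdempotentElem p ∧ φ p = e := by
  obtain ⟨f, rfl⟩ := hφ e
  obtain ⟨n, hn, g, h₁, h₂⟩ := hR f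
  refine ⟨f ^ n * g, ?_, ?_⟩
  · rw [IsIdempotentElem, ← mul_assoc, h₂]
  · have hpow : φ f ^ n = φ f := he.pow_eq hn.ne'
    have h₂' := congrArg φ h₂
    have h₁' := congrArg φ h₁
    simp only [map_mul, map_pow, hpow] at h₁' h₂' ⊢
    rw [mul_assoc, ← h₁', ← mul_assoc, he.eq] at h₂'
    exact h₂'

/-- The idempotent f^n g decides: if it is 0 then f^n = 0, if it is 1 then f^n is invertible. -/
theorem IsStronglyPiRegular.isUnit_or_isNilpotent {R : Type*} [Ring R]
    (hR : IsStronglyPiRegular R) (hid : ∀ e : R, IsIdempotentElem e → e = 0 ∨ e = 1) (f : R) :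
    IsUnit f ∨ IsNilpotent f := by
  obtain ⟨n, hn, g, h₁, h₂⟩ := hR f
  rcases hid (f ^ n * g) (by rw [IsIdempotentElem, ← mul_assoc, h₂]) with h | h
  · exact Or.inr ⟨n, by rw [← h₂, h, zero_mul]⟩
  · exact Or.inl ((isUnit_pow_iff hn.ne').1 ⟨⟨f ^ n, g, h, h₁ ▸ h⟩, rfl⟩)

/-! ### Local rings and the unit-or-nilpotent dichotomy -/

theorem isLocalRing_of_isUnit_or_isNilpotent {R : Type*} [Ring R] [Nontrivial R]
    (h : ∀ f : R, IsUnit f ∨ IsNilpotent f) : IsLocalRing R :=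
  IsLocalRing.of_isUnit_or_isUnit_one_sub_self fun f =>
    (h f).imp id fun hf => hf.isUnit_one_sub

theorem not_isNilpotent_of_mul_eq_one {R : Type*} [MonoidWithZero R] [Nontrivial R] {x y : R}
    (h : x * y = 1) : ¬ IsNilpotent x ∧ ¬ IsNilpotent y := by
  have key : ∀ n : ℕ, x ^ n * y ^ n = 1 := by
    intro n
    induction n with
    | zero => simp
    | succ n ih => rw [pow_succ, pow_succ', mul_assoc, ← mul_assoc x, h, one_mul, ih]
  constructor
  · rintro ⟨n, hn⟩
    have := key n
    rw [hn, zero_mul] at this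
    exact zero_ne_one this
  · rintro ⟨n, hn⟩
    have := key n
    rw [hn, mul_zero] at this
    exact zero_ne_one this

/-- A one-sided invertible element is not nilpotent, so a product with a nilpotent factor is never a
unit. If x + y had left inverse z with x, y nilpotent, then z y = 1 - z x would be both a unit and
nilpotent. -/
theorem exists_twoSidedIdeal_of_isUnit_or_isNilpotent {R : Type*} [Ring R] [Nontrivial R]
    (h : ∀ f : R, IsUnit f ∨ IsNilpotent f) :
    ∃ I : TwoSidedIdeal R, ∀ f : R, f ∈ I ↔ IsNilpotent f := by
  have hl : ∀ {x y : R}, IsNilpotent y → IsNilpotent (x * y) := by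
    intro x y hy
    refine (h (x * y)).resolve_left fun hu => ?_
    obtain ⟨z, hz⟩ := hu.exists_left_inv
    rw [← mul_assoc] at hz
    exact (not_isNilpotent_of_mul_eq_one hz).2 hy
  have hr : ∀ {x y : R}, IsNilpotent x → IsNilpotent (x * y) := by
    intro x y hy
    refine (h (x * y)).resolve_left fun hu => ?_
    obtain ⟨z, hz⟩ := hu.exists_right_inv
    rw [mul_assoc] at hz
    exact (not_isNilpotent_of_mul_eq_one hz).1 hy
  refine ⟨TwoSidedIdeal.mk' {f | IsNilpotent f} IsNilpotent.zero ?_ (fun hx => hx.neg) hl hr,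
    fun f => TwoSidedIdeal.mem_mk' _ _ _ _ _ _ _⟩
  intro x y hx hy
  refine (h (x + y)).resolve_left fun hu => ?_
  obtain ⟨z, hz⟩ := hu.exists_left_inv
  rw [mul_add] at hz
  have h1 : IsUnit (z * y) := by
    rw [← eq_sub_iff_add_eq'] at hz
    rw [hz]
    exact (hl hx).isUnit_one_sub
  obtain ⟨t, ht⟩ := h1.exists_left_inv
  exact (not_isNilpotent_of_mul_eq_one ht).2 (hl hy)

theorem isLocalRing_of_surjective {R S : Type*} [Ring R] [Ring S] [IsLocalRing R] [Nontrivial S]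
    (φ : R →+* S) (hφ : Function.Surjective φ) : IsLocalRing S :=
  IsLocalRing.of_isUnit_or_isUnit_one_sub_self fun s => by
    obtain ⟨r, rfl⟩ := hφ s
    rw [← map_one φ, ← map_sub]
    exact (IsLocalRing.isUnit_or_isUnit_of_add_one (add_sub_cancel r 1)).imp
      (fun h => h.map φ) (fun h => h.map φ)

theorem IsLocalRing.eq_zero_or_one_of_isIdempotentElem {R : Type*} [Ring R] [IsLocalRing R]
    {e : R} (he : IsIdempotentElem e) : e = 0 ∨ e = 1 := by
  rcases IsLocalRing.isUnit_or_isUnit_of_add_one (add_sub_cancel e 1) with h | h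
  · exact Or.inr ((IsIdempotentElem.iff_eq_one_of_isUnit h).1 he)
  · have := (IsIdempotentElem.iff_eq_one_of_isUnit h).1 he.one_sub
    exact Or.inl (by simpa using this)

/-- Group inverses commute with everything that commutes with the given element. -/
theorem commute_of_group_inverse {R : Type*} [Ring R] {g s T : R} (h₁ : g * s = s * g)
    (h₂ : g * s * g = g) (h₃ : s * g * s = s) (hT : T * g = g * T) : T * s = s * T := by
  -- With the idempotent e = g s, one shows e T e = T e and e T e = e T; so T commutes with e, and
  -- then with s.
  have hA : g * s * T * (g * s) = T * (g * s) := by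
    calc g * s * T * (g * s) = g * s * (T * g) * s := by noncomm_ring
      _ = g * s * g * T * s := by rw [hT]; noncomm_ring
      _ = T * (g * s) := by rw [h₂, ← hT, mul_assoc]
  have hB : g * s * T * (g * s) = g * s * T := by
    calc g * s * T * (g * s) = s * g * T * (s * g) := by rw [h₁]
      _ = s * (T * g) * (s * g) := by rw [hT]; noncomm_ring
      _ = s * T * (g * s * g) := by noncomm_ring
      _ = g * s * T := by rw [h₂, mul_assoc, hT, ← mul_assoc, ← h₁]
  have hAB : T * (g * s) = g * s * T := hA.symm.trans hB
  calc T * s = T * (g * s) * s := by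
        have : s = g * s * s := by rw [h₁, h₃]
        calc T * s = T * (g * s * s) := by rw [← this]
          _ = _ := by noncomm_ring
    _ = s * (g * T) * s := by rw [hAB, h₁]; noncomm_ring
    _ = s * (T * (g * s)) := by rw [← hT]; noncomm_ring
    _ = s * g * s * T := by rw [hAB]; noncomm_ring
    _ = s * T := by rw [h₃]

/-! ### Direct sums in preadditive categories -/

section Preadditive

variable {C D : Type*} [Category C] [Preadditive C] [Category D] [Preadditive D]

theorem isBinaryDirectSum_of_total {X Y Z : C} (i : Y ⟶ X) (r : X ⟶ Y) (i' : Z ⟶ X) (r' : X ⟶ Z)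
    (h₁ : i ≫ r = 𝟙 Y) (h₂ : i' ≫ r' = 𝟙 Z) (h₃ : i ≫ r' = 0) (h₄ : i' ≫ r = 0)
    (h₅ : r ≫ i + r' ≫ i' = 𝟙 X) : IsBinaryDirectSum X Y Z :=
  ⟨⟨X, r, r', i, i', h₁, h₃, h₄, h₂⟩, ⟨isBinaryBilimitOfTotal _ h₅⟩, ⟨Iso.refl _⟩⟩

theorem IsBinaryDirectSum.exists_total {X Y Z : C} (h : IsBinaryDirectSum X Y Z) :
    ∃ (i : Y ⟶ X) (r : X ⟶ Y) (i' : Z ⟶ X) (r' : X ⟶ Z), i ≫ r = 𝟙 Y ∧ i' ≫ r' = 𝟙 Z ∧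
      i ≫ r' = 0 ∧ i' ≫ r = 0 ∧ r ≫ i + r' ≫ i' = 𝟙 X := by
  obtain ⟨b, ⟨hb⟩, ⟨e⟩⟩ := h
  refine ⟨b.inl ≫ e.inv, e.hom ≫ b.fst, b.inr ≫ e.inv, e.hom ≫ b.snd, by simp, by simp, by simp,
    by simp, ?_⟩
  have : e.hom ≫ (b.fst ≫ b.inl + b.snd ≫ b.inr) ≫ e.inv = 𝟙 X := by
    rw [IsBilimit.binary_total hb, Category.id_comp, e.hom_inv_id]
  rw [← this]
  simp [Preadditive.comp_add, Preadditive.add_comp]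

theorem isBinaryDirectSum_of_split {X Y Z : C} (e : X ⟶ X) (i : Y ⟶ X) (r : X ⟶ Y) (i' : Z ⟶ X)
    (r' : X ⟶ Z) (h₁ : i ≫ r = 𝟙 Y) (h₂ : r ≫ i = e) (h₃ : i' ≫ r' = 𝟙 Z)
    (h₄ : r' ≫ i' = 𝟙 X - e) : IsBinaryDirectSum X Y Z := by
  refine isBinaryDirectSum_of_total i r i' r' h₁ h₃ ?_ ?_ (by rw [h₂, h₄, add_sub_cancel])
  · have : i ≫ (r' ≫ i') ≫ r' = 0 := by
      rw [h₄, ← h₂, Preadditive.sub_comp, Preadditive.comp_sub, Category.id_comp, Category.assoc,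
        ← Category.assoc i r, h₁, Category.id_comp, sub_self]
    rwa [Category.assoc, h₃, Category.comp_id] at this
  · have : i' ≫ (r ≫ i) ≫ r = 0 := by
      rw [h₂, ← sub_sub_cancel (𝟙 X) e, ← h₄, Preadditive.sub_comp, Preadditive.comp_sub,
        Category.id_comp, Category.assoc, ← Category.assoc i' r', h₃, Category.id_comp, sub_self]
    rwa [Category.assoc, h₁, Category.comp_id] at this

theorem IsBinaryDirectSum.map {X Y Z : C} (h : IsBinaryDirectSum X Y Z) (F : C ⥤ D) [F.Additive] :
    IsBinaryDirectSum (F.obj X) (F.obj Y) (F.obj Z) := by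
  obtain ⟨i, r, i', r', h₁, h₂, h₃, h₄, h₅⟩ := h.exists_total
  refine isBinaryDirectSum_of_total (F.map i) (F.map r) (F.map i') (F.map r') ?_ ?_ ?_ ?_ ?_
  · rw [← F.map_comp, h₁, F.map_id]
  · rw [← F.map_comp, h₂, F.map_id]
  · rw [← F.map_comp, h₃, F.map_zero]
  · rw [← F.map_comp, h₄, F.map_zero]
  · rw [← F.map_comp, ← F.map_comp, ← F.map_add, h₅, F.map_id]

theorem IsBinaryDirectSum.of_map {X Y Z : C} (F : C ⥤ D) [F.Additive] [F.Full] [F.Faithful]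
    (h : IsBinaryDirectSum (F.obj X) (F.obj Y) (F.obj Z)) : IsBinaryDirectSum X Y Z := by
  obtain ⟨i, r, i', r', h₁, h₂, h₃, h₄, h₅⟩ := h.exists_total
  refine isBinaryDirectSum_of_total (F.preimage i) (F.preimage r) (F.preimage i') (F.preimage r')
    ?_ ?_ ?_ ?_ ?_ <;> apply F.map_injective <;> simpa

theorem isZero_map {X : C} (hX : IsZero X) (F : C ⥤ D) [F.Additive] : IsZero (F.obj X) := by
  rw [IsZero.iff_id_eq_zero] at hX ⊢
  rw [← F.map_id, hX, F.map_zero]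

theorem isZero_of_map {X : C} (F : C ⥤ D) [F.Additive] [F.Faithful] (hX : IsZero (F.obj X)) :
    IsZero X := by
  rw [IsZero.iff_id_eq_zero] at hX ⊢
  exact F.map_injective (by rw [F.map_id, hX, F.map_zero])

theorem nontrivial_end_of_not_isZero {X : C} (hX : ¬ IsZero X) : Nontrivial (End X) :=
  ⟨⟨1, 0, fun h => hX ((IsZero.iff_id_eq_zero X).2 h)⟩⟩

theorem not_isZero_of_nontrivial_end {X : C} [Nontrivial (End X)] : ¬ IsZero X :=
  fun h => one_ne_zero (α := End X) ((IsZero.iff_id_eq_zero X).1 h)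

/-- The projection onto a summand is an idempotent of a local ring, hence 0 or 1. -/
theorem isIndecomposable_of_isLocalRing {X : C} (hX : IsLocalRing (End X)) :
    IsIndecomposable X := by
  refine ⟨not_isZero_of_nontrivial_end, fun Y Z h => ?_⟩
  obtain ⟨i, r, i', r', h₁, h₂, h₃, h₄, h₅⟩ := h.exists_total
  have he : IsIdempotentElem (M := End X) (r ≫ i) := by
    change (r ≫ i) ≫ r ≫ i = r ≫ i
    rw [Category.assoc, ← Category.assoc i, h₁, Category.id_comp]
  rcases IsLocalRing.eq_zero_or_one_of_isIdempotentElem he with h | h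
  · left
    rw [IsZero.iff_id_eq_zero]
    have : i ≫ (r ≫ i) ≫ r = 𝟙 Y := by
      rw [Category.assoc, h₁, Category.comp_id, h₁]
    rw [← this, show r ≫ i = 0 from h, zero_comp, comp_zero]
  · right
    rw [IsZero.iff_id_eq_zero, ← h₂, ← Category.id_comp r', ← show r ≫ i = 𝟙 X from h,
      ← Category.assoc, ← Category.assoc, h₄, zero_comp, zero_comp]

theorem hasFittingEnd_of_isStronglyPiRegular {X : C} (hX : ¬ IsZero X)
    (h : IsStronglyPiRegular (End X)) (hid : ∀ e : End X, IsIdempotentElem e → e = 0 ∨ e = 1) :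
    HasFittingEnd X := by
  have := nontrivial_end_of_not_isZero hX
  have key := h.isUnit_or_isNilpotent hid
  exact ⟨fun f => (key f).imp (isUnit_iff_isIso f).1 id,
    exists_twoSidedIdeal_of_isUnit_or_isNilpotent key, isLocalRing_of_isUnit_or_isNilpotent key⟩

/-- Fullness makes the target a quotient of a local ring; it has to be nonzero. -/
theorem isLocalRing_end_map {X : C} (F : C ⥤ D) [F.Additive] [F.Full]
    (hX : IsLocalRing (End X)) (h : ¬ IsZero (F.obj X)) : IsLocalRing (End (F.obj X)) :=
  have := nontrivial_end_of_not_isZero h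
  isLocalRing_of_surjective
    { F.mapEnd X with
      map_zero' := F.map_zero X X
      map_add' := fun _ _ => F.map_add } F.map_surjective

theorem isLocalRing_end_of_map {X : C} (F : C ⥤ D) [F.Additive] [F.Full] [F.Faithful]
    (hX : IsLocalRing (End (F.obj X))) : IsLocalRing (End X) := by
  have : Nontrivial (End X) := nontrivial_end_of_not_isZero fun h =>
    not_isZero_of_nontrivial_end (isZero_map h F)
  refine isLocalRing_of_surjective (R := End (F.obj X))
    { toFun := fun f => F.preimage f
      map_one' := F.preimage_id
      map_mul' := fun f g => F.preimage_comp g f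
      map_zero' := F.map_injective (by simp)
      map_add' := fun f g => F.map_injective (by rw [F.map_add]; simp) }
    fun f => ⟨F.map f, F.preimage_map f⟩

/-- `X` is the direct sum of the finite family `Y`: inclusions and projections are given. -/
def IsDirectSumOf {ι : Type*} [Fintype ι] (X : C) (Y : ι → C) : Prop :=
  ∃ (i : ∀ j, Y j ⟶ X) (r : ∀ j, X ⟶ Y j), (∀ j, i j ≫ r j = 𝟙 (Y j)) ∧
    (∀ j l, j ≠ l → i j ≫ r l = 0) ∧ ∑ j, r j ≫ i j = 𝟙 X

namespace IsDirectSumOf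

variable {ι κ : Type*} [Fintype ι] [Fintype κ]

theorem isFiniteDirectSum {n : ℕ} {X : C} {Y : Fin n → C} (h : IsDirectSumOf X Y) :
    IsFiniteDirectSum X Y := by
  obtain ⟨i, r, h₁, h₂, h₃⟩ := h
  refine ⟨⟨X, r, i, fun j l => ?_⟩, ⟨isBilimitOfTotal _ h₃⟩, ⟨Iso.refl _⟩⟩
  split_ifs with hjl
  · subst hjl
    exact h₁ j
  · exact h₂ j l hjl

theorem reindex {X : C} {Y : ι → C} (h : IsDirectSumOf X Y) (e : κ ≃ ι) :
    IsDirectSumOf X (fun l => Y (e l)) := by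
  obtain ⟨i, r, h₁, h₂, h₃⟩ := h
  exact ⟨fun l => i (e l), fun l => r (e l), fun l => h₁ (e l),
    fun j l hjl => h₂ _ _ (e.injective.ne hjl), (e.sum_comp fun j => r j ≫ i j).trans h₃⟩

theorem map {X : C} {Y : ι → C} (h : IsDirectSumOf X Y) (F : C ⥤ D) [F.Additive] :
    IsDirectSumOf (F.obj X) (fun j => F.obj (Y j)) := by
  obtain ⟨i, r, h₁, h₂, h₃⟩ := h
  refine ⟨fun j => F.map (i j), fun j => F.map (r j), fun j => ?_, fun j l hjl => ?_, ?_⟩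
  · rw [← F.map_comp, h₁, F.map_id]
  · rw [← F.map_comp, h₂ j l hjl, F.map_zero]
  · simp only [← F.map_comp, ← F.map_sum, h₃, F.map_id]

theorem of_map {X : C} {Y : ι → C} (F : C ⥤ D) [F.Additive] [F.Full] [F.Faithful]
    (h : IsDirectSumOf (F.obj X) (fun j => F.obj (Y j))) : IsDirectSumOf X Y := by
  obtain ⟨i, r, h₁, h₂, h₃⟩ := h
  refine ⟨fun j => F.preimage (i j), fun j => F.preimage (r j), fun j => ?_, fun j l hjl => ?_, ?_⟩
  · exact F.map_injective (by simpa using h₁ j)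
  · exact F.map_injective (by simpa using h₂ j l hjl)
  · exact F.map_injective (by simpa [F.map_sum] using h₃)

theorem of_iso {X X' : C} {Y : ι → C} (h : IsDirectSumOf X Y) (e : X ≅ X') :
    IsDirectSumOf X' Y := by
  obtain ⟨i, r, h₁, h₂, h₃⟩ := h
  refine ⟨fun j => i j ≫ e.hom, fun j => e.inv ≫ r j, fun j => ?_, fun j l hjl => ?_, ?_⟩
  · simpa using h₁ j
  · simpa using h₂ j l hjl
  · have : ∑ j, (e.inv ≫ r j) ≫ i j ≫ e.hom = e.inv ≫ (∑ j, r j ≫ i j) ≫ e.hom := by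
      simp [Preadditive.comp_sum, Preadditive.sum_comp]
    rw [this, h₃, Category.id_comp, e.inv_hom_id]

theorem of_isZero {X : C} (hX : IsZero X) (Y : Fin 0 → C) : IsDirectSumOf X Y :=
  ⟨fun j => j.elim0, fun j => j.elim0, fun j => j.elim0, fun j => j.elim0, hX.eq_of_src _ _⟩

theorem single (X : C) : IsDirectSumOf X (fun _ : Fin 1 => X) :=
  ⟨fun _ => 𝟙 X, fun _ => 𝟙 X, fun _ => Category.comp_id _,
    fun j l hjl => (hjl (Subsingleton.elim j l)).elim, by simp⟩

theorem sum {X X₁ X₂ : C} {Y : ι → C} {Z : κ → C} (h : IsBinaryDirectSum X X₁ X₂)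
    (hY : IsDirectSumOf X₁ Y) (hZ : IsDirectSumOf X₂ Z) : IsDirectSumOf X (Sum.elim Y Z) := by
  obtain ⟨i₁, r₁, i₂, r₂, h₁, h₂, h₃, h₄, h₅⟩ := h.exists_total
  obtain ⟨i, r, a₁, a₂, a₃⟩ := hY
  obtain ⟨i', r', b₁, b₂, b₃⟩ := hZ
  have h₁' {W : C} (f : X₁ ⟶ W) : i₁ ≫ r₁ ≫ f = f := by
    rw [← Category.assoc, h₁, Category.id_comp]
  have h₂' {W : C} (f : X₂ ⟶ W) : i₂ ≫ r₂ ≫ f = f := by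
    rw [← Category.assoc, h₂, Category.id_comp]
  have h₃' {W : C} (f : X₂ ⟶ W) : i₁ ≫ r₂ ≫ f = 0 := by
    rw [← Category.assoc, h₃, zero_comp]
  have h₄' {W : C} (f : X₁ ⟶ W) : i₂ ≫ r₁ ≫ f = 0 := by
    rw [← Category.assoc, h₄, zero_comp]
  refine ⟨fun j => match j with
      | Sum.inl j => i j ≫ i₁
      | Sum.inr j => i' j ≫ i₂,
    fun j => match j with
      | Sum.inl j => r₁ ≫ r j
      | Sum.inr j => r₂ ≫ r' j, ?_, ?_, ?_⟩
  · rintro (j | j)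
    · change (i j ≫ i₁) ≫ r₁ ≫ r j = 𝟙 (Y j)
      rw [Category.assoc, h₁', a₁]
    · change (i' j ≫ i₂) ≫ r₂ ≫ r' j = 𝟙 (Z j)
      rw [Category.assoc, h₂', b₁]
  · rintro (j | j) (l | l) hjl
    · change (i j ≫ i₁) ≫ r₁ ≫ r l = 0
      rw [Category.assoc, h₁', a₂ j l fun e => hjl (e ▸ rfl)]
    · change (i j ≫ i₁) ≫ r₂ ≫ r' l = 0
      rw [Category.assoc, h₃', comp_zero]
    · change (i' j ≫ i₂) ≫ r₁ ≫ r l = 0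
      rw [Category.assoc, h₄', comp_zero]
    · change (i' j ≫ i₂) ≫ r₂ ≫ r' l = 0
      rw [Category.assoc, h₂', b₂ j l fun e => hjl (e ▸ rfl)]
  · rw [Fintype.sum_sum_type]
    change ∑ j, (r₁ ≫ r j) ≫ i j ≫ i₁ + ∑ j, (r₂ ≫ r' j) ≫ i' j ≫ i₂ = 𝟙 X
    have e₁ : ∑ j, (r₁ ≫ r j) ≫ i j ≫ i₁ = r₁ ≫ (∑ j, r j ≫ i j) ≫ i₁ := by
      simp only [Preadditive.comp_sum, Preadditive.sum_comp, Category.assoc]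
    have e₂ : ∑ j, (r₂ ≫ r' j) ≫ i' j ≫ i₂ = r₂ ≫ (∑ j, r' j ≫ i' j) ≫ i₂ := by
      simp only [Preadditive.comp_sum, Preadditive.sum_comp, Category.assoc]
    rw [e₁, e₂, a₃, b₃, Category.id_comp, Category.id_comp, h₅]

end IsDirectSumOf

theorem hasFiniteBiproducts_of_isBinaryDirectSum (h₀ : ∃ Z : C, IsZero Z)
    (h : ∀ Y Z : C, ∃ X, IsBinaryDirectSum X Y Z) : HasFiniteBiproducts C := by
  have : HasZeroObject C := ⟨h₀⟩
  have : HasBinaryBiproducts C := ⟨fun Y Z => by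
    obtain ⟨X, b, ⟨hb⟩, -⟩ := h Y Z
    exact ⟨⟨⟨b, hb⟩⟩⟩⟩
  have : HasFiniteProducts C := hasFiniteProducts_of_has_binary_and_terminal
  exact HasFiniteBiproducts.of_hasFiniteProducts

end Preadditive

theorem IsBinaryDirectSum.symm {C : Type*} [Category C] [Preadditive C] {X Y Z : C}
    (h : IsBinaryDirectSum X Y Z) : IsBinaryDirectSum X Z Y := by
  obtain ⟨i, r, i', r', h₁, h₂, h₃, h₄, h₅⟩ := h.exists_total
  exact isBinaryDirectSum_of_total i' r' i r h₂ h₁ h₄ h₃ (by rw [add_comm, h₅])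

/-- An object whose idempotents split has only trivial idempotents if it is indecomposable. -/
theorem IsIndecomposable.eq_zero_or_one {C : Type*} [Category C] [Preadditive C] {X : C}
    (hX : IsIndecomposable X) (hs : ∀ e : X ⟶ X, e ≫ e = e →
      ∃ (Y : C) (i : Y ⟶ X) (r : X ⟶ Y), i ≫ r = 𝟙 Y ∧ r ≫ i = e)
    (e : End X) (he : IsIdempotentElem e) : e = 0 ∨ e = 1 := by
  obtain ⟨Y, i, r, h₁, h₂⟩ := hs e he
  obtain ⟨Z, i', r', h₃, h₄⟩ := hs (1 - e : End X) he.one_sub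
  rcases hX.2 Y Z (isBinaryDirectSum_of_split e i r i' r' h₁ h₂ h₃ h₄) with h | h
  · left
    rw [← h₂, h.eq_of_src i 0, comp_zero]
  · right
    have : (1 - e : End X) = 0 := by rw [← h₄, h.eq_of_src i' 0, comp_zero]
    exact (sub_eq_zero.1 this).symm

namespace DGMod

variable {k : Type w} {A : Type u} [CommRing k] [Ring A] [Algebra k A] {𝒜 : DGAlgebra k A}

/-! ### Endomorphisms and direct sum decompositions in `dgMod` -/

theorem isZero_of_subsingleton (M : DGMod 𝒜) [Subsingleton M.carrier] : IsZero M := by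
  rw [IsZero.iff_id_eq_zero]
  exact lin_injective (LinearMap.ext fun x => Subsingleton.elim (α := M.carrier) _ _)

theorem nontrivial_of_not_isZero {M : DGMod 𝒜} (hM : ¬ IsZero M) : Nontrivial M.carrier :=
  not_subsingleton_iff_nontrivial.1 fun _ => hM M.isZero_of_subsingleton

theorem lin_pow {M : DGMod 𝒜} (f : End M) (n : ℕ) :
    lin (f ^ n : End M) = (lin f ^ n : Module.End Aᵐᵒᵖ M.carrier) := by
  induction n with
  | zero => rfl
  | succ n ih =>
    rw [pow_succ, pow_succ, ← ih]
    rfl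

/-- By the Fitting lemma M is the direct sum of kernel and range of some f^n, which gives a group
inverse among A-linear maps. A group inverse commutes with whatever commutes with f^n, in particular
with d and the projections to homogeneous components, so it is a morphism of dg modules. -/
theorem IsHatFiltered.isStronglyPiRegular (h : 𝒜.IsPosSemisimple) {M : DGMod 𝒜}
    (hM : M.IsHatFiltered) : IsStronglyPiRegular (End M) := by
  intro f
  have := hM.finite
  have := hM.projective
  obtain ⟨n, hn, hf⟩ := exists_fitting h M f
  let g : Module.End Aᵐᵒᵖ M.carrier := lin f ^ n
  have hg : lin (f ^ n : End M) = g := lin_pow f n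
  have hgg : ∀ x, g (g x) = (lin f ^ (n + n)) x := fun x => by
    rw [pow_add, Module.End.mul_apply]
  obtain ⟨s, hs₁, hs₂⟩ := exists_fitting_inverse g
    ⟨Submodule.disjoint_def.2 (by
      rintro _ hx ⟨y, rfl⟩
      rw [LinearMap.mem_ker, hgg] at hx
      exact (hf y _).1 hx),
    codisjoint_iff.2 (eq_top_iff.2 fun x _ => by
      obtain ⟨y, hy⟩ := (hf x (n + n)).2
      rw [← hgg] at hy
      rw [← sub_add_cancel x (g y)]
      refine Submodule.add_mem_sup ?_ ⟨y, rfl⟩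
      rw [LinearMap.mem_ker, map_sub, sub_eq_zero]
      exact hy)⟩
  have hgs : ∀ x, g (s x) = s (g x) := fun x => by
    rw [← hs₂ (s x), hs₁]
  have hgs' : ∀ x, g (s (g x)) = g x := fun x => by rw [hgs, hs₂]
  -- Passing from s to s g s secures t g t = t, which the commutation argument needs.
  let t : Module.End Aᵐᵒᵖ M.carrier := s * g * s
  -- The argument takes place in the ring of additive endomorphisms, because d is not A-linear.
  have ht : ∀ T : M.carrier →+ M.carrier, (∀ x, T (g x) = g (T x)) → ∀ x, T (t x) = t (T x) := by
    intro T hT x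
    have := commute_of_group_inverse (R := AddMonoid.End M.carrier) (g := g.toAddMonoidHom)
      (s := t.toAddMonoidHom) (T := T) ?_ ?_ ?_ ?_
    · exact DFunLike.congr_fun this x
    · ext x
      change g (s (g (s x))) = s (g (s (g x)))
      rw [hgs', hgs', hgs]
    · ext x
      change g (s (g (s (g x)))) = g x
      rw [hgs', hgs']
    · ext x
      change s (g (s (g (s (g (s x)))))) = s (g (s x))
      rw [hgs', hgs']
    · ext x
      exact hT x
  let t' : M ⟶ M := ofLin t
    (fun {i m} hm => by
      have := ht (M.proj i) (fun x => by rw [← hg]; exact proj_lin (f ^ n : End M) i x) m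
      rw [M.proj_of_mem hm] at this
      rw [← this]
      exact M.proj_mem i _)
    (fun m => (ht M.d (fun x => by rw [← hg]; exact (lin_comm (f ^ n : End M) x).symm) m).symm)
  refine ⟨n, hn, t', lin_injective (LinearMap.ext fun x => ?_),
    lin_injective (LinearMap.ext fun x => ?_)⟩
  · change lin (f ^ n : End M) (s (g (s x))) = s (g (s (lin (f ^ n : End M) x)))
    rw [hg, hgs', hgs', hgs]
  · change lin (f ^ n : End M) (s (g (s (lin (f ^ n : End M) x)))) = lin (f ^ n : End M) x
    rw [hg, hgs', hgs']

theorem exists_split_idempotent {M : DGMod 𝒜} (e : M ⟶ M) (he : e ≫ e = e) :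
    ∃ (E : DGMod 𝒜) (i : E ⟶ M) (r : M ⟶ E), i ≫ r = 𝟙 E ∧ r ≫ i = e := by
  have he' : ∀ x, lin e (lin e x) = lin e x := fun x => LinearMap.congr_fun (congrArg lin he) x
  refine ⟨(range e).toDGMod, (range e).incl, ofLin (N := (range e).toDGMod)
    (LinearMap.codRestrict (range e).toSubmodule (lin e) fun x => ⟨x, rfl⟩)
    (fun hm => lin_mem e hm) (fun m => Subtype.ext (lin_comm e m)), ?_, rfl⟩
  refine lin_injective (LinearMap.ext ?_)
  rintro ⟨_, x, rfl⟩
  exact Subtype.ext (he' x)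

theorem _root_.IsIndecomposable.hasFittingEnd_dgMod (h : 𝒜.IsPosSemisimple) {M : DGMod 𝒜}
    (hM : M.IsHatFiltered) (hM' : IsIndecomposable M) : HasFittingEnd M :=
  hasFittingEnd_of_isStronglyPiRegular hM'.1 (hM.isStronglyPiRegular h)
    (hM'.eq_zero_or_one exists_split_idempotent)

theorem IsHatFiltered.of_isBinaryDirectSum {M E E' : DGMod 𝒜} (hM : M.IsHatFiltered)
    (hs : IsBinaryDirectSum M E E') : E.IsHatFiltered := by
  obtain ⟨i, r, i', r', h₁, h₂, h₃, h₄, h₅⟩ := hs.exists_total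
  exact hM.of_retract i r h₁

theorem IsHatFiltered.exists_notMem_plus (h : 𝒜.IsPosSemisimple) {M : DGMod 𝒜}
    (hM : M.IsHatFiltered) (h₀ : ¬ IsZero M) : ∃ x, x ∉ M.plus := by
  have := nontrivial_of_not_isZero h₀
  have := hM.finite
  obtain ⟨a, -, ⟨x, hx, hx₀⟩, hx'⟩ := exists_lowest h M
  exact ⟨x, fun hp => hx₀ (hx' x hx hp)⟩

/-- By Nakayama E' has an element outside E' A⁺; in M it stays outside M A⁺, and it dies in E. -/
theorem topLength_lt_of_isBinaryDirectSum (h : 𝒜.IsPosSemisimple) {M E E' : DGMod 𝒜}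
    (hM : M.IsHatFiltered) (hs : IsBinaryDirectSum M E E') (hE' : ¬ IsZero E') :
    E.topLength < M.topLength := by
  have := hM.finite
  obtain ⟨x, hx⟩ := (hM.of_isBinaryDirectSum hs.symm).exists_notMem_plus h hE'
  obtain ⟨i, r, i', r', h₁, h₂, h₃, h₄, h₅⟩ := hs.exists_total
  refine topLength_lt h (lin r) (fun y => ⟨lin i y, LinearMap.congr_fun (congrArg lin h₁) y⟩)
    (x := lin i' x) (fun hp => hx ?_) ?_
  · have := plus_le_comap (lin r') hp
    rwa [Submodule.mem_comap, ← LinearMap.comp_apply, ← lin_comp, h₂] at this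
  · rw [← LinearMap.comp_apply, ← lin_comp, h₄]
    exact zero_mem _

/-- Summands are again filtered and have shorter M / M A⁺, so splitting stops at indecomposables,
whose endomorphism rings are local. -/
theorem IsHatFiltered.exists_decomposition (h : 𝒜.IsPosSemisimple) {M : DGMod 𝒜}
    (hM : M.IsHatFiltered) : ∃ (n : ℕ) (Y : Fin n → DGMod 𝒜),
      (∀ j, (Y j).IsHatFiltered ∧ IsLocalRing (End (Y j))) ∧ IsDirectSumOf M Y := by
  induction hn : M.topLength using WellFoundedLT.induction generalizing M with
  | ind n ih =>
  subst hn
  by_cases h₀ : IsZero M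
  · exact ⟨0, Fin.elim0, fun j => j.elim0, IsDirectSumOf.of_isZero h₀ _⟩
  by_cases h₁ : IsIndecomposable M
  · exact ⟨1, fun _ => M, fun _ => ⟨hM, (h₁.hasFittingEnd_dgMod h hM).2.2⟩,
      IsDirectSumOf.single M⟩
  · rw [IsIndecomposable, not_and] at h₁
    replace h₁ := h₁ h₀
    push Not at h₁
    obtain ⟨E, E', hs, hE, hE'⟩ := h₁
    obtain ⟨n, Y, hY, hY'⟩ := ih _ (topLength_lt_of_isBinaryDirectSum h hM hs hE')
      (hM.of_isBinaryDirectSum hs) rfl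
    obtain ⟨m, Z, hZ, hZ'⟩ := ih _ (topLength_lt_of_isBinaryDirectSum h hM hs.symm hE)
      (hM.of_isBinaryDirectSum hs.symm) rfl
    have hYZ : ∀ j, (Sum.elim Y Z j).IsHatFiltered ∧ IsLocalRing (End (Sum.elim Y Z j)) := by
      rintro (j | j)
      · exact hY j
      · exact hZ j
    exact ⟨n + m, fun j => Sum.elim Y Z (finSumFinEquiv.symm j), fun j => hYZ _,
      (IsDirectSumOf.sum hs hY' hZ').reindex finSumFinEquiv.symm⟩

/-- The direct sum of two dg modules. -/
def directSum (M N : DGMod 𝒜) : DGMod 𝒜 := cone (0 : shift (-1) N ⟶ M)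

theorem isBinaryDirectSum_directSum (M N : DGMod 𝒜) : IsBinaryDirectSum (directSum M N) M N := by
  have hd : ∀ n : N.carrier, -(shift (-1) N).d n = N.d n := fun n => by
    change -((-1 : ℤ).negOnePow • N.d n) = N.d n
    rw [Int.negOnePow_odd (-1) (by decide), Units.neg_smul, one_smul, neg_neg]
  refine isBinaryDirectSum_of_total
    (ofLin (N := directSum M N) (LinearMap.inl Aᵐᵒᵖ M.carrier N.carrier)
      (fun hm => ⟨hm, zero_mem _⟩) ?_)
    (ofLin (M := directSum M N) (LinearMap.fst Aᵐᵒᵖ M.carrier N.carrier) (fun hm => hm.1) ?_)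
    (ofLin (N := directSum M N) (LinearMap.inr Aᵐᵒᵖ M.carrier N.carrier)
      (fun {i n} hn => ⟨zero_mem _, ?_⟩) ?_)
    (ofLin (M := directSum M N) (LinearMap.snd Aᵐᵒᵖ M.carrier N.carrier)
      (fun {i x} hx => ?_) ?_) ?_ ?_ ?_ ?_ ?_
  · intro m
    refine Prod.ext ?_ ?_
    · change M.d m = M.d m + 0
      rw [add_zero]
    · change (0 : N.carrier) = -(shift (-1) N).d 0
      rw [map_zero, neg_zero]
      rfl
  · rintro ⟨m, n⟩
    change M.d m + 0 = M.d m
    rw [add_zero]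
  · change n ∈ N.gr (i + 1 + -1)
    rwa [add_neg_cancel_right]
  · intro n
    refine Prod.ext ?_ (hd n).symm
    change (0 : M.carrier) = M.d 0 + 0
    rw [map_zero, add_zero]
  · have : x.2 ∈ N.gr (i + 1 + -1) := hx.2
    rwa [add_neg_cancel_right] at this
  · rintro ⟨m, n⟩
    exact hd n
  · rfl
  · rfl
  · rfl
  · rfl
  · refine lin_injective (LinearMap.ext ?_)
    rintro ⟨m, n⟩
    refine Prod.ext ?_ ?_
    · exact add_zero m
    · exact zero_add n

theorem IsHatFiltered.of_isBinaryDirectSum_of_summands {S M N : DGMod 𝒜} (hM : M.IsHatFiltered)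
    (hN : N.IsHatFiltered) (hs : IsBinaryDirectSum S M N) : S.IsHatFiltered := by
  obtain ⟨i, r, i', r', h₁, h₂, h₃, h₄, h₅⟩ := hs.exists_total
  have h₅' : ∀ x, lin i (lin r x) + lin i' (lin r' x) = x :=
    fun x => LinearMap.congr_fun (congrArg lin h₅) x
  have h₁' : ∀ x, lin r (lin i x) = x := fun x => LinearMap.congr_fun (congrArg lin h₁) x
  have h₂' : ∀ x, lin r' (lin i' x) = x := fun x => LinearMap.congr_fun (congrArg lin h₂) x
  have h₃' : ∀ x, lin r' (lin i x) = 0 := fun x => LinearMap.congr_fun (congrArg lin h₃) x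
  have h₄' : ∀ x, lin r (lin i' x) = 0 := fun x => LinearMap.congr_fun (congrArg lin h₄) x
  have := hM.finite
  have := hN.finite
  have := hM.projective
  have := hN.projective
  let φ : (M.carrier × N.carrier) ≃ₗ[Aᵐᵒᵖ] S.carrier :=
    LinearEquiv.ofLinearMap (LinearMap.coprod (lin i) (lin i')) (LinearMap.prod (lin r) (lin r'))
      (LinearMap.ext h₅') (LinearMap.ext fun x => Prod.ext
        (by
          change lin r (lin i x.1 + lin i' x.2) = x.1
          rw [map_add, h₁', h₄', add_zero])
        (by
          change lin r' (lin i x.1 + lin i' x.2) = x.2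
          rw [map_add, h₂', h₃', zero_add]))
  refine ⟨Module.Finite.equiv φ, Module.Projective.of_equiv φ, fun j F hF hF' x hx => ?_⟩
  rw [← h₅' x]
  refine add_mem ?_ ?_
  · refine hM.induction j (F.comap (lin i)) (fun l hl y hy => hF l hl _ (lin_mem i hy))
      (fun y hy hdy => hF' _ (lin_mem i hy) ?_) _ (lin_mem r hx)
    rw [← lin_comm]
    exact hdy
  · refine hN.induction j (F.comap (lin i')) (fun l hl y hy => hF l hl _ (lin_mem i' hy))
      (fun y hy hdy => hF' _ (lin_mem i' hy) ?_) _ (lin_mem r' hx)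
    rw [← lin_comm]
    exact hdy

theorem subsingleton_zero (M : DGMod 𝒜) : Subsingleton (DGSubmodule.zero M).toDGMod.carrier :=
  inferInstanceAs (Subsingleton (⊥ : Submodule Aᵐᵒᵖ M.carrier))

theorem isHatFiltered_of_subsingleton (M : DGMod 𝒜) [Subsingleton M.carrier] :
    M.IsHatFiltered :=
  ⟨inferInstance, inferInstance, fun _ F _ _ x _ => Subsingleton.elim 0 x ▸ zero_mem F⟩

/-! ### The homotopy category -/

instance : (DGHot.functor 𝒜).Additive where
  map_add := rfl

theorem homotopyRetract_iff {N M : DGMod 𝒜} : HomotopyRetract N M ↔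
    ∃ (i : (DGHot.functor 𝒜).obj N ⟶ (DGHot.functor 𝒜).obj M)
      (r : (DGHot.functor 𝒜).obj M ⟶ (DGHot.functor 𝒜).obj N), i ≫ r = 𝟙 _ := by
  constructor
  · rintro ⟨i, r, h⟩
    refine ⟨(DGHot.functor 𝒜).map i, (DGHot.functor 𝒜).map r, ?_⟩
    rw [← Functor.map_comp, ← CategoryTheory.Functor.map_id]
    exact (Quotient.functor_map_eq_iff _ _ _).2 h
  · rintro ⟨i, r, h⟩
    obtain ⟨i, rfl⟩ := (DGHot.functor 𝒜).map_surjective i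
    obtain ⟨r, rfl⟩ := (DGHot.functor 𝒜).map_surjective r
    rw [← Functor.map_comp, ← CategoryTheory.Functor.map_id] at h
    exact ⟨i, r, (Quotient.functor_map_eq_iff _ _ _).1 h⟩

/-- A contractible filtered dg module is zero. -/
theorem IsHatFiltered.isZero_of_map (h : 𝒜.IsPosSemisimple) {M : DGMod 𝒜} (hM : M.IsHatFiltered)
    (h₀ : IsZero ((DGHot.functor 𝒜).obj M)) : IsZero M := by
  by_contra hM₀
  obtain ⟨x, hx⟩ := hM.exists_notMem_plus h hM₀
  rw [IsZero.iff_id_eq_zero, ← CategoryTheory.Functor.map_id, ← (DGHot.functor 𝒜).map_zero] at h₀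
  -- A contraction writes x as d s x + s d x. Both terms lie in M A⁺ because d M ⊆ M A⁺,
  -- contradicting the choice of x.
  obtain ⟨s, -, hs⟩ := (Quotient.functor_map_eq_iff _ _ _).1 h₀
  have := hs x
  rw [lin_id, lin_zero, LinearMap.zero_apply, zero_add, LinearMap.id_apply] at this
  refine hx (this ▸ add_mem (hM.d_mem_plus h _) (plus_le_comap s (hM.d_mem_plus h _)))

/-- By π-regularity a homotopy idempotent lifts to a strict one, which splits in dgMod through a
filtered summand. -/
theorem IsHatFiltered.exists_split_hot (h : 𝒜.IsPosSemisimple) {M : DGMod 𝒜}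
    (hM : M.IsHatFiltered)
    (e : (DGHot.functor 𝒜).obj M ⟶ (DGHot.functor 𝒜).obj M) (he : e ≫ e = e) :
    ∃ (E : DGMod 𝒜) (i : (DGHot.functor 𝒜).obj E ⟶ (DGHot.functor 𝒜).obj M)
      (r : (DGHot.functor 𝒜).obj M ⟶ (DGHot.functor 𝒜).obj E),
      E.IsHatFiltered ∧ i ≫ r = 𝟙 _ ∧ r ≫ i = e := by
  obtain ⟨p, hp, rfl⟩ := (hM.isStronglyPiRegular h).exists_lift_idempotent
    ((DGHot.functor 𝒜).mapEnd M) (DGHot.functor 𝒜).map_surjective (e := e) he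
  obtain ⟨E, i, r, h₁, h₂⟩ := exists_split_idempotent p hp
  refine ⟨E, (DGHot.functor 𝒜).map i, (DGHot.functor 𝒜).map r, hM.of_retract i r h₁, ?_, ?_⟩
  · rw [← Functor.map_comp, h₁, CategoryTheory.Functor.map_id]
  · rw [← Functor.map_comp, h₂]
    rfl

/-- X and a filtered E split the same idempotent of M₀ in the homotopy category, hence are
isomorphic there. -/
theorem IsFilteredRetract.exists_iso (h : 𝒜.IsPosSemisimple) {X : DGHot 𝒜}
    (hX : X.as.IsFilteredRetract) :
    ∃ M : DGMod 𝒜, M.IsHatFiltered ∧ Nonempty (X ≅ (DGHot.functor 𝒜).obj M) := by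
  obtain ⟨M₀, hM₀, hr⟩ := hX
  obtain ⟨i, r, hir⟩ := homotopyRetract_iff.1 hr
  obtain ⟨E, i', r', hE, h₁, h₂⟩ := hM₀.exists_split_hot h (r ≫ i) (by
    rw [Category.assoc, ← Category.assoc i, hir, Category.id_comp])
  refine ⟨E, hE, ⟨⟨i ≫ r', i' ≫ r, ?_, ?_⟩⟩⟩
  · calc (i ≫ r') ≫ i' ≫ r = i ≫ (r' ≫ i') ≫ r := by simp only [Category.assoc]
      _ = (i ≫ r) ≫ i ≫ r := by rw [h₂]; simp only [Category.assoc]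
      _ = 𝟙 _ := by rw [hir, Category.comp_id]
  · calc (i' ≫ r) ≫ i ≫ r' = i' ≫ (r ≫ i) ≫ r' := by simp only [Category.assoc]
      _ = (i' ≫ r') ≫ i' ≫ r' := by rw [← h₂]; simp only [Category.assoc]
      _ = 𝟙 _ := by rw [h₁, Category.comp_id]

theorem IsFilteredRetract.exists_split (h : 𝒜.IsPosSemisimple) {X : DGHot 𝒜}
    (hX : X.as.IsFilteredRetract) (e : X ⟶ X) (he : e ≫ e = e) :
    ∃ (Y : DGHot 𝒜) (i : Y ⟶ X) (r : X ⟶ Y), i ≫ r = 𝟙 Y ∧ r ≫ i = e := by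
  obtain ⟨M, hM, ⟨φ⟩⟩ := hX.exists_iso h
  obtain ⟨E, i, r, -, h₁, h₂⟩ := hM.exists_split_hot h (φ.inv ≫ e ≫ φ.hom) (by
    simp only [Category.assoc, φ.hom_inv_id_assoc]
    rw [← Category.assoc e e, he])
  refine ⟨_, i ≫ φ.inv, φ.hom ≫ r, ?_, ?_⟩
  · simp [h₁]
  · calc (φ.hom ≫ r) ≫ i ≫ φ.inv = φ.hom ≫ (r ≫ i) ≫ φ.inv := by simp only [Category.assoc]
      _ = e := by rw [h₂]; simp

theorem IsFilteredRetract.isStronglyPiRegular (h : 𝒜.IsPosSemisimple) {X : DGHot 𝒜}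
    (hX : X.as.IsFilteredRetract) : IsStronglyPiRegular (End X) := by
  obtain ⟨M, hM, ⟨φ⟩⟩ := hX.exists_iso h
  have := (hM.isStronglyPiRegular h).of_surjective ((DGHot.functor 𝒜).mapEnd M)
    (DGHot.functor 𝒜).map_surjective
  exact this.of_surjective φ.symm.conj.toMonoidHom φ.symm.conj.surjective

theorem IsHatFiltered.isLocalRing_end_hot (h : 𝒜.IsPosSemisimple) {M : DGMod 𝒜}
    (hM : M.IsHatFiltered) (hl : IsLocalRing (End M)) :
    IsLocalRing (End ((DGHot.functor 𝒜).obj M)) :=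
  isLocalRing_end_map _ hl fun h₀ => not_isZero_of_nontrivial_end (hM.isZero_of_map h h₀)

end DGMod

/-! ### The category `dgPer` -/

section DGPer

open DGMod

variable {k : Type w} {A : Type u} [CommRing k] [Ring A] [Algebra k A] {𝒜 : DGAlgebra k A}

/-- Homotopy retracts of filtered modules form a strict triangulated subcategory that contains A and
is closed under summands, and dgPer is the smallest such. -/
theorem dgPer.isFilteredRetract (h : 𝒜.IsPosSemisimple) {X : DGHot 𝒜} (hX : dgPer 𝒜 X) :
    X.as.IsFilteredRetract := by
  have hr : ∀ X Y : DGHot 𝒜, ∀ (i : X ⟶ Y) (r : Y ⟶ X), i ≫ r = 𝟙 X →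
      Y.as.IsFilteredRetract → X.as.IsFilteredRetract :=
    fun X Y i r hir hY => hY.of_retract (homotopyRetract_iff.2 ⟨i, r, hir⟩)
  refine hX (fun X => X.as.IsFilteredRetract)
    ⟨fun X Y e => hr Y X e.inv e.hom e.inv_hom_id, ?_, fun n M hM => hM.shiftObj n,
      fun M N f hM hN => hM.cone h hN f⟩ ?_ (isHatFiltered_ofAlgebra h).isFilteredRetract
  · exact ⟨(DGHot.functor 𝒜).obj (ofAlgebra 𝒜), (isHatFiltered_ofAlgebra h).isFilteredRetract⟩
  · intro Y Z W hs hY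
    obtain ⟨i, r, i', r', h₁, -⟩ := hs.exists_total
    exact hr Z Y i r h₁ hY

/-- Closure is only given for summands with a complement; the complement comes from splitting the
idempotent 1 - r i on Y. -/
theorem dgPer.of_retract (h : 𝒜.IsPosSemisimple) {X Y : DGHot 𝒜} (hY : dgPer 𝒜 Y) (i : X ⟶ Y)
    (r : Y ⟶ X) (hir : i ≫ r = 𝟙 X) : dgPer 𝒜 X := by
  have he : (𝟙 Y - r ≫ i) ≫ (𝟙 Y - r ≫ i) = 𝟙 Y - r ≫ i :=
    (IsIdempotentElem.one_sub (R := End Y) (a := r ≫ i) (by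
      change (r ≫ i) ≫ r ≫ i = r ≫ i
      rw [Category.assoc, ← Category.assoc i, hir, Category.id_comp]))
  obtain ⟨Z, i', r', h₁, h₂⟩ := (hY.isFilteredRetract h).exists_split h _ he
  exact fun P hP hP' hA => hP' Y X Z
    (isBinaryDirectSum_of_split (r ≫ i) i r i' r' hir rfl h₁ h₂) (hY P hP hP' hA)

theorem dgPer_ofAlgebra (𝒜 : DGAlgebra k A) : dgPer 𝒜 ((DGHot.functor 𝒜).obj (ofAlgebra 𝒜)) :=
  fun _ _ _ hA => hA

/-- The direct sum is built as the cone of a zero map out of a shift, so the triangulated closure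
properties apply directly. -/
theorem dgPer_directSum {M N : DGMod 𝒜} (hM : dgPer 𝒜 ((DGHot.functor 𝒜).obj M))
    (hN : dgPer 𝒜 ((DGHot.functor 𝒜).obj N)) :
    dgPer 𝒜 ((DGHot.functor 𝒜).obj (directSum M N)) :=
  fun P hP hP' hA => hP.cone _ _ _ (hP.shift _ _ (hN P hP hP' hA)) (hM P hP hP' hA)

theorem dgPer_of_isZero (h : 𝒜.IsPosSemisimple) {Z : DGHot 𝒜} (hZ : IsZero Z) : dgPer 𝒜 Z :=
  (dgPer_ofAlgebra 𝒜).of_retract h 0 0 (hZ.eq_of_src _ _)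

theorem hasFiniteBiproducts_fullSubcategory (P : ObjectProperty (DGHot 𝒜))
    (hP₀ : ∀ M : DGMod 𝒜, Subsingleton M.carrier → P ((DGHot.functor 𝒜).obj M))
    (hP : ∀ M N : DGMod 𝒜, P ((DGHot.functor 𝒜).obj M) → P ((DGHot.functor 𝒜).obj N) →
      P ((DGHot.functor 𝒜).obj (directSum M N))) :
    HasFiniteBiproducts P.FullSubcategory := by
  refine hasFiniteBiproducts_of_isBinaryDirectSum ?_ fun Y Z => ?_
  · have := subsingleton_zero (ofAlgebra 𝒜)
    exact ⟨⟨_, hP₀ (DGSubmodule.zero (ofAlgebra 𝒜)).toDGMod this⟩,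
      isZero_of_map P.ι (isZero_map (isZero_of_subsingleton _) (DGHot.functor 𝒜))⟩
  · exact ⟨⟨_, hP Y.obj.as Z.obj.as Y.property Z.property⟩,
      IsBinaryDirectSum.of_map P.ι
        ((isBinaryDirectSum_directSum Y.obj.as Z.obj.as).map (DGHot.functor 𝒜))⟩

/-- Every object of `dgPer` is a finite direct sum of objects with local endomorphism rings. -/
theorem dgPer_exists_decomposition (h : 𝒜.IsPosSemisimple) (N : (dgPer 𝒜).FullSubcategory) :
    ∃ (n : ℕ) (Y : Fin n → (dgPer 𝒜).FullSubcategory),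
      (∀ j, IsLocalRing (End (Y j))) ∧ IsDirectSumOf N Y := by
  obtain ⟨M, hM, ⟨φ⟩⟩ := (dgPer.isFilteredRetract h N.property).exists_iso h
  obtain ⟨n, Y, hY, hs⟩ := hM.exists_decomposition h
  have hs' : IsDirectSumOf N.obj _ := (hs.map (DGHot.functor 𝒜)).of_iso φ.symm
  -- The summands lie in dgPer as retracts of N; it is not needed that every filtered module lies in
  -- dgPer.
  have hY' : ∀ j, dgPer 𝒜 ((DGHot.functor 𝒜).obj (Y j)) := fun j => by
    obtain ⟨i, r, h₁, -⟩ := hs'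
    exact dgPer.of_retract h N.property (i j) (r j) (h₁ j)
  exact ⟨n, fun j => ⟨_, hY' j⟩,
    fun j => isLocalRing_end_of_map (dgPer 𝒜).ι ((hY j).1.isLocalRing_end_hot h (hY j).2),
    IsDirectSumOf.of_map (dgPer 𝒜).ι hs'⟩

/-- Indecomposability is tested inside dgPer, so the idempotents of N must split there; the
splittings in dgHot qualify because dgPer is closed under retracts. -/
theorem dgPer_hasFittingEnd (h : 𝒜.IsPosSemisimple) {N : (dgPer 𝒜).FullSubcategory}
    (hN : IsIndecomposable N) : HasFittingEnd N.obj := by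
  have hN' := dgPer.isFilteredRetract h N.property
  refine hasFittingEnd_of_isStronglyPiRegular (fun h₀ => hN.1 (isZero_of_map (dgPer 𝒜).ι h₀))
    (hN'.isStronglyPiRegular h) fun e he => ?_
  refine (hN.eq_zero_or_one (fun e he => ?_) (ObjectProperty.homMk e)
    (ObjectProperty.hom_ext _ he)).imp (fun h' => congrArg (fun f => f.hom) h')
      (fun h' => congrArg (fun f => f.hom) h')
  obtain ⟨Y, i, r, h₁, h₂⟩ := hN'.exists_split h e.hom (congrArg (fun f => f.hom) he)
  exact ⟨⟨Y, dgPer.of_retract h N.property i r h₁⟩, ObjectProperty.homMk i,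
    ObjectProperty.homMk r, ObjectProperty.hom_ext _ h₁, ObjectProperty.hom_ext _ h₂⟩

/-! ### The category `dgFilt` -/

theorem dgFilt_iff (h : 𝒜.IsPosSemisimple) (X : DGHot 𝒜) : dgFilt h X ↔ X.as.IsHatFiltered :=
  hasHatFiltration_iff h X.as

/-- A decomposition in dgMod has filtered summands and so gives one in dgFilt; the summand that is
zero up to homotopy is already zero in dgMod. -/
theorem dgFilt_isIndecomposable_as (h : 𝒜.IsPosSemisimple) {M : (dgFilt h).FullSubcategory}
    (hM : IsIndecomposable M) : IsIndecomposable M.obj.as := by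
  have hM' := (dgFilt_iff h _).1 M.property
  refine ⟨fun h₀ => hM.1 (isZero_of_map (dgFilt h).ι (isZero_map h₀ (DGHot.functor 𝒜))),
    fun Y Z hs => ?_⟩
  have hY := hM'.of_isBinaryDirectSum hs
  have hZ := hM'.of_isBinaryDirectSum hs.symm
  refine (hM.2 ⟨(DGHot.functor 𝒜).obj Y, (dgFilt_iff h _).2 hY⟩
    ⟨(DGHot.functor 𝒜).obj Z, (dgFilt_iff h _).2 hZ⟩
    (IsBinaryDirectSum.of_map (dgFilt h).ι (hs.map (DGHot.functor 𝒜)))).imp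
    (fun h₀ => hY.isZero_of_map h (by exact isZero_map h₀ (dgFilt h).ι))
    (fun h₀ => hZ.isZero_of_map h (by exact isZero_map h₀ (dgFilt h).ι))

theorem dgFilt_exists_decomposition (h : 𝒜.IsPosSemisimple) (M : (dgFilt h).FullSubcategory) :
    ∃ (n : ℕ) (Y : Fin n → (dgFilt h).FullSubcategory),
      (∀ j, IsLocalRing (End (Y j)) ∧ IsLocalRing (End (Y j).obj.as)) ∧
      IsDirectSumOf M Y ∧ IsDirectSumOf M.obj.as (fun j => (Y j).obj.as) := by
  obtain ⟨n, Y, hY, hs⟩ := ((dgFilt_iff h _).1 M.property).exists_decomposition h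
  exact ⟨n, fun j => ⟨(DGHot.functor 𝒜).obj (Y j), (dgFilt_iff h _).2 (hY j).1⟩,
    fun j => ⟨isLocalRing_end_of_map (dgFilt h).ι ((hY j).1.isLocalRing_end_hot h (hY j).2),
      (hY j).2⟩, IsDirectSumOf.of_map (dgFilt h).ι (hs.map (DGHot.functor 𝒜)), hs⟩

end DGPer

/-! ### Assembly of the three statements -/

theorem proposition8p6 {k : Type w} {A : Type u} [CommRing k] [Ring A] [Algebra k A]
    (𝒜 : DGAlgebra k A) (h : 𝒜.IsPosSemisimple) :
    -- (1) indecomposables of `dgFilt`, in `dgMod` or equivalently in `dgFilt`, and of `dgPer`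
    (∀ M : (dgFilt h).FullSubcategory, (IsIndecomposable M.obj.as ∨ IsIndecomposable M) →
      HasFittingEnd M.obj.as) ∧
    (∀ N : (dgPer 𝒜).FullSubcategory, IsIndecomposable N → HasFittingEnd N.obj) ∧
    -- (2) decompositions into indecomposables
    (∀ M : (dgFilt h).FullSubcategory, ∃ (n : ℕ) (Y : Fin n → (dgFilt h).FullSubcategory),
      (∀ i, IsIndecomposable (Y i) ∧ IsIndecomposable (Y i).obj.as) ∧
      IsFiniteDirectSum M Y ∧ IsFiniteDirectSum M.obj.as (fun i => (Y i).obj.as)) ∧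
    (∀ N : (dgPer 𝒜).FullSubcategory, ∃ (n : ℕ) (Y : Fin n → (dgPer 𝒜).FullSubcategory),
      (∀ i, IsIndecomposable (Y i)) ∧ IsFiniteDirectSum N Y) ∧
    -- (3) the Krull-Remak-Schmidt property
    IsKrullRemakSchmidt (dgFilt h).FullSubcategory ∧
    IsKrullRemakSchmidt (dgPer 𝒜).FullSubcategory := by
  refine ⟨fun M hM => ?_, fun N hN => dgPer_hasFittingEnd h hN, fun M => ?_, fun N => ?_, ?_, ?_⟩
  · exact (hM.elim id (dgFilt_isIndecomposable_as h)).hasFittingEnd_dgMod h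
      ((dgFilt_iff h _).1 M.property)
  · obtain ⟨n, Y, hY, hs, hs'⟩ := dgFilt_exists_decomposition h M
    exact ⟨n, Y, fun i => ⟨isIndecomposable_of_isLocalRing (hY i).1,
      isIndecomposable_of_isLocalRing (hY i).2⟩, hs.isFiniteDirectSum, hs'.isFiniteDirectSum⟩
  · obtain ⟨n, Y, hY, hs⟩ := dgPer_exists_decomposition h N
    exact ⟨n, Y, fun i => isIndecomposable_of_isLocalRing (hY i), hs.isFiniteDirectSum⟩
  · refine ⟨hasFiniteBiproducts_fullSubcategory (dgFilt h)
      (fun M hM => (dgFilt_iff h _).2 M.isHatFiltered_of_subsingleton)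
      (fun M N hM hN => (dgFilt_iff h _).2 ?_), fun M => ?_⟩
    · exact ((dgFilt_iff h _).1 hM).of_isBinaryDirectSum_of_summands ((dgFilt_iff h _).1 hN)
        (DGMod.isBinaryDirectSum_directSum M N)
    · obtain ⟨n, Y, hY, hs, -⟩ := dgFilt_exists_decomposition h M
      exact ⟨n, Y, fun i => (hY i).1, hs.isFiniteDirectSum⟩
  · refine ⟨hasFiniteBiproducts_fullSubcategory (dgPer 𝒜)
      (fun M hM => dgPer_of_isZero h (isZero_map M.isZero_of_subsingleton (DGHot.functor 𝒜)))
      (fun M N hM hN => dgPer_directSum hM hN), fun N => ?_⟩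
    obtain ⟨n, Y, hY, hs⟩ := dgPer_exists_decomposition h N
    exact ⟨n, Y, hY, hs.isFiniteDirectSum⟩
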